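/- Let $n\ge 1$ and let $\mathbb{H}^n=\mathbb{C}^n\times\mathbb{R}$ be the Heisenberg group with group law $(z,t)(w,t')=(z+w,\,t+t'+\tfrac12\Im(z\cdot\bar w))$ and Lebesgue (Haar) measure. Writing $z_j=x_j+iy_j$, let $$X_j=\frac{\partial}{\partial x_j}+\frac12 y_j\frac{\partial}{\partial t},\qquad Y_j=\frac{\partial}{\partial y_j}-\frac12 x_j\frac{\partial}{\partial t}\quad(1\le j\le n),\qquad T=\frac{\partial}{\partial t},$$ and let $\mathcal{L}=-\sum_{j=1}^n(X_j^2+Y_j^2)$ be the sublaplacian; the same letter denotes the non-negative self-adjoint operator in $L^2(\mathbb{H}^n)$ that it defines. For $s\ge 0$ let $W^{s,2}(\mathbb{H}^n)$ be the Hilbert space of all $f=(I+\mathcal{L})^{-s/2}f_0$ with $f_0\in L^2(\mathbb{H}^n)$, with inner product $\langle f,g\rangle_s=\langle f_0,g_0\rangle_{L^2}$ for $f=(I+\mathcal{L})^{-s/2}f_0$ and $g=(I+\mathcal{L})^{-s/2}g_0$. Let $D(A)$ be the space of all smooth functions $f:\mathbb{H}^n\to\mathbb{C}$ such that for all $\alpha,\beta\in\mathbb{N}^n$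 and $j\in\mathbb{N}$ (with $0\in\mathbb{N}$) the derivative $X^\alpha Y^\beta T^jf$ is in $L^2(\mathbb{H}^n)$ and vanishes at the origin, and let $A$ be the restriction of $\mathcal{L}$ to $D(A)$. If $n-1<s\le n+1$, then $f$ and $\mathcal{L}f$ are in $W^{s,2}(\mathbb{H}^n)$ for every $f\in D(A)$, so that $A$ is an operator in $W^{s,2}(\mathbb{H}^n)$; the domain $D(A)$ is dense in $W^{s,2}(\mathbb{H}^n)$ and $A$ is symmetric there, but $(I+A)D(A)$ is not dense in $W^{s,2}(\mathbb{H}^n)$, and $A$ is not essentially self-adjoint, that is, its closure is not self-adjoint. -/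

import Mathlib

open MeasureTheory
open scoped NNReal ContDiff InnerProductSpace

noncomputable section

namespace Heisenberg

/-- The underlying manifold `ℂⁿ × ℝ` of the Heisenberg group. The group law is
`(z, t) (w, s) = (z + w, t + s + Im (z · conj w) / 2)`; its identity is `0` and its Haar measure is
the Lebesgue measure `volume`. -/
abbrev Heis (n : ℕ) : Type := (Fin n → ℂ) × ℝ

/-- Smooth complex-valued functions on the Heisenberg group. -/
def Smooth (n : ℕ) : Submodule ℂ (Heis n → ℂ) where
  carrier := {f | ContDiff ℝ ∞ f}
  add_mem' {f g} (hf : ContDiff ℝ ∞ f) (hg : ContDiff ℝ ∞ g) :=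
    show ContDiff ℝ ∞ (f + g) from hf.add hg
  zero_mem' := show ContDiff ℝ ∞ (fun _ => 0) from contDiff_const
  smul_mem' c f (hf : ContDiff ℝ ∞ f) := show ContDiff ℝ ∞ (c • f) from hf.const_smul c

theorem contDiff_coe {n : ℕ} (f : Smooth n) : ContDiff ℝ ∞ (f : Heis n → ℂ) := f.2

theorem differentiableAt_coe {n : ℕ} (f : Smooth n) (p : Heis n) :
    DifferentiableAt ℝ (f : Heis n → ℂ) p :=
  ((contDiff_coe f).differentiable (by simp)).differentiableAt

/-- A smooth vector field `v`, acting on smooth functions as a first order differential operator. -/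
def fieldOp {n : ℕ} (v : Heis n → Heis n) (hv : ContDiff ℝ ∞ v) : Module.End ℂ (Smooth n) where
  toFun f := ⟨fun p => fderiv ℝ (f : Heis n → ℂ) p (v p),
    show ContDiff ℝ ∞ _ from ((contDiff_coe f).fderiv_right (m := ∞) (by simp)).clm_apply hv⟩
  map_add' f g := by
    ext p
    simp [fderiv_add (differentiableAt_coe f p) (differentiableAt_coe g p)]
  map_smul' c f := by
    ext p
    simp [fderiv_const_smul (differentiableAt_coe f p) c]

/-- The left invariant field `X_j = ∂/∂x_j + (y_j / 2) ∂/∂t`, where `z_j = x_j + i y_j`. -/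
def X {n : ℕ} (j : Fin n) : Module.End ℂ (Smooth n) :=
  fieldOp (fun p => (Pi.single j 1, (p.1 j).im / 2)) <| by
    have h : ContDiff ℝ ∞ fun p : Heis n => Complex.imCLM (p.1 j) := by fun_prop
    exact contDiff_const.prodMk (h.div_const 2)

/-- The left invariant field `Y_j = ∂/∂y_j - (x_j / 2) ∂/∂t`, where `z_j = x_j + i y_j`. -/
def Y {n : ℕ} (j : Fin n) : Module.End ℂ (Smooth n) :=
  fieldOp (fun p => (Pi.single j Complex.I, -((p.1 j).re / 2))) <| by
    have h : ContDiff ℝ ∞ fun p : Heis n => Complex.reCLM (p.1 j) := by fun_prop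
    exact contDiff_const.prodMk (h.div_const 2).neg

/-- The central field `T = ∂/∂t`. -/
def T (n : ℕ) : Module.End ℂ (Smooth n) :=
  fieldOp (fun _ => (0, 1)) contDiff_const

/-- `X^α = X_1^{α_1} ⋯ X_n^{α_n}`. -/
def Xpow {n : ℕ} (α : Fin n → ℕ) : Module.End ℂ (Smooth n) :=
  (List.ofFn fun j => X j ^ α j).prod

/-- `Y^β = Y_1^{β_1} ⋯ Y_n^{β_n}`. -/
def Ypow {n : ℕ} (β : Fin n → ℕ) : Module.End ℂ (Smooth n) :=
  (List.ofFn fun j => Y j ^ β j).prod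

/-- The sublaplacian `ℒ = -∑_j (X_j² + Y_j²)` on smooth functions. -/
def sublaplacian (n : ℕ) : Module.End ℂ (Smooth n) :=
  -∑ j, (X j ^ 2 + Y j ^ 2)

/-- `L²` of the Heisenberg group. -/
abbrev L2 (n : ℕ) : Type := Lp ℂ 2 (volume : Measure (Heis n))

/-- The Hilbert space in which the horizontal first order jets `(φ, X_1 φ, …, Y_n φ)` live. -/
abbrev JetSpace (n : ℕ) : Type := PiLp 2 fun _ : Option (Fin n ⊕ Fin n) => L2 n

/-- The horizontal jets `(φ, X_1 φ, …, X_n φ, Y_1 φ, …, Y_n φ)` of the functions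
`φ ∈ C_c^∞`. -/
def testJets (n : ℕ) : Submodule ℂ (JetSpace n) where
  carrier := {u | ∃ φ : Smooth n, HasCompactSupport (φ : Heis n → ℂ) ∧
    u none =ᵐ[volume] (φ : Heis n → ℂ) ∧
    (∀ j, u (some (Sum.inl j)) =ᵐ[volume] (X j φ : Heis n → ℂ)) ∧
    ∀ j, u (some (Sum.inr j)) =ᵐ[volume] (Y j φ : Heis n → ℂ)}
  add_mem' := by
    rintro u v ⟨φ, hφ, h0, hX, hY⟩ ⟨ψ, hψ, k0, kX, kY⟩
    refine ⟨φ + ψ, hφ.add hψ, ?_, fun j => ?_, fun j => ?_⟩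
    · exact (Lp.coeFn_add _ _).trans (h0.add k0)
    · rw [map_add]
      exact (Lp.coeFn_add _ _).trans ((hX j).add (kX j))
    · rw [map_add]
      exact (Lp.coeFn_add _ _).trans ((hY j).add (kY j))
  zero_mem' := by
    refine ⟨0, HasCompactSupport.zero, ?_, fun j => ?_, fun j => ?_⟩
    · exact Lp.coeFn_zero _ _ _
    · rw [map_zero]
      exact Lp.coeFn_zero _ _ _
    · rw [map_zero]
      exact Lp.coeFn_zero _ _ _
  smul_mem' := by
    rintro c u ⟨φ, hφ, h0, hX, hY⟩
    refine ⟨c • φ, hφ.smul_left (f := fun _ => c), ?_, fun j => ?_, fun j => ?_⟩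
    · exact (Lp.coeFn_smul _ _).trans (h0.const_smul c)
    · rw [map_smul]
      exact (Lp.coeFn_smul _ _).trans ((hX j).const_smul c)
    · rw [map_smul]
      exact (Lp.coeFn_smul _ _).trans ((hY j).const_smul c)

/-- The domain of the closed quadratic form `u ↦ ∑_j ‖X_j u‖² + ‖Y_j u‖²` of the sublaplacian,
as a closed space of horizontal jets. -/
def formDomain (n : ℕ) : Submodule ℂ (JetSpace n) := (testJets n).topologicalClosure

instance (n : ℕ) : CompleteSpace (formDomain n) :=
  (Submodule.isClosed_topologicalClosure _).completeSpace_coe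

/-- The projection of a jet to its function component. -/
def jetProj (n : ℕ) : JetSpace n →L[ℂ] L2 n := PiLp.proj 2 (fun _ => L2 n) none

/-- The resolvent `(I + ℒ)⁻¹` on `L²` of the (self-adjoint) sublaplacian. By the definition of the
orthogonal projection, `u = resolvent n f` is the unique element of the form domain with
`⟨u, v⟩ + ∑_j (⟨X_j u, X_j v⟩ + ⟨Y_j u, Y_j v⟩) = ⟨f, v⟩` for all `v` in the form domain, which is
the weak form of `(I + ℒ) u = f`. -/
def resolvent (n : ℕ) : L2 n →L[ℂ] L2 n :=
  jetProj n ∘L (formDomain n).starProjection ∘L ContinuousLinearMap.adjoint (jetProj n)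

theorem resolvent_isPositive (n : ℕ) : (resolvent n).IsPositive := by
  have h : ((formDomain n).starProjection).IsPositive :=
    ContinuousLinearMap.IsPositive.of_isStarProjection isStarProjection_starProjection
  simpa [resolvent] using h.conj_adjoint (jetProj n)

theorem exists_testJet {n : ℕ} (φ : Smooth n) (hφ : HasCompactSupport (φ : Heis n → ℂ)) :
    ∃ u ∈ testJets n, jetProj n u =ᵐ[volume] (φ : Heis n → ℂ) := by
  have hsupp : ∀ v hv, HasCompactSupport (fieldOp v hv φ : Heis n → ℂ) := fun v hv => by
    refine (hφ.fderiv (𝕜 := ℝ)).mono fun p hp h0 => hp ?_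
    change fderiv ℝ (φ : Heis n → ℂ) p (v p) = 0
    rw [h0]
    rfl
  have hmem : ∀ ψ : Smooth n, HasCompactSupport (ψ : Heis n → ℂ) →
      MemLp (ψ : Heis n → ℂ) 2 volume := fun ψ hψ =>
    (contDiff_coe ψ).continuous.memLp_of_hasCompactSupport hψ
  refine ⟨WithLp.toLp 2 fun i => match i with
    | none => (hmem φ hφ).toLp _
    | some (Sum.inl j) => (hmem (X j φ) (hsupp _ _)).toLp _
    | some (Sum.inr j) => (hmem (Y j φ) (hsupp _ _)).toLp _, ⟨φ, hφ, ?_, ?_, ?_⟩, ?_⟩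
  · exact (hmem φ hφ).coeFn_toLp
  · exact fun j => (hmem (X j φ) (hsupp _ _)).coeFn_toLp
  · exact fun j => (hmem (Y j φ) (hsupp _ _)).coeFn_toLp
  · exact (hmem φ hφ).coeFn_toLp

theorem resolvent_injective (n : ℕ) : Function.Injective (resolvent n) := by
  refine (injective_iff_map_eq_zero (resolvent n)).2 fun f hf => ?_
  set w := ContinuousLinearMap.adjoint (jetProj n) f with hw
  have h0 : (formDomain n).starProjection w = 0 := by
    rw [← inner_self_eq_zero (𝕜 := ℂ), Submodule.inner_starProjection_left_eq_right,
      (formDomain n).starProjection_eq_self_iff.2 (Submodule.starProjection_apply_mem _ _),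
      ← Submodule.inner_starProjection_left_eq_right, hw,
      ContinuousLinearMap.adjoint_inner_right]
    change ⟪resolvent n f, f⟫_ℂ = 0
    rw [hf, inner_zero_left]
  have horth : ∀ u ∈ testJets n, ⟪jetProj n u, f⟫_ℂ = 0 := fun u hu => by
    rw [← ContinuousLinearMap.adjoint_inner_right, ← hw]
    exact ((Submodule.starProjection_apply_eq_zero_iff _).1 h0) u
      (Submodule.le_topologicalClosure _ hu)
  have hloc : LocallyIntegrable (f : Heis n → ℂ) volume :=
    (Lp.memLp f).locallyIntegrable (by norm_num)
  rw [Lp.eq_zero_iff_ae_eq_zero]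
  refine ae_eq_zero_of_integral_contDiff_smul_eq_zero hloc fun g hg hgs => ?_
  obtain ⟨u, hu, hug⟩ := exists_testJet
    (⟨fun p => (g p : ℂ), Complex.ofRealCLM.contDiff.comp hg⟩ : Smooth n)
    (hgs.comp_left (g := fun x : ℝ => (x : ℂ)) Complex.ofReal_zero)
  rw [← horth u hu, L2.inner_def]
  refine integral_congr_ae ?_
  filter_upwards [hug] with p hp
  rw [hp]
  simp [mul_comm]

/-- The power `a ^ y` of a positive operator in a Hilbert space, in the sense of the (continuous)
functional calculus. -/
def opPow {H : Type*} [NormedAddCommGroup H] [InnerProductSpace ℂ H] [CompleteSpace H]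
    (a : H →L[ℂ] H) (y : ℝ) : H →L[ℂ] H := CFC.rpow a y

theorem opPow_injective {H : Type*} [NormedAddCommGroup H] [InnerProductSpace ℂ H]
    [CompleteSpace H] {a : H →L[ℂ] H} (ha : a.IsPositive) (hinj : Function.Injective a)
    {y : ℝ} (hy : 0 ≤ y) : Function.Injective (opPow a y) := by
  have ha' : 0 ≤ a := ContinuousLinearMap.nonneg_iff_isPositive a |>.mpr ha
  rcases hy.eq_or_lt with rfl | hy
  · have : opPow a 0 = 1 := CFC.rpow_zero a
    rw [this]
    exact Function.injective_id
  · obtain ⟨m, hm⟩ := exists_nat_gt y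
    have key : a ^ m = opPow a (m - y) * opPow a y := by
      rw [← CFC.rpow_natCast a m]
      have hc : ∀ r : ℝ, 0 ≤ r → ContinuousOn (fun x : ℝ≥0 => x ^ r) (spectrum ℝ≥0 a) :=
        fun r hr => (NNReal.continuous_rpow_const hr).continuousOn
      change cfc (fun x : ℝ≥0 => x ^ (m : ℝ)) a =
        cfc (fun x : ℝ≥0 => x ^ ((m : ℝ) - y)) a * cfc (fun x : ℝ≥0 => x ^ y) a
      rw [← cfc_mul _ _ a (hc _ (by linarith)) (hc _ hy.le)]
      refine cfc_congr fun x _ => ?_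
      change x ^ (m : ℝ) = x ^ ((m : ℝ) - y) * x ^ y
      rw [← NNReal.rpow_add_of_nonneg x (by linarith) hy.le, sub_add_cancel]
    have h1 : Function.Injective (a ^ m : H →L[ℂ] H) := by
      simpa using hinj.iterate m
    rw [key] at h1
    exact Function.Injective.of_comp h1

/-- The bounded operator `(I + ℒ)^{-s/2}` on `L²`, for `s ≥ 0`, as a power of the positive operator
`(I + ℒ)⁻¹`. -/
def besselPotential (n : ℕ) (s : ℝ≥0) : L2 n →L[ℂ] L2 n := opPow (resolvent n) ((s : ℝ) / 2)

theorem besselPotential_injective (n : ℕ) (s : ℝ≥0) :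
    Function.Injective (besselPotential n s) :=
  opPow_injective (resolvent_isPositive n) (resolvent_injective n) (by positivity)

/-- The Sobolev space `W^{s,2}`, `s ≥ 0`: the space of all `f = (I + ℒ)^{-s/2} f₀` with
`f₀ ∈ L²`. -/
def Sobolev (n : ℕ) (s : ℝ≥0) : Type := LinearMap.range (besselPotential n s).toLinearMap

namespace Sobolev

variable {n : ℕ} {s : ℝ≥0}

instance : AddCommGroup (Sobolev n s) :=
  inferInstanceAs (AddCommGroup (LinearMap.range (besselPotential n s).toLinearMap))

instance : Module ℂ (Sobolev n s) :=
  inferInstanceAs (Module ℂ (LinearMap.range (besselPotential n s).toLinearMap))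

/-- The inclusion of `W^{s,2}` in `L²`. -/
def toL2 : Sobolev n s →ₗ[ℂ] L2 n :=
  (LinearMap.range (besselPotential n s).toLinearMap).subtype

/-- The bijection `f₀ ↦ (I + ℒ)^{-s/2} f₀` of `L²` to `W^{s,2}`. -/
def ofL2 (n : ℕ) (s : ℝ≥0) : L2 n ≃ₗ[ℂ] Sobolev n s :=
  LinearEquiv.ofInjective (besselPotential n s).toLinearMap (besselPotential_injective n s)

/-- The norm `‖f‖_{(s)} = ‖(I + ℒ)^{s/2} f‖ = ‖f₀‖` for `f = (I + ℒ)^{-s/2} f₀`. -/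
instance : NormedAddCommGroup (Sobolev n s) :=
  NormedAddCommGroup.induced _ _ (ofL2 n s).symm (ofL2 n s).symm.injective

/-- The inner product `⟨f, g⟩_s = ⟨f₀, g₀⟩` for `f = (I + ℒ)^{-s/2} f₀`,
`g = (I + ℒ)^{-s/2} g₀`. -/
instance : InnerProductSpace ℂ (Sobolev n s) where
  norm_smul_le c f := by
    change ‖(ofL2 n s).symm (c • f)‖ ≤ ‖c‖ * ‖(ofL2 n s).symm f‖
    rw [map_smul, norm_smul]
  inner f g := ⟪(ofL2 n s).symm f, (ofL2 n s).symm g⟫_ℂ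
  norm_sq_eq_re_inner f := norm_sq_eq_re_inner ((ofL2 n s).symm f)
  conj_inner_symm f g := inner_conj_symm ((ofL2 n s).symm f) ((ofL2 n s).symm g)
  add_left f g h := by rw [map_add, inner_add_left]
  smul_left f g c := by rw [map_smul, inner_smul_left]

instance : CompleteSpace (Sobolev n s) := by
  have h : Isometry (ofL2 n s) := AddMonoidHomClass.isometry_of_norm (ofL2 n s) fun f => by
    change ‖(ofL2 n s).symm (ofL2 n s f)‖ = ‖f‖
    rw [LinearEquiv.symm_apply_apply]
  exact (IsometryEquiv.mk (ofL2 n s).toEquiv h).completeSpace_iff.mp inferInstance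

end Sobolev

/-- The space of all smooth functions `f` such that all the derivatives `X^α Y^β T^k f` are in `L²`
and vanish at the origin. -/
def flatFunctions (n : ℕ) : Submodule ℂ (Smooth n) where
  carrier := {f | ∀ (α β : Fin n → ℕ) (k : ℕ),
    MemLp (Xpow α (Ypow β ((T n ^ k) f)) : Heis n → ℂ) 2 volume ∧
    (Xpow α (Ypow β ((T n ^ k) f)) : Heis n → ℂ) 0 = 0}
  add_mem' hf hg α β k := by
    refine ⟨?_, ?_⟩
    · rw [map_add, map_add, map_add]
      exact (hf α β k).1.add (hg α β k).1
    · simp [(hf α β k).2, (hg α β k).2]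
  zero_mem' α β k := by simp
  smul_mem' c f hf α β k := by
    refine ⟨?_, ?_⟩
    · rw [map_smul, map_smul, map_smul]
      exact (hf α β k).1.const_smul c
    · simp [(hf α β k).2]

/-- The graph of the sublaplacian, restricted to the above space of functions, as a subset of
`W^{s,2} × W^{s,2}`. -/
def graphA (n : ℕ) (s : ℝ≥0) : Submodule ℂ (Sobolev n s × Sobolev n s) where
  carrier := {u | ∃ f ∈ flatFunctions n, u.1.toL2 =ᵐ[volume] (f : Heis n → ℂ) ∧
    u.2.toL2 =ᵐ[volume] (sublaplacian n f : Heis n → ℂ)}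
  add_mem' := by
    rintro u v ⟨f, hf, h1, h2⟩ ⟨g, hg, k1, k2⟩
    refine ⟨f + g, add_mem hf hg, ?_, ?_⟩
    · rw [Prod.fst_add, map_add]
      exact (Lp.coeFn_add _ _).trans (h1.add k1)
    · rw [Prod.snd_add, map_add, map_add]
      exact (Lp.coeFn_add _ _).trans (h2.add k2)
  zero_mem' := by
    refine ⟨0, zero_mem _, ?_, ?_⟩
    · rw [Prod.fst_zero, map_zero]
      exact Lp.coeFn_zero _ _ _
    · rw [Prod.snd_zero, map_zero, map_zero]
      exact Lp.coeFn_zero _ _ _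
  smul_mem' := by
    rintro c u ⟨f, hf, h1, h2⟩
    refine ⟨c • f, Submodule.smul_mem _ c hf, ?_, ?_⟩
    · rw [Prod.smul_fst, map_smul]
      exact (Lp.coeFn_smul _ _).trans (h1.const_smul c)
    · rw [Prod.smul_snd, map_smul, map_smul]
      exact (Lp.coeFn_smul _ _).trans (h2.const_smul c)

/-- The operator `A` in the Hilbert space `W^{s,2}`: the sublaplacian with domain the functions all
of whose derivatives `X^α Y^β T^k f` are in `L²` and vanish at the origin. -/
def opA (n : ℕ) (s : ℝ≥0) : Sobolev n s →ₗ.[ℂ] Sobolev n s := (graphA n s).toLinearPMap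

end Heisenberg

/-- An unbounded operator in a Hilbert space is essentially self-adjoint if it is densely defined
and symmetric and its closure is self-adjoint. -/
def IsEssentiallySelfAdjoint {H : Type*} [NormedAddCommGroup H] [InnerProductSpace ℂ H]
    [CompleteSpace H] (A : H →ₗ.[ℂ] H) : Prop :=
  Dense (A.domain : Set H) ∧ A.IsFormalAdjoint A ∧ IsSelfAdjoint A.closure

end

/-!
The operator `A` is the sublaplacian restricted to functions that are flat at the origin.

*Density.* Let `χ` be a cutoff equal to `1` near the origin and `δ_r` the dilations. A test function
`φ` differs from the flat function `(1 - χ ∘ δ_r) φ` by `(χ ∘ δ_r) φ`, whose `L²` norm is of order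
`r⁻⁽ⁿ⁺¹⁾` because the homogeneous dimension is `2n + 2`. Up to the exponent `s = n + 1` its
`W^{s,2}` norm stays bounded as `r → ∞`, so it tends weakly to `0`; a subspace that is weakly dense
is dense.

*Obstruction.* Since `s + 2 > n + 1`, evaluation at the origin is continuous for the `W^{s+2,2}`
norm: a fixed local estimate is rescaled by dilations and summed over dyadic pieces of the
spectrum of `(I + ℒ)⁻¹`. Hence `f ↦ ((I + ℒ)⁻¹ f)(0)` is a nonzero bounded functional on `W^{s,2}`
that vanishes on `(I + A) D(A)`. As `‖f‖ ≤ ‖(I + A) f‖`, a self-adjoint closure would make that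
range dense.

Self-adjointness of `ℒ` enters through density of `(I + ℒ)^m C_c^∞` in `L²`: a function
orthogonal to that range becomes, after regularization by group convolution, a smooth solution
of `(I + ℒ)^m u = 0` of polynomial growth, and a Caccioppoli estimate on growing balls forces
`u = 0`.
-/

noncomputable section

section MixedDeriv

open ContDiff

variable {ι : Type*} [DecidableEq ι] {G : (ι → ℝ) → ℂ}

/-- The mixed partial derivative `∂_{i₁} ⋯ ∂_{iₖ} G` along a list of coordinates. -/
def mixedDeriv (l : List ι) (G : (ι → ℝ) → ℂ) : (ι → ℝ) → ℂ :=
  l.foldr (fun i H y => fderiv ℝ H y (Pi.single i 1)) G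

theorem mixedDeriv_cons (i : ι) (l : List ι) (G : (ι → ℝ) → ℂ) :
    mixedDeriv (i :: l) G = fun y => fderiv ℝ (mixedDeriv l G) y (Pi.single i 1) := rfl

theorem hasCompactSupport_mixedDeriv (l : List ι) (hG : HasCompactSupport G) :
    HasCompactSupport (mixedDeriv l G) := by
  induction l with
  | nil => exact hG
  | cons i l ih => exact ih.fderiv_apply (𝕜 := ℝ) _

variable [Fintype ι]

theorem contDiff_mixedDeriv (l : List ι) (hG : ContDiff ℝ ∞ G) :
    ContDiff ℝ ∞ (mixedDeriv l G) := by
  induction l with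
  | nil => exact hG
  | cons i l ih => exact (ih.fderiv_right (m := ∞) (by simp)).clm_apply contDiff_const

theorem enorm_le_lintegral_fderiv_update (i : ι) (hG : ContDiff ℝ ∞ G) (hc : HasCompactSupport G)
    (x : ι → ℝ) :
    ‖G x‖ₑ ≤ ∫⁻ t, ‖fderiv ℝ G (Function.update x i t) (Pi.single i 1)‖ₑ := by
  have hderiv (t : ℝ) : deriv (G ∘ Function.update x i) t =
      fderiv ℝ G (Function.update x i t) (Pi.single i 1) := by
    rw [fderiv_comp_deriv _ (hG.differentiable (by simp)).differentiableAt
      (hasDerivAt_update x i t).differentiableAt, deriv_update]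
  simp only [← hderiv]
  calc ‖G x‖ₑ ≤ ∫⁻ t in Set.Iic (x i), ‖deriv (G ∘ Function.update x i) t‖ₑ := by
        refine le_trans (by simp) (HasCompactSupport.enorm_le_lintegral_Ici_deriv ?_ ?_ (x i))
        · exact (hG.of_le (by simp)).comp (by convert! contDiff_update 1 x i)
        · exact hc.comp_isClosedEmbedding (isClosedEmbedding_update x i)
    _ ≤ _ := setLIntegral_le_lintegral _ _

theorem enorm_le_lmarginal_mixedDeriv {l : List ι} (hl : l.Nodup) (hG : ContDiff ℝ ∞ G)
    (hc : HasCompactSupport G) (x : ι → ℝ) :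
    ‖G x‖ₑ ≤ (∫⋯∫⁻_l.toFinset, (fun y => ‖mixedDeriv l G y‖ₑ) ∂fun _ => volume) x := by
  induction l with
  | nil => simp [mixedDeriv]
  | cons i l ih =>
    obtain ⟨hi, hl⟩ := List.nodup_cons.1 hl
    rw [List.toFinset_cons, lmarginal_insert' _
      (contDiff_mixedDeriv (i :: l) hG).continuous.enorm.measurable (by simpa using hi)]
    exact (ih hl).trans (lmarginal_mono (fun y => enorm_le_lintegral_fderiv_update i
      (contDiff_mixedDeriv l hG) (hasCompactSupport_mixedDeriv l hc) y) x)

end MixedDeriv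

theorem integrable_mul_comp_snd_of_hasCompactSupport {X Y : Type*} [TopologicalSpace X] [T2Space X]
    [SecondCountableTopology X] [MeasurableSpace X] [BorelSpace X] {μ : Measure X} [SFinite μ]
    [IsFiniteMeasureOnCompacts μ] [TopologicalSpace Y] [T2Space Y] [SecondCountableTopology Y]
    [MeasurableSpace Y] [BorelSpace Y] {ν : Measure Y} [SFinite ν] {Φ : X × Y → ℂ}
    (hΦ : Continuous Φ) (hs : HasCompactSupport Φ) {G : Y → ℂ} (hG : LocallyIntegrable G ν) :
    Integrable (fun z => Φ z * G z.2) (μ.prod ν) := by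
  have hK₁ : IsCompact (Prod.fst '' tsupport Φ) := IsCompact.image hs continuous_fst
  have hK₂ : IsCompact (Prod.snd '' tsupport Φ) := IsCompact.image hs continuous_snd
  have h₁ : Integrable ((Prod.fst '' tsupport Φ).indicator fun _ => (1 : ℂ)) μ :=
    (integrable_indicator_iff hK₁.measurableSet).2 (integrableOn_const hK₁.measure_ne_top)
  have h₂ : Integrable ((Prod.snd '' tsupport Φ).indicator G) ν :=
    (integrable_indicator_iff hK₂.measurableSet).2 (hG.integrableOn_isCompact hK₂)
  obtain ⟨C, hC⟩ := hs.exists_bound_of_continuous hΦ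
  refine ((h₁.mul_prod h₂).bdd_mul hΦ.aestronglyMeasurable (.of_forall hC)).congr
    (.of_forall fun z => ?_)
  by_cases hz : z ∈ tsupport Φ
  · simp only [Set.indicator_of_mem (Set.mem_image_of_mem Prod.fst hz),
      Set.indicator_of_mem (Set.mem_image_of_mem Prod.snd hz), one_mul]
  · simp [image_eq_zero_of_notMem_tsupport hz]

theorem exists_extension_of_denseRange {𝕜 E H : Type*} [RCLike 𝕜] [AddCommGroup E]
    [Module 𝕜 E] [NormedAddCommGroup H] [NormedSpace 𝕜 H] {e : E →ₗ[𝕜] H} (he : DenseRange e)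
    {f : E →ₗ[𝕜] 𝕜} {C : ℝ} (hf : ∀ x, ‖f x‖ ≤ C * ‖e x‖) :
    ∃ ℓ : H →L[𝕜] 𝕜, (∀ x, ℓ (e x) = f x) ∧
      ∀ q : H → ℝ, Continuous q → (∀ x, ‖f x‖ ≤ q (e x)) → ∀ u, ‖ℓ u‖ ≤ q u := by
  have heq := LinearMap.extendOfNorm_eq he ⟨C, hf⟩
  exact ⟨f.extendOfNorm e, heq, fun q hq hfq u => he.induction_on u
    (isClosed_le (by fun_prop) hq) fun x => (heq x).symm ▸ hfq x⟩

theorem mul_prod_ofFn_pow {M : Type*} [Monoid M] {k : ℕ} {x : Fin k → M}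
    (hx : ∀ i j, Commute (x i) (x j)) (α : Fin k → ℕ) (j : Fin k) :
    x j * (List.ofFn fun i => x i ^ α i).prod =
      (List.ofFn fun i => x i ^ (α + (Pi.single j 1 : Fin k → ℕ)) i).prod := by
  induction k with
  | zero => exact j.elim0
  | succ k ih =>
    rw [List.ofFn_succ, List.ofFn_succ, List.prod_cons, List.prod_cons]
    cases j using Fin.cases with
    | zero =>
      rw [← mul_assoc, ← pow_succ']
      simp
    | succ j =>
      rw [← mul_assoc, ((hx j.succ 0).pow_right _).eq, mul_assoc,
        ih (fun i i' => hx i.succ i'.succ) (fun i => α i.succ)]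
      simp [Pi.single_apply]

theorem exists_list_prod_map_eq_prod_ofFn_pow {M : Type*} [Monoid M] {k : ℕ} {x : Fin k → M}
    (hx : ∀ i j, Commute (x i) (x j)) (l : List (Fin k)) :
    ∃ α : Fin k → ℕ, (l.map x).prod = (List.ofFn fun i => x i ^ α i).prod := by
  induction l with
  | nil => exact ⟨0, by simp⟩
  | cons j l ih =>
    obtain ⟨α, hα⟩ := ih
    exact ⟨α + (Pi.single j 1 : Fin k → ℕ), by
      rw [List.map_cons, List.prod_cons, hα, mul_prod_ofFn_pow hx]⟩

namespace Heisenberg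

open Filter Topology

variable {n : ℕ}

instance : CoeFun (Smooth n) fun _ => Heis n → ℂ := ⟨Subtype.val⟩

/-! ### Smooth vector fields as differential operators -/

section FieldOp

variable (v : Heis n → Heis n) (hv : ContDiff ℝ ∞ v)

theorem fieldOp_apply (f : Smooth n) (p : Heis n) : fieldOp v hv f p = fderiv ℝ f p (v p) := rfl

theorem fieldOp_fieldOp_apply (w : Heis n → Heis n) (hw : ContDiff ℝ ∞ w) (f : Smooth n)
    (p : Heis n) : fieldOp v hv (fieldOp w hw f) p =
      fderiv ℝ (fderiv ℝ f) p (v p) (w p) + fderiv ℝ f p (fderiv ℝ w p (v p)) := by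
  have h1 : DifferentiableAt ℝ (fderiv ℝ (f : Heis n → ℂ)) p :=
    (((contDiff_coe f).fderiv_right (m := ∞) (by simp)).differentiable (by simp)).differentiableAt
  have h2 : DifferentiableAt ℝ w p := (hw.differentiable (by simp)).differentiableAt
  change fderiv ℝ (fun q => fderiv ℝ f q (w q)) p (v p) = _
  rw [fderiv_clm_apply h1 h2]
  simp [add_comm]

theorem fieldOp_commutator {w u : Heis n → Heis n} (hw : ContDiff ℝ ∞ w) (hu : ContDiff ℝ ∞ u)
    (h : ∀ p, fderiv ℝ w p (v p) - fderiv ℝ v p (w p) = u p) :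
    fieldOp v hv * fieldOp w hw = fieldOp w hw * fieldOp v hv + fieldOp u hu := by
  ext f p
  have hsymm : IsSymmSndFDerivAt ℝ (f : Heis n → ℂ) p :=
    (contDiff_coe f).contDiffAt.isSymmSndFDerivAt (by
      simp only [minSmoothness_of_isRCLikeNormedField]
      exact WithTop.coe_le_coe.2 (le_top : (2 : ℕ∞) ≤ ⊤))
  change fieldOp v hv (fieldOp w hw f) p = fieldOp w hw (fieldOp v hv f) p + fieldOp u hu f p
  rw [fieldOp_fieldOp_apply, fieldOp_fieldOp_apply, hsymm.eq (v p) (w p), fieldOp_apply, ← h p,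
    map_sub]
  ring

theorem tsupport_fieldOp_subset (f : Smooth n) :
    tsupport (fieldOp v hv f : Heis n → ℂ) ⊆ tsupport (f : Heis n → ℂ) := by
  refine closure_minimal (fun p hp => ?_) (isClosed_tsupport _)
  refine support_fderiv_subset ℝ (f := (f : Heis n → ℂ)) fun h0 => hp ?_
  rw [fieldOp_apply, h0]
  rfl

/-- Multiplication by a smooth function. -/
def mulOp (c : Smooth n) : Module.End ℂ (Smooth n) where
  toFun f := ⟨fun p => c p * f p, show ContDiff ℝ ∞ _ from (contDiff_coe c).mul (contDiff_coe f)⟩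
  map_add' f g := by ext p; simp [mul_add]
  map_smul' a f := by ext p; simp; ring

@[simp] theorem mulOp_apply (c f : Smooth n) (p : Heis n) : mulOp c f p = c p * f p := rfl

theorem fieldOp_mulOp (c f : Smooth n) :
    fieldOp v hv (mulOp c f) = mulOp (fieldOp v hv c) f + mulOp c (fieldOp v hv f) := by
  ext p
  change fderiv ℝ (fun p => c p * f p) p (v p) = _
  rw [fderiv_fun_mul (differentiableAt_coe c p) (differentiableAt_coe f p)]
  simp [fieldOp_apply]
  ring

/-- Composition with a smooth map, as an operator on smooth functions. -/
def pullback (g : Heis n → Heis n) (hg : ContDiff ℝ ∞ g) : Module.End ℂ (Smooth n) where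
  toFun f := ⟨fun p => f (g p), show ContDiff ℝ ∞ _ from (contDiff_coe f).comp hg⟩
  map_add' _ _ := rfl
  map_smul' _ _ := rfl

theorem fieldOp_pullback_apply (g : Heis n → Heis n) (hg : ContDiff ℝ ∞ g) (f : Smooth n)
    (p : Heis n) :
    fieldOp v hv (pullback g hg f) p = fderiv ℝ f (g p) (fderiv ℝ g p (v p)) := by
  change fderiv ℝ ((f : Heis n → ℂ) ∘ g) p (v p) = _
  rw [fderiv_comp p (differentiableAt_coe f _) (hg.differentiable (by simp)).differentiableAt]
  rfl

/-- The complex conjugate of a smooth function. -/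
def conjugate (f : Smooth n) : Smooth n :=
  ⟨fun p => (starRingEnd ℂ) (f p),
    show ContDiff ℝ ∞ _ from Complex.conjCLE.contDiff.comp (contDiff_coe f)⟩

@[simp] theorem conjugate_apply (f : Smooth n) (p : Heis n) :
    conjugate f p = (starRingEnd ℂ) (f p) := rfl

theorem fieldOp_conjugate (f : Smooth n) :
    fieldOp v hv (conjugate f) = conjugate (fieldOp v hv f) := by
  ext p
  have : HasFDerivAt (conjugate f) ((Complex.conjCLE : ℂ →L[ℝ] ℂ) ∘L fderiv ℝ f p) p :=
    (Complex.conjCLE : ℂ →L[ℝ] ℂ).hasFDerivAt.comp p (differentiableAt_coe f p).hasFDerivAt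
  rw [fieldOp_apply, this.fderiv]
  rfl

end FieldOp

/-! ### The group law and the left invariant fields -/

/-- The form `Im (a · conj z) / 2` in the group law. -/
def symp : (Fin n → ℂ) →L[ℝ] (Fin n → ℂ) →L[ℝ] ℝ :=
  ∑ j, ((1 / 2 : ℝ) • innerSL ℝ).bilinearComp (.proj j : (Fin n → ℂ) →L[ℝ] ℂ)
    (Complex.I • .proj j)

theorem symp_apply (a z : Fin n → ℂ) :
    symp a z = ∑ j, ((a j).im * (z j).re - (a j).re * (z j).im) / 2 := by
  simp only [symp, sum_apply]
  refine Finset.sum_congr rfl fun j _ => ?_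
  simp [Complex.inner]
  ring

theorem symp_swap (a z : Fin n → ℂ) : symp a z = -symp z a := by
  rw [symp_apply, symp_apply, ← Finset.sum_neg_distrib]
  exact Finset.sum_congr rfl fun j _ => by ring

@[simp] theorem symp_self (a : Fin n → ℂ) : symp a a = 0 := by
  linarith [symp_swap a a]

theorem symp_single_one (a : Fin n → ℂ) (j : Fin n) : symp a (Pi.single j 1) = (a j).im / 2 := by
  rw [symp_apply, Finset.sum_eq_single j] <;> simp +contextual

theorem symp_single_I (a : Fin n → ℂ) (j : Fin n) :
    symp a (Pi.single j Complex.I) = -((a j).re / 2) := by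
  rw [symp_apply, Finset.sum_eq_single j] <;> simp +contextual [neg_div]

/-- The group law of the Heisenberg group; the inverse of `p` is `-p`. -/
def heisMul (p q : Heis n) : Heis n := (p.1 + q.1, p.2 + q.2 + symp p.1 q.1)

/-- The value at `p` of the left invariant vector field with the value `w` at the identity. -/
def leftField (w p : Heis n) : Heis n := (w.1, w.2 + symp p.1 w.1)

theorem contDiff_leftField (w : Heis n) : ContDiff ℝ ∞ (leftField w) := by
  have h : ContDiff ℝ ∞ fun p : Heis n => symp.flip w.1 p.1 := by fun_prop
  exact contDiff_const.prodMk (contDiff_const.add h)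

theorem fderiv_leftField (w p u : Heis n) : fderiv ℝ (leftField w) p u = (0, symp u.1 w.1) := by
  have h : HasFDerivAt (leftField w) ((0 : Heis n →L[ℝ] (Fin n → ℂ)).prod
      (symp.flip w.1 ∘L .fst ℝ _ _)) p :=
    (hasFDerivAt_const w.1 p).prodMk
      ((symp.flip w.1 ∘L .fst ℝ (Fin n → ℂ) ℝ).hasFDerivAt.const_add w.2)
  rw [h.fderiv]
  rfl

/-- The left invariant vector field with the value `w` at the identity, as a differential
operator. -/
def leftDeriv (w : Heis n) : Module.End ℂ (Smooth n) := fieldOp (leftField w) (contDiff_leftField w)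

theorem leftDeriv_apply (w : Heis n) (f : Smooth n) (p : Heis n) :
    leftDeriv w f p = fderiv ℝ f p (leftField w p) := rfl

theorem leftDeriv_snd (r : ℝ) : leftDeriv ((0, r) : Heis n) = (r : ℂ) • T n := by
  ext f p
  have : leftField ((0, r) : Heis n) p = r • (0, 1) := by ext <;> simp [leftField]
  rw [leftDeriv_apply, this, map_smul]
  rfl

theorem leftDeriv_commutator (v w : Heis n) :
    leftDeriv v * leftDeriv w = leftDeriv w * leftDeriv v + ((2 * symp v.1 w.1 : ℝ) : ℂ) • T n := by
  rw [← leftDeriv_snd]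
  refine fieldOp_commutator _ _ _ _ fun p => ?_
  simp only [fderiv_leftField, leftField, symp_swap w.1 v.1, map_zero]
  ext <;> simp
  ring

theorem T_leftDeriv (w : Heis n) (f : Smooth n) : T n (leftDeriv w f) = leftDeriv w (T n f) := by
  have hT : T n = leftDeriv (0, 1) := by simp [leftDeriv_snd]
  simpa [hT] using LinearMap.congr_fun (leftDeriv_commutator (0, 1) w) f

theorem leftDeriv_mulOp (w : Heis n) (c f : Smooth n) :
    leftDeriv w (mulOp c f) = mulOp (leftDeriv w c) f + mulOp c (leftDeriv w f) :=
  fieldOp_mulOp ..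

/-- The values at the identity of the horizontal fields `X_1, …, X_n, Y_1, …, Y_n`, projected to
`ℂⁿ`. -/
def frame : Fin n ⊕ Fin n → Fin n → ℂ :=
  Sum.elim (fun j => Pi.single j 1) fun j => Pi.single j Complex.I

/-- The horizontal fields `X_1, …, X_n, Y_1, …, Y_n` as one family. -/
def V (i : Fin n ⊕ Fin n) : Module.End ℂ (Smooth n) := leftDeriv (frame i, 0)

theorem X_eq_V (j : Fin n) : X j = V (.inl j) := by
  ext f p
  simp only [V, leftDeriv_apply, leftField, frame, Sum.elim_inl, symp_single_one, zero_add]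
  rfl

theorem Y_eq_V (j : Fin n) : Y j = V (.inr j) := by
  ext f p
  simp only [V, leftDeriv_apply, leftField, frame, Sum.elim_inr, symp_single_I, zero_add]
  rfl

theorem V_mul_V (k i : Fin n ⊕ Fin n) :
    V k * V i = V i * V k + ((2 * symp (frame k) (frame i) : ℝ) : ℂ) • T n :=
  leftDeriv_commutator ..

theorem V_V (k i : Fin n ⊕ Fin n) (f : Smooth n) :
    V k (V i f) = V i (V k f) + ((2 * symp (frame k) (frame i) : ℝ) : ℂ) • T n f :=
  LinearMap.congr_fun (V_mul_V k i) f

theorem T_V (i : Fin n ⊕ Fin n) (f : Smooth n) : T n (V i f) = V i (T n f) := T_leftDeriv ..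

theorem V_mulOp (i : Fin n ⊕ Fin n) (c f : Smooth n) :
    V i (mulOp c f) = mulOp (V i c) f + mulOp c (V i f) := leftDeriv_mulOp ..

theorem V_conjugate (i : Fin n ⊕ Fin n) (f : Smooth n) : V i (conjugate f) = conjugate (V i f) :=
  fieldOp_conjugate _ (contDiff_leftField _) f

theorem T_eq (j : Fin n) (f : Smooth n) :
    T n f = V (.inr j) (V (.inl j) f) - V (.inl j) (V (.inr j) f) := by
  rw [V_V (.inr j)]
  simp [frame, symp_single_one]

theorem sublaplacian_apply (f : Smooth n) : sublaplacian n f = -∑ i, V i (V i f) := by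
  simp [sublaplacian, X_eq_V, Y_eq_V, Finset.sum_add_distrib, pow_two]

theorem T_sublaplacian (f : Smooth n) : T n (sublaplacian n f) = sublaplacian n (T n f) := by
  simp only [sublaplacian_apply, T_V, map_neg, map_sum]

theorem sublaplacian_V (i : Fin n ⊕ Fin n) (f : Smooth n) :
    sublaplacian n (V i f) = V i (sublaplacian n f) -
      ∑ k, ((4 * symp (frame k) (frame i) : ℝ) : ℂ) • V k (T n f) := by
  have h (k) : V k (V k (V i f)) =
      V i (V k (V k f)) + ((4 * symp (frame k) (frame i) : ℝ) : ℂ) • V k (T n f) := by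
    rw [V_V k i, map_add, V_V k i, map_smul, T_V]
    push_cast
    module
  simp only [sublaplacian_apply, h, Finset.sum_add_distrib, map_neg, map_sum]
  abel

/-! ### Dilations and translations -/

/-- The automorphic dilation `(z, t) ↦ (r z, r² t)`. -/
def dil (r : ℝ) : Heis n →L[ℝ] Heis n :=
  (r • ContinuousLinearMap.id ℝ (Fin n → ℂ)).prodMap (r ^ 2 • ContinuousLinearMap.id ℝ ℝ)

theorem dil_apply (r : ℝ) (p : Heis n) : dil r p = (r • p.1, r ^ 2 * p.2) := rfl

theorem dil_dil (r s : ℝ) (p : Heis n) : dil r (dil s p) = dil (r * s) p := by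
  simp only [dil_apply, smul_smul]
  ext <;> simp; ring

@[simp] theorem dil_one (p : Heis n) : dil 1 p = p := by simp [dil_apply]

@[simp] theorem dil_zero_left (p : Heis n) : dil 0 p = 0 := by simp [dil_apply]

/-- Composition with a dilation, as an operator on smooth functions. -/
def dilate (r : ℝ) : Module.End ℂ (Smooth n) := pullback (dil r) (dil r).contDiff

@[simp] theorem dilate_apply (r : ℝ) (f : Smooth n) (p : Heis n) : dilate r f p = f (dil r p) := rfl

theorem V_dilate (i : Fin n ⊕ Fin n) (r : ℝ) (f : Smooth n) :
    V i (dilate r f) = (r : ℂ) • dilate r (V i f) := by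
  ext p
  have hfield : dil r (leftField (frame i, 0) p) = r • leftField (frame i, 0) (dil r p) := by
    ext <;> simp [leftField, dil_apply]; ring
  rw [V, leftDeriv, dilate, fieldOp_pullback_apply, ContinuousLinearMap.fderiv, hfield, map_smul]
  rfl

theorem V_mulOp_dilate (i : Fin n ⊕ Fin n) (r : ℝ) (f g : Smooth n) :
    V i (mulOp (dilate r f) g) =
      (r : ℂ) • mulOp (dilate r (V i f)) g + mulOp (dilate r f) (V i g) := by
  rw [V_mulOp, V_dilate]
  congr 1
  ext p
  exact mul_assoc _ _ _

theorem sublaplacian_dilate (r : ℝ) (f : Smooth n) :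
    sublaplacian n (dilate r f) = ((r : ℂ) ^ 2) • dilate r (sublaplacian n f) := by
  simp only [sublaplacian_apply, pow_two, V_dilate, map_smul, map_neg, map_sum, Finset.smul_sum,
    smul_neg, smul_smul]

theorem contDiff_heisMul_uncurry : ContDiff ℝ ∞ fun z : Heis n × Heis n => heisMul z.1 z.2 := by
  unfold heisMul
  fun_prop

theorem contDiff_heisMul (a : Heis n) : ContDiff ℝ ∞ (heisMul a) :=
  contDiff_heisMul_uncurry.comp (contDiff_const.prodMk contDiff_id)

theorem fderiv_heisMul (a p w : Heis n) : fderiv ℝ (heisMul a) p w = leftField w a := by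
  have h : HasFDerivAt (heisMul a) ((ContinuousLinearMap.fst ℝ (Fin n → ℂ) ℝ).prod
      (.snd ℝ (Fin n → ℂ) ℝ + symp a.1 ∘L .fst ℝ _ ℝ)) p :=
    ((ContinuousLinearMap.fst ℝ (Fin n → ℂ) ℝ).hasFDerivAt.const_add _).prodMk
      (((ContinuousLinearMap.snd ℝ (Fin n → ℂ) ℝ).hasFDerivAt.const_add _).add
        (symp a.1 ∘L .fst ℝ _ ℝ).hasFDerivAt)
  rw [h.fderiv]
  rfl

/-- Composition with the left translation by `a`, as an operator on smooth functions. -/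
def translate (a : Heis n) : Module.End ℂ (Smooth n) := pullback (heisMul a) (contDiff_heisMul a)

@[simp] theorem translate_apply (a : Heis n) (f : Smooth n) (p : Heis n) :
    translate a f p = f (heisMul a p) := rfl

theorem leftDeriv_translate (w a : Heis n) (f : Smooth n) :
    leftDeriv w (translate a f) = translate a (leftDeriv w f) := by
  ext p
  rw [leftDeriv, translate, fieldOp_pullback_apply, fderiv_heisMul]
  change _ = fderiv ℝ f (heisMul a p) (leftField w (heisMul a p))
  congr 1
  ext <;> simp [leftField, heisMul]; ring

theorem sublaplacian_translate (a : Heis n) (f : Smooth n) :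
    sublaplacian n (translate a f) = translate a (sublaplacian n f) := by
  simp only [sublaplacian_apply, V, leftDeriv_translate, map_neg, map_sum]

/-! ### Test functions and integration by parts -/

/-- The space `C_c^∞`. -/
def testFunctions (n : ℕ) : Submodule ℂ (Smooth n) where
  carrier := {f | HasCompactSupport (f : Heis n → ℂ)}
  add_mem' hf hg := HasCompactSupport.add hf hg
  zero_mem' := HasCompactSupport.zero
  smul_mem' c _ hf := HasCompactSupport.smul_left (f := fun _ => c) hf

section TestFunctions

variable {f : Smooth n} (hf : f ∈ testFunctions n)
include hf

theorem fieldOp_mem_testFunctions {v : Heis n → Heis n} (hv : ContDiff ℝ ∞ v) :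
    fieldOp v hv f ∈ testFunctions n :=
  IsCompact.of_isClosed_subset hf (isClosed_tsupport _) (tsupport_fieldOp_subset v hv f)

theorem V_mem_testFunctions (i : Fin n ⊕ Fin n) : V i f ∈ testFunctions n :=
  fieldOp_mem_testFunctions hf (contDiff_leftField _)

theorem T_mem_testFunctions : T n f ∈ testFunctions n :=
  fieldOp_mem_testFunctions hf contDiff_const

theorem mulOp_mem_testFunctions_left (g : Smooth n) : mulOp f g ∈ testFunctions n :=
  HasCompactSupport.mul_right (f := (f : Heis n → ℂ)) hf

theorem mulOp_mem_testFunctions_right (c : Smooth n) : mulOp c f ∈ testFunctions n :=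
  HasCompactSupport.mul_left (f' := (f : Heis n → ℂ)) hf

theorem conjugate_mem_testFunctions : conjugate f ∈ testFunctions n :=
  HasCompactSupport.comp_left (f := (f : Heis n → ℂ)) hf (map_zero _)

theorem memLp_of_mem_testFunctions : MemLp (f : Heis n → ℂ) 2 volume :=
  (contDiff_coe f).continuous.memLp_of_hasCompactSupport hf

theorem integrable_of_mem_testFunctions : Integrable (f : Heis n → ℂ) volume :=
  (contDiff_coe f).continuous.integrable_of_hasCompactSupport hf

theorem dilate_mem_testFunctions {r : ℝ} (hr : r ≠ 0) : dilate r f ∈ testFunctions n := by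
  let e : Heis n ≃ₜ Heis n :=
    { toFun := dil r, invFun := dil r⁻¹,
      left_inv := fun p => by rw [dil_dil, inv_mul_cancel₀ hr, dil_one]
      right_inv := fun p => by rw [dil_dil, mul_inv_cancel₀ hr, dil_one]
      continuous_toFun := (dil r).continuous
      continuous_invFun := (dil r⁻¹).continuous }
  exact HasCompactSupport.comp_homeomorph (f := (f : Heis n → ℂ)) hf e

end TestFunctions

instance : (volume : Measure (Heis n)).IsAddHaarMeasure :=
  haveI : (volume : Measure (Fin n → ℂ)).IsAddHaarMeasure :=
    Measure.pi.isAddHaarMeasure _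
  Measure.prod.instIsAddHaarMeasure (volume : Measure (Fin n → ℂ)) (volume : Measure ℝ)

/-- The constant vector field `w`, as a differential operator. -/
def D (w : Heis n) : Module.End ℂ (Smooth n) := fieldOp (fun _ => w) contDiff_const

theorem D_apply (w : Heis n) (f : Smooth n) (p : Heis n) : D w f p = fderiv ℝ f p w := rfl

theorem integral_D_eq_zero (w : Heis n) {f : Smooth n} (hf : f ∈ testFunctions n) :
    ∫ p, D w f p = 0 := by
  have hD : Integrable (fun p => fderiv ℝ f p w) :=
    integrable_of_mem_testFunctions (fieldOp_mem_testFunctions (v := fun _ => w) hf contDiff_const)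
  have := integral_mul_fderiv_eq_neg_fderiv_mul_of_integrable (μ := (volume : Measure (Heis n)))
    (f := fun _ : Heis n => (1 : ℂ)) (g := f) (v := w) (𝕜 := ℂ)
    (by simp) (by simpa using hD) (by simpa using integrable_of_mem_testFunctions hf)
    (fun p _ => by fun_prop) (fun p _ => differentiableAt_coe f p)
  simpa [D_apply] using this

/-- A real linear form in the variable `z`, as a smooth function of `(z, t)`. -/
def linearFun (k : (Fin n → ℂ) →L[ℝ] ℝ) : Smooth n :=
  ⟨Complex.ofRealCLM ∘L k ∘L .fst ℝ (Fin n → ℂ) ℝ,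
    show ContDiff ℝ ∞ _ from ContinuousLinearMap.contDiff _⟩

theorem D_linearFun_apply (w : Heis n) (k : (Fin n → ℂ) →L[ℝ] ℝ) (p : Heis n) :
    D w (linearFun k) p = (k w.1 : ℂ) := by
  change fderiv ℝ (Complex.ofRealCLM ∘L k ∘L .fst ℝ (Fin n → ℂ) ℝ) p w = _
  rw [ContinuousLinearMap.fderiv]
  rfl

theorem T_mulOp_linearFun (k : (Fin n → ℂ) →L[ℝ] ℝ) (f : Smooth n) :
    T n (mulOp (linearFun k) f) = mulOp (linearFun k) (T n f) := by
  have h : T n (linearFun k) = 0 := by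
    ext p
    exact (D_linearFun_apply (0, 1) k p).trans (by simp)
  rw [T] at h ⊢
  rw [fieldOp_mulOp, h]
  ext p
  simp

theorem leftDeriv_eq_D_add (w : Heis n) (f : Smooth n) :
    leftDeriv w f = D w f + mulOp (linearFun (symp.flip w.1)) (T n f) := by
  ext p
  have h : leftField w p = w + symp p.1 w.1 • (0, 1) := by ext <;> simp [leftField]
  rw [leftDeriv_apply, h, map_add, map_smul, Complex.real_smul]
  rfl

theorem integral_leftDeriv_eq_zero (w : Heis n) {f : Smooth n} (hf : f ∈ testFunctions n) :
    ∫ p, leftDeriv w f p = 0 := by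
  have hk := mulOp_mem_testFunctions_right hf (linearFun (symp.flip w.1))
  rw [leftDeriv_eq_D_add, ← T_mulOp_linearFun]
  have := integral_add
    (integrable_of_mem_testFunctions
      (fieldOp_mem_testFunctions (v := fun _ => w) hf contDiff_const))
    (integrable_of_mem_testFunctions (T_mem_testFunctions hk))
  refine this.trans ?_
  change (∫ p, D w f p) + ∫ p, D (0, 1) (mulOp (linearFun (symp.flip w.1)) f) p = 0
  rw [integral_D_eq_zero w hf, integral_D_eq_zero _ hk, add_zero]

theorem integral_V_mul (i : Fin n ⊕ Fin n) {f : Smooth n} (hf : f ∈ testFunctions n)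
    (g : Smooth n) : ∫ p, V i f p * g p = -∫ p, f p * V i g p := by
  have h := integral_leftDeriv_eq_zero (frame i, 0) (mulOp_mem_testFunctions_left hf g)
  rw [leftDeriv_mulOp] at h
  refine eq_neg_of_add_eq_zero_left (Eq.trans ?_ h)
  exact (integral_add
    (integrable_of_mem_testFunctions (mulOp_mem_testFunctions_left (V_mem_testFunctions hf i) g))
    (integrable_of_mem_testFunctions (mulOp_mem_testFunctions_left hf (V i g)))).symm

theorem integral_mul_sublaplacian {f : Smooth n} (hf : f ∈ testFunctions n) (g : Smooth n) :
    ∫ p, f p * sublaplacian n g p = ∑ i, ∫ p, V i f p * V i g p := by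
  have h (p : Heis n) : f p * sublaplacian n g p = -∑ i, f p * V i (V i g) p := by
    rw [← Finset.mul_sum, ← mul_neg]
    simp [sublaplacian_apply]
  have hint (i : Fin n ⊕ Fin n) : Integrable fun p => f p * V i (V i g) p :=
    integrable_of_mem_testFunctions (mulOp_mem_testFunctions_left hf (V i (V i g)))
  simp only [h, integral_neg]
  rw [integral_finsetSum _ fun i _ => hint i]
  simp only [integral_V_mul _ hf, Finset.sum_neg_distrib]

theorem integral_sublaplacian_mul {f : Smooth n} (hf : f ∈ testFunctions n) (g : Smooth n) :
    ∫ p, sublaplacian n f p * g p = ∫ p, f p * sublaplacian n g p := by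
  have hV (i) := V_mem_testFunctions hf i
  have h (p : Heis n) : sublaplacian n f p * g p = -∑ i, V i (V i f) p * g p := by
    rw [← Finset.sum_mul, ← neg_mul]
    simp [sublaplacian_apply]
  have hint (i : Fin n ⊕ Fin n) : Integrable fun p => V i (V i f) p * g p :=
    integrable_of_mem_testFunctions (mulOp_mem_testFunctions_left (V_mem_testFunctions (hV i) i) g)
  simp only [integral_mul_sublaplacian hf, h, integral_neg]
  rw [integral_finsetSum _ fun i _ => hint i]
  simp only [integral_V_mul _ (hV _), Finset.sum_neg_distrib, neg_neg]

/-! ### Smooth functions with square integrable horizontal derivatives -/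

/-- The iterated horizontal derivative along a word in the horizontal fields. -/
def wordOp (l : List (Fin n ⊕ Fin n)) : Module.End ℂ (Smooth n) := (l.map V).prod

@[simp] theorem wordOp_nil : wordOp (n := n) [] = 1 := rfl

@[simp] theorem wordOp_cons (i : Fin n ⊕ Fin n) (l : List (Fin n ⊕ Fin n)) :
    wordOp (i :: l) = V i * wordOp l := by simp [wordOp]

theorem wordOp_append (l l' : List (Fin n ⊕ Fin n)) :
    wordOp (l ++ l') = wordOp l * wordOp l' := by simp [wordOp]

theorem T_wordOp (l : List (Fin n ⊕ Fin n)) (f : Smooth n) :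
    T n (wordOp l f) = wordOp l (T n f) := by
  induction l with
  | nil => rfl
  | cons i l ih => rw [wordOp_cons, Module.End.mul_apply, T_V, ih, Module.End.mul_apply]

/-- The smooth functions all of whose iterated horizontal derivatives are in `L²`. -/
def sobolevInfty (n : ℕ) : Submodule ℂ (Smooth n) where
  carrier := {f | ∀ l, MemLp (wordOp l f : Heis n → ℂ) 2 volume}
  add_mem' hf hg l := by rw [map_add]; exact (hf l).add (hg l)
  zero_mem' l := by rw [map_zero]; exact MemLp.zero
  smul_mem' c f hf l := by rw [map_smul]; exact (hf l).const_smul c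

section SobolevInfty

variable {f : Smooth n}

theorem memLp_of_mem_sobolevInfty (hf : f ∈ sobolevInfty n) : MemLp (f : Heis n → ℂ) 2 volume :=
  hf []

theorem wordOp_mem_sobolevInfty (l : List (Fin n ⊕ Fin n)) (hf : f ∈ sobolevInfty n) :
    wordOp l f ∈ sobolevInfty n := fun l' => by
  have := hf (l' ++ l)
  rwa [wordOp_append] at this

theorem V_mem_sobolevInfty (i : Fin n ⊕ Fin n) (hf : f ∈ sobolevInfty n) :
    V i f ∈ sobolevInfty n := wordOp_mem_sobolevInfty [i] hf

theorem sublaplacian_mem_sobolevInfty (hf : f ∈ sobolevInfty n) :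
    sublaplacian n f ∈ sobolevInfty n := by
  rw [sublaplacian_apply]
  exact neg_mem (sum_mem fun i _ => wordOp_mem_sobolevInfty [i, i] hf)

theorem wordOp_mem_testFunctions (l : List (Fin n ⊕ Fin n)) (hf : f ∈ testFunctions n) :
    wordOp l f ∈ testFunctions n := by
  induction l with
  | nil => exact hf
  | cons i l ih => exact V_mem_testFunctions ih i

theorem sublaplacian_mem_testFunctions (hf : f ∈ testFunctions n) :
    sublaplacian n f ∈ testFunctions n := by
  rw [sublaplacian_apply]
  exact neg_mem (sum_mem fun i _ => wordOp_mem_testFunctions [i, i] hf)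

theorem testFunctions_le_sobolevInfty : testFunctions n ≤ sobolevInfty n := fun _ hf l =>
  memLp_of_mem_testFunctions (wordOp_mem_testFunctions l hf)

end SobolevInfty

/-! ### Classes in `L²` -/

open Classical in
/-- The class in `L²` of a smooth function; the junk value `0` for functions which are not square
integrable makes it a total function. -/
def l2Class (f : Smooth n) : L2 n :=
  if h : MemLp (f : Heis n → ℂ) 2 volume then h.toLp _ else 0

section L2Class

variable {f g : Smooth n}

theorem l2Class_eq_toLp (hf : MemLp (f : Heis n → ℂ) 2 volume) : l2Class f = hf.toLp _ :=
  dif_pos hf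

theorem coeFn_l2Class (hf : MemLp (f : Heis n → ℂ) 2 volume) :
    l2Class f =ᵐ[volume] (f : Heis n → ℂ) := by
  rw [l2Class_eq_toLp hf]
  exact hf.coeFn_toLp

/-- The inclusion of `sobolevInfty` in `L²`, as a linear map. -/
def sobolevInftyToL2 (n : ℕ) : sobolevInfty n →ₗ[ℂ] L2 n where
  toFun f := l2Class f
  map_add' f g := by
    rw [l2Class_eq_toLp (memLp_of_mem_sobolevInfty f.2),
      l2Class_eq_toLp (memLp_of_mem_sobolevInfty g.2),
      l2Class_eq_toLp (memLp_of_mem_sobolevInfty (f + g).2), ← MemLp.toLp_add]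
    rfl
  map_smul' c f := by
    rw [l2Class_eq_toLp (memLp_of_mem_sobolevInfty f.2),
      l2Class_eq_toLp (memLp_of_mem_sobolevInfty (c • f).2), RingHom.id_apply,
      ← MemLp.toLp_const_smul]
    rfl

theorem l2Class_add (hf : f ∈ sobolevInfty n) (hg : g ∈ sobolevInfty n) :
    l2Class (f + g) = l2Class f + l2Class g :=
  (sobolevInftyToL2 n).map_add (⟨f, hf⟩ : sobolevInfty n) (⟨g, hg⟩ : sobolevInfty n)

theorem l2Class_sub (hf : f ∈ sobolevInfty n) (hg : g ∈ sobolevInfty n) :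
    l2Class (f - g) = l2Class f - l2Class g :=
  (sobolevInftyToL2 n).map_sub (⟨f, hf⟩ : sobolevInfty n) (⟨g, hg⟩ : sobolevInfty n)

theorem l2Class_neg (hf : f ∈ sobolevInfty n) : l2Class (-f) = -l2Class f :=
  (sobolevInftyToL2 n).map_neg (⟨f, hf⟩ : sobolevInfty n)

theorem l2Class_smul (c : ℂ) (hf : f ∈ sobolevInfty n) : l2Class (c • f) = c • l2Class f :=
  (sobolevInftyToL2 n).map_smul c (⟨f, hf⟩ : sobolevInfty n)

theorem l2Class_sum {ι : Type*} (s : Finset ι) {f : ι → Smooth n}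
    (hf : ∀ i, f i ∈ sobolevInfty n) : l2Class (∑ i ∈ s, f i) = ∑ i ∈ s, l2Class (f i) := by
  have := map_sum (sobolevInftyToL2 n) (fun i => (⟨f i, hf i⟩ : sobolevInfty n)) s
  simpa only [sobolevInftyToL2, LinearMap.coe_mk, AddHom.coe_mk,
    AddSubmonoidClass.coe_finsetSum] using this

theorem inner_l2Class (hf : MemLp (f : Heis n → ℂ) 2 volume)
    (hg : MemLp (g : Heis n → ℂ) 2 volume) :
    ⟪l2Class f, l2Class g⟫_ℂ = ∫ p, conjugate f p * g p := by
  rw [L2.inner_def]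
  refine integral_congr_ae ?_
  filter_upwards [coeFn_l2Class hf, coeFn_l2Class hg] with p h1 h2
  rw [h1, h2, conjugate_apply, RCLike.inner_apply, mul_comm]

theorem norm_l2Class_sq (hf : MemLp (f : Heis n → ℂ) 2 volume) :
    ‖l2Class f‖ ^ 2 = ∫ p, ‖f p‖ ^ 2 := by
  have h := inner_l2Class hf hf
  simp only [inner_self_eq_norm_sq_to_K, conjugate_apply, Complex.conj_mul'] at h
  norm_cast at h
  exact Complex.ofReal_injective h

theorem inner_V (i : Fin n ⊕ Fin n) (hf : f ∈ testFunctions n) (hg : g ∈ sobolevInfty n) :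
    ⟪l2Class f, l2Class (V i g)⟫_ℂ = -⟪l2Class (V i f), l2Class g⟫_ℂ := by
  rw [inner_l2Class (memLp_of_mem_testFunctions hf)
      (memLp_of_mem_sobolevInfty (V_mem_sobolevInfty i hg)),
    inner_l2Class (memLp_of_mem_testFunctions (V_mem_testFunctions hf i))
      (memLp_of_mem_sobolevInfty hg), ← V_conjugate,
    integral_V_mul i (conjugate_mem_testFunctions hf), neg_neg]

theorem inner_sublaplacian (hf : f ∈ testFunctions n) (hg : g ∈ sobolevInfty n) :
    ⟪l2Class f, l2Class (sublaplacian n g)⟫_ℂ = ∑ i, ⟪l2Class (V i f), l2Class (V i g)⟫_ℂ := by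
  have hVV (i) : V i (V i g) ∈ sobolevInfty n := wordOp_mem_sobolevInfty [i, i] hg
  rw [sublaplacian_apply, l2Class_neg (sum_mem fun i _ => hVV i), l2Class_sum _ hVV,
    inner_neg_right, inner_sum, ← Finset.sum_neg_distrib]
  exact Finset.sum_congr rfl fun i _ => by rw [inner_V i hf (V_mem_sobolevInfty i hg), neg_neg]

end L2Class

theorem map_dil {r : ℝ} (hr : 0 < r) : Measure.map (dil r) (volume : Measure (Heis n)) =
    ENNReal.ofReal ((r ^ (2 * n + 2))⁻¹) • volume := by
  have hdet : LinearMap.det (dil (n := n) r : Heis n →ₗ[ℝ] Heis n) = r ^ (2 * n + 2) := by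
    have : (dil (n := n) r : Heis n →ₗ[ℝ] Heis n) =
        (r • (LinearMap.id : (Fin n → ℂ) →ₗ[ℝ] (Fin n → ℂ))).prodMap
          (r ^ 2 • (LinearMap.id : ℝ →ₗ[ℝ] ℝ)) := rfl
    rw [this, LinearMap.det_prodMap, LinearMap.det_smul, LinearMap.det_smul]
    simp [Module.finrank_pi_fintype, mul_comm]
    ring
  have h := Measure.map_linearMap_addHaar_eq_smul_addHaar (volume : Measure (Heis n))
    (f := (dil (n := n) r : Heis n →ₗ[ℝ] Heis n)) (by rw [hdet]; positivity)
  rw [hdet, abs_of_pos (by positivity)] at h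
  exact h

theorem norm_l2Class_dilate {r : ℝ} (hr : 0 < r) {f : Smooth n} (hf : f ∈ testFunctions n) :
    ‖l2Class (dilate r f)‖ = (r ^ (n + 1))⁻¹ * ‖l2Class f‖ := by
  refine (sq_eq_sq₀ (norm_nonneg _) (by positivity)).1 ?_
  have h := integral_map (μ := (volume : Measure (Heis n))) (φ := dil r)
    (f := fun p => ‖f p‖ ^ 2) (dil r).continuous.aemeasurable
    (((contDiff_coe f).continuous.norm.pow 2).aestronglyMeasurable)
  rw [mul_pow, norm_l2Class_sq (memLp_of_mem_testFunctions hf),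
    norm_l2Class_sq (memLp_of_mem_testFunctions (dilate_mem_testFunctions hf hr.ne'))]
  simp only [dilate_apply]
  rw [← h, map_dil hr, integral_smul_measure, ENNReal.toReal_ofReal (by positivity), smul_eq_mul]
  ring

/-! ### Cutoffs -/

/-- The horizontal differential operators of order at most `k`, i.e. the linear combinations of
the iterated derivatives along words of length at most `k` in the horizontal fields. -/
def horizontalOps (n k : ℕ) : Submodule ℂ (Module.End ℂ (Smooth n)) :=
  Submodule.span ℂ (wordOp '' {l | l.length ≤ k})

theorem wordOp_mem_horizontalOps {l : List (Fin n ⊕ Fin n)} {k : ℕ} (hl : l.length ≤ k) :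
    wordOp l ∈ horizontalOps n k := Submodule.subset_span ⟨l, hl, rfl⟩

theorem mul_mem_horizontalOps {P Q : Module.End ℂ (Smooth n)} {j k : ℕ}
    (hP : P ∈ horizontalOps n j) (hQ : Q ∈ horizontalOps n k) :
    P * Q ∈ horizontalOps n (j + k) := by
  have h := Submodule.mul_mem_mul hP hQ
  rw [horizontalOps, horizontalOps, Submodule.span_mul_span] at h
  refine Submodule.span_mono ?_ h
  rintro _ ⟨_, ⟨l, hl, rfl⟩, _, ⟨l', hl', rfl⟩, rfl⟩
  exact ⟨l ++ l', by simpa using add_le_add hl hl', wordOp_append l l'⟩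

/-- The operator `I + ℒ` on smooth functions. -/
def shifted (n : ℕ) : Module.End ℂ (Smooth n) := 1 + sublaplacian n

theorem shifted_apply (f : Smooth n) : shifted n f = f + sublaplacian n f := rfl

theorem shifted_pow_succ_apply (m : ℕ) (f : Smooth n) :
    (shifted n ^ (m + 1)) f = (shifted n ^ m) (shifted n f) := by
  rw [pow_succ]; rfl

theorem shifted_mem_horizontalOps (n : ℕ) : shifted n ∈ horizontalOps n 2 := by
  have h : sublaplacian n = ∑ i, (-1 : ℂ) • wordOp [i, i] := by
    ext1 f
    rw [sublaplacian_apply, LinearMap.sum_apply, ← Finset.sum_neg_distrib]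
    exact Finset.sum_congr rfl fun i _ => (neg_one_smul ℂ (V i (V i f))).symm
  rw [shifted, h]
  exact add_mem (wordOp_mem_horizontalOps (l := []) zero_le_two)
    (sum_mem fun i _ => Submodule.smul_mem _ _ (wordOp_mem_horizontalOps (l := [i, i]) le_rfl))

theorem shifted_pow_mem_horizontalOps (n m : ℕ) : shifted n ^ m ∈ horizontalOps n (2 * m) := by
  induction m with
  | zero => exact wordOp_mem_horizontalOps (l := []) le_rfl
  | succ m ih =>
    exact pow_succ (shifted n) m ▸ mul_mem_horizontalOps ih (shifted_mem_horizontalOps n)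

theorem exists_cutoff (n : ℕ) : ∃ χ ∈ testFunctions n, (χ : Heis n → ℂ) =ᶠ[𝓝 0] 1 := by
  let b : ContDiffBump (0 : Heis n) := ⟨1, 2, one_pos, one_lt_two⟩
  refine ⟨⟨fun p => (b p : ℂ), Complex.ofRealCLM.contDiff.comp b.contDiff⟩,
    b.hasCompactSupport.comp_left (g := fun x : ℝ => (x : ℂ)) Complex.ofReal_zero, ?_⟩
  filter_upwards [b.eventuallyEq_one] with p hp
  simp [hp]

section HorizontalOps

variable {P : Module.End ℂ (Smooth n)} {k : ℕ} {χ f : Smooth n}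

theorem apply_mem_sobolevInfty (hP : P ∈ horizontalOps n k) (hf : f ∈ sobolevInfty n) :
    P f ∈ sobolevInfty n := by
  induction hP using Submodule.span_induction with
  | mem _ hP => obtain ⟨l, -, rfl⟩ := hP; exact wordOp_mem_sobolevInfty l hf
  | zero => exact zero_mem _
  | add _ _ _ _ h h' => exact add_mem h h'
  | smul c _ _ h => exact Submodule.smul_mem _ c h

theorem apply_mem_testFunctions (hP : P ∈ horizontalOps n k) (hf : f ∈ testFunctions n) :
    P f ∈ testFunctions n := by
  induction hP using Submodule.span_induction with
  | mem _ hP => obtain ⟨l, -, rfl⟩ := hP; exact wordOp_mem_testFunctions l hf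
  | zero => exact zero_mem _
  | add _ _ _ _ h h' => exact add_mem h h'
  | smul c _ _ h => exact Submodule.smul_mem _ c h

theorem shifted_pow_mem_testFunctions (m : ℕ) (hf : f ∈ testFunctions n) :
    (shifted n ^ m) f ∈ testFunctions n :=
  apply_mem_testFunctions (shifted_pow_mem_horizontalOps n m) hf

theorem shifted_mem_testFunctions (hf : f ∈ testFunctions n) : shifted n f ∈ testFunctions n :=
  apply_mem_testFunctions (shifted_mem_horizontalOps n) hf

theorem shifted_pow_mem_sobolevInfty (m : ℕ) (hf : f ∈ sobolevInfty n) :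
    (shifted n ^ m) f ∈ sobolevInfty n :=
  apply_mem_sobolevInfty (shifted_pow_mem_horizontalOps n m) hf

theorem shifted_mem_sobolevInfty (hf : f ∈ sobolevInfty n) : shifted n f ∈ sobolevInfty n :=
  apply_mem_sobolevInfty (shifted_mem_horizontalOps n) hf

theorem exists_norm_apply_le (hχ : χ ∈ testFunctions n) : ∃ C, ∀ p, ‖χ p‖ ≤ C :=
  HasCompactSupport.exists_bound_of_continuous (f := (χ : Heis n → ℂ)) hχ
    (contDiff_coe χ).continuous

theorem tendsto_integral_norm_dilate_sub_mul_sq (hχ : χ ∈ testFunctions n)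
    (hf : MemLp (f : Heis n → ℂ) 2 volume) :
    Tendsto (fun ε : ℝ => ∫ p, ‖(χ (dil ε p) - χ 0) * f p‖ ^ 2) (𝓝 0) (𝓝 0) := by
  obtain ⟨C, hC⟩ := exists_norm_apply_le hχ
  have hχc := (contDiff_coe χ).continuous
  have hfc := (contDiff_coe f).continuous
  rw [show (0 : ℝ) = ∫ _ : Heis n, (0 : ℝ) from integral_zero _ _ |>.symm]
  refine tendsto_integral_filter_of_dominated_convergence
    (fun p => (2 * C) ^ 2 * ‖f p‖ ^ 2) (.of_forall fun ε => ?_)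
    (.of_forall fun ε => .of_forall fun p => ?_)
    ((hf.integrable_norm_pow two_ne_zero).const_mul _) (.of_forall fun p => ?_)
  · have := (dil (n := n) ε).continuous
    exact Continuous.aestronglyMeasurable (by fun_prop)
  · rw [norm_pow, norm_norm, norm_mul, mul_pow]
    gcongr
    exact (norm_sub_le _ _).trans (by linarith [hC (dil ε p), hC 0])
  · have hd : Continuous fun ε : ℝ => dil ε p := by simp only [dil_apply]; fun_prop
    refine Continuous.tendsto' (by fun_prop) _ _ ?_
    simp [dil_zero_left]

theorem eventually_mulOp_dilate_mem_sobolevInfty (hχ : χ ∈ testFunctions n) (f : Smooth n) :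
    ∀ᶠ ε in 𝓝[>] (0 : ℝ), mulOp (dilate ε χ) f ∈ sobolevInfty n := by
  filter_upwards [self_mem_nhdsWithin] with ε hε
  exact testFunctions_le_sobolevInfty
    (mulOp_mem_testFunctions_left (dilate_mem_testFunctions hχ (ne_of_gt hε)) f)

theorem tendsto_l2Class_cutoff (hχ : χ ∈ testFunctions n) (hf : f ∈ sobolevInfty n) :
    Tendsto (fun ε : ℝ => l2Class (mulOp (dilate ε χ) f)) (𝓝[>] 0) (𝓝 (χ 0 • l2Class f)) := by
  rw [tendsto_iff_norm_sub_tendsto_zero]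
  have h := (tendsto_integral_norm_dilate_sub_mul_sq hχ (memLp_of_mem_sobolevInfty hf)).sqrt
  rw [Real.sqrt_zero] at h
  refine (h.mono_left nhdsWithin_le_nhds).congr' ?_
  filter_upwards [eventually_mulOp_dilate_mem_sobolevInfty hχ f] with ε hε
  have hf' := Submodule.smul_mem _ (χ 0) hf
  rw [← l2Class_smul _ hf, ← l2Class_sub hε hf', ← Real.sqrt_sq (norm_nonneg (l2Class _)),
    norm_l2Class_sq (memLp_of_mem_sobolevInfty (sub_mem hε hf'))]
  simp [sub_mul]

theorem tendsto_l2Class_wordOp_cutoff (l : List (Fin n ⊕ Fin n)) (hχ : χ ∈ testFunctions n)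
    (hf : f ∈ sobolevInfty n) :
    Tendsto (fun ε : ℝ => l2Class (wordOp l (mulOp (dilate ε χ) f))) (𝓝[>] 0)
      (𝓝 (χ 0 • l2Class (wordOp l f))) := by
  induction l using List.reverseRecOn generalizing χ f with
  | nil => exact tendsto_l2Class_cutoff hχ hf
  | append_singleton l i ih =>
    have hε : Tendsto (fun ε : ℝ => (ε : ℂ)) (𝓝[>] 0) (𝓝 0) :=
      (Complex.continuous_ofReal.tendsto' 0 0 (by simp)).mono_left nhdsWithin_le_nhds
    have h := (hε.smul (ih (V_mem_testFunctions hχ i) hf)).add (ih hχ (V_mem_sobolevInfty i hf))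
    rw [zero_smul, zero_add] at h
    have happend : wordOp (l ++ [i]) = wordOp l * V i := wordOp_append l [i]
    rw [happend]
    refine h.congr' ?_
    filter_upwards [eventually_mulOp_dilate_mem_sobolevInfty (V_mem_testFunctions hχ i) f,
      eventually_mulOp_dilate_mem_sobolevInfty hχ (V i f)] with ε h₁ h₂
    rw [Module.End.mul_apply, V_mulOp_dilate, map_add, map_smul,
      l2Class_add (Submodule.smul_mem _ _ (wordOp_mem_sobolevInfty l h₁))
        (wordOp_mem_sobolevInfty l h₂), l2Class_smul _ (wordOp_mem_sobolevInfty l h₁)]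

theorem tendsto_l2Class_apply_cutoff (hP : P ∈ horizontalOps n k) (hχ : χ ∈ testFunctions n)
    (hf : f ∈ sobolevInfty n) :
    Tendsto (fun ε : ℝ => l2Class (P (mulOp (dilate ε χ) f))) (𝓝[>] 0)
      (𝓝 (χ 0 • l2Class (P f))) := by
  have hmem := eventually_mulOp_dilate_mem_sobolevInfty hχ f
  induction hP using Submodule.span_induction with
  | mem _ hP => obtain ⟨l, -, rfl⟩ := hP; exact tendsto_l2Class_wordOp_cutoff l hχ hf
  | zero =>
    have h₀ : l2Class (0 : Smooth n) = 0 := (sobolevInftyToL2 n).map_zero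
    simpa only [LinearMap.zero_apply, h₀, smul_zero] using tendsto_const_nhds
  | add P Q hP hQ h h' =>
    rw [LinearMap.add_apply, l2Class_add (apply_mem_sobolevInfty hP hf)
      (apply_mem_sobolevInfty hQ hf), smul_add]
    refine (h.add h').congr' ?_
    filter_upwards [hmem] with ε hε
    exact (l2Class_add (apply_mem_sobolevInfty hP hε) (apply_mem_sobolevInfty hQ hε)).symm
  | smul c P hP h =>
    rw [LinearMap.smul_apply, l2Class_smul _ (apply_mem_sobolevInfty hP hf), smul_comm]
    refine (h.const_smul c).congr' ?_
    filter_upwards [hmem] with ε hε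
    exact (l2Class_smul _ (apply_mem_sobolevInfty hP hε)).symm

end HorizontalOps

/-! ### The resolvent on smooth functions -/

section Resolvent

variable {f : Smooth n}

/-- The horizontal jet of a smooth function. -/
def jet (f : Smooth n) : JetSpace n :=
  WithLp.toLp 2 fun i => i.elim (l2Class f) fun k => l2Class (V k f)

theorem coeFn_l2Class_V (hf : f ∈ testFunctions n) (i : Fin n ⊕ Fin n) :
    l2Class (V i f) =ᵐ[volume] (V i f : Heis n → ℂ) :=
  coeFn_l2Class (memLp_of_mem_testFunctions (V_mem_testFunctions hf i))

theorem jet_mem_testJets (hf : f ∈ testFunctions n) : jet f ∈ testJets n := by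
  refine ⟨f, hf, coeFn_l2Class (memLp_of_mem_testFunctions hf), fun j => ?_, fun j => ?_⟩
  · exact X_eq_V j ▸ coeFn_l2Class_V hf (Sum.inl j)
  · exact Y_eq_V j ▸ coeFn_l2Class_V hf (Sum.inr j)

theorem exists_eq_jet_of_mem_testJets {u : JetSpace n} (hu : u ∈ testJets n) :
    ∃ f ∈ testFunctions n, u = jet f := by
  obtain ⟨f, hf, h0, hX, hY⟩ := hu
  refine ⟨f, hf, ?_⟩
  ext1 i
  rcases i with _ | j | j
  · exact Lp.ext (h0.trans (coeFn_l2Class (memLp_of_mem_testFunctions hf)).symm)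
  · exact Lp.ext ((X_eq_V j ▸ hX j).trans (coeFn_l2Class_V hf (Sum.inl j)).symm)
  · exact Lp.ext ((Y_eq_V j ▸ hY j).trans (coeFn_l2Class_V hf (Sum.inr j)).symm)

theorem jet_mem_formDomain (hf : f ∈ sobolevInfty n) : jet f ∈ formDomain n := by
  obtain ⟨χ, hχ, hχ1⟩ := exists_cutoff n
  have h1 : χ 0 = 1 := hχ1.self_of_nhds
  have h : Tendsto (fun ε : ℝ => jet (mulOp (dilate ε χ) f)) (𝓝[>] 0) (𝓝 (jet f)) := by
    refine ((PiLp.continuous_toLp 2 _).tendsto _).comp (tendsto_pi_nhds.2 fun i => ?_)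
    cases i with
    | none => simpa [h1] using tendsto_l2Class_cutoff hχ hf
    | some i => simpa [h1] using tendsto_l2Class_wordOp_cutoff [i] hχ hf
  refine mem_closure_of_tendsto h ?_
  filter_upwards [self_mem_nhdsWithin] with ε hε
  exact jet_mem_testJets
    (mulOp_mem_testFunctions_left (dilate_mem_testFunctions hχ (ne_of_gt hε)) f)

theorem resolvent_shifted (hf : f ∈ sobolevInfty n) :
    resolvent n (l2Class (shifted n f)) = l2Class f := by
  have key : (formDomain n).starProjection
      (ContinuousLinearMap.adjoint (jetProj n) (l2Class (shifted n f))) = jet f := by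
    refine Submodule.eq_starProjection_of_mem_orthogonal (jet_mem_formDomain hf) ?_
    rw [formDomain, Submodule.orthogonal_closure]
    intro u hu
    obtain ⟨φ, hφ, rfl⟩ := exists_eq_jet_of_mem_testJets hu
    rw [inner_sub_right, ContinuousLinearMap.adjoint_inner_right, sub_eq_zero, shifted_apply,
      l2Class_add hf (sublaplacian_mem_sobolevInfty hf), inner_add_right, PiLp.inner_apply,
      Fintype.sum_option]
    change ⟪l2Class φ, l2Class f⟫_ℂ + ⟪l2Class φ, l2Class (sublaplacian n f)⟫_ℂ = _
    rw [inner_sublaplacian hφ hf]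
    rfl
  simp only [resolvent, ContinuousLinearMap.comp_apply]
  rw [key]
  rfl

theorem resolvent_pow_shifted_pow (m : ℕ) (hf : f ∈ sobolevInfty n) :
    (resolvent n ^ m) (l2Class ((shifted n ^ m) f)) = l2Class f := by
  induction m generalizing f with
  | zero => rfl
  | succ m ih =>
    rw [shifted_pow_succ_apply, pow_succ', mul_apply_eq_comp,
      ih (shifted_mem_sobolevInfty hf), resolvent_shifted hf]

theorem norm_jetProj_apply_le (u : JetSpace n) : ‖jetProj n u‖ ≤ ‖u‖ :=
  PiLp.norm_apply_le u none

theorem norm_resolvent_apply_le (f : L2 n) : ‖resolvent n f‖ ≤ ‖f‖ := by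
  have h1 : ‖jetProj n‖ ≤ 1 :=
    ContinuousLinearMap.opNorm_le_bound _ zero_le_one fun u => by
      rw [one_mul]; exact norm_jetProj_apply_le u
  have h2 : ‖ContinuousLinearMap.adjoint (jetProj n) f‖ ≤ ‖f‖ := by
    refine (ContinuousLinearMap.le_opNorm _ _).trans ?_
    rw [LinearIsometryEquiv.norm_map]
    exact mul_le_of_le_one_left (norm_nonneg _) h1
  exact (norm_jetProj_apply_le _).trans
    (((formDomain n).norm_starProjection_apply_le _).trans h2)

theorem norm_l2Class_le_shifted (hf : f ∈ sobolevInfty n) :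
    ‖l2Class f‖ ≤ ‖l2Class (shifted n f)‖ := by
  conv_lhs => rw [← resolvent_shifted hf]
  exact norm_resolvent_apply_le _

theorem norm_l2Class_sublaplacian_le (hf : f ∈ sobolevInfty n) :
    ‖l2Class (sublaplacian n f)‖ ≤ 2 * ‖l2Class (shifted n f)‖ := by
  have h : sublaplacian n f = shifted n f - f := by rw [shifted_apply]; abel
  rw [h, l2Class_sub (shifted_mem_sobolevInfty hf) hf]
  exact (norm_sub_le _ _).trans (by linarith [norm_l2Class_le_shifted hf])

theorem norm_l2Class_shifted_pow_mono (hf : f ∈ sobolevInfty n) {m k : ℕ} (h : m ≤ k) :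
    ‖l2Class ((shifted n ^ m) f)‖ ≤ ‖l2Class ((shifted n ^ k) f)‖ := by
  induction h with
  | refl => exact le_rfl
  | @step k _ ih =>
    refine ih.trans ?_
    rw [Nat.succ_eq_add_one, pow_succ']
    exact norm_l2Class_le_shifted (shifted_pow_mem_sobolevInfty k hf)

end Resolvent

/-! ### Horizontal derivatives of test functions -/

/-- The square root of the quadratic form of the sublaplacian. -/
def horizontalNorm (f : Smooth n) : ℝ := √(∑ i, ‖l2Class (V i f)‖ ^ 2)

section HorizontalNorm

variable {f g : Smooth n}

theorem horizontalNorm_nonneg (f : Smooth n) : 0 ≤ horizontalNorm f := Real.sqrt_nonneg _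

theorem norm_l2Class_V_le_horizontalNorm (i : Fin n ⊕ Fin n) (f : Smooth n) :
    ‖l2Class (V i f)‖ ≤ horizontalNorm f :=
  Real.le_sqrt_of_sq_le <| Finset.single_le_sum (f := fun i => ‖l2Class (V i f)‖ ^ 2)
    (fun i _ => by positivity) (Finset.mem_univ i)

theorem ofReal_horizontalNorm_sq (hf : f ∈ testFunctions n) :
    ((horizontalNorm f ^ 2 : ℝ) : ℂ) = ⟪l2Class f, l2Class (sublaplacian n f)⟫_ℂ := by
  rw [inner_sublaplacian hf (testFunctions_le_sobolevInfty hf), horizontalNorm,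
    Real.sq_sqrt (by positivity)]
  push_cast
  exact Finset.sum_congr rfl fun i _ =>
    (inner_self_eq_norm_sq_to_K (𝕜 := ℂ) (l2Class (V i f))).symm

theorem horizontalNorm_sq_le (hf : f ∈ testFunctions n) :
    horizontalNorm f ^ 2 ≤ ‖l2Class f‖ * ‖l2Class (sublaplacian n f)‖ := by
  have h := norm_inner_le_norm (𝕜 := ℂ) (l2Class f) (l2Class (sublaplacian n f))
  rwa [← ofReal_horizontalNorm_sq hf, Complex.norm_real, Real.norm_of_nonneg (by positivity)] at h

theorem horizontalNorm_le (hf : f ∈ testFunctions n) :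
    horizontalNorm f ≤ 2 * ‖l2Class (shifted n f)‖ := by
  have hf' := testFunctions_le_sobolevInfty hf
  refine le_of_sq_le_sq ?_ (by positivity)
  calc horizontalNorm f ^ 2 ≤ ‖l2Class f‖ * ‖l2Class (sublaplacian n f)‖ :=
        horizontalNorm_sq_le hf
    _ ≤ ‖l2Class (shifted n f)‖ * (2 * ‖l2Class (shifted n f)‖) := by
        gcongr
        exacts [norm_l2Class_le_shifted hf', norm_l2Class_sublaplacian_le hf']
    _ ≤ _ := by nlinarith [norm_nonneg (l2Class (shifted n f))]

theorem norm_inner_T_le (hn : 1 ≤ n) (hf : f ∈ testFunctions n) (hg : g ∈ testFunctions n) :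
    ‖⟪l2Class g, l2Class (T n f)⟫_ℂ‖ ≤ 2 * (horizontalNorm g * horizontalNorm f) := by
  have hf' := testFunctions_le_sobolevInfty hf
  have hV (i k) : ‖⟪l2Class g, l2Class (V i (V k f))⟫_ℂ‖ ≤ horizontalNorm g * horizontalNorm f := by
    rw [inner_V i hg (V_mem_sobolevInfty k hf'), norm_neg]
    exact (norm_inner_le_norm _ _).trans (mul_le_mul (norm_l2Class_V_le_horizontalNorm i g)
      (norm_l2Class_V_le_horizontalNorm k f) (norm_nonneg _) (horizontalNorm_nonneg _))
  have hVV (i k) : V i (V k f) ∈ sobolevInfty n := wordOp_mem_sobolevInfty [i, k] hf'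
  let j : Fin n := ⟨0, hn⟩
  rw [T_eq j, l2Class_sub (hVV _ _) (hVV _ _), inner_sub_right]
  refine (norm_sub_le _ _).trans ?_
  linarith [hV (.inr j) (.inl j), hV (.inl j) (.inr j)]

theorem horizontalNorm_T_le (hn : 1 ≤ n) (hf : f ∈ testFunctions n) :
    horizontalNorm (T n f) ≤ 2 * horizontalNorm (sublaplacian n f) := by
  have h := norm_inner_T_le hn (sublaplacian_mem_testFunctions hf) (T_mem_testFunctions hf)
  rw [T_sublaplacian, ← ofReal_horizontalNorm_sq (T_mem_testFunctions hf), Complex.norm_real,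
    Real.norm_of_nonneg (by positivity)] at h
  by_contra! hc
  nlinarith [horizontalNorm_nonneg (sublaplacian n f), horizontalNorm_nonneg (T n f)]

theorem norm_l2Class_T_le (hn : 1 ≤ n) (hf : f ∈ testFunctions n) :
    ‖l2Class (T n f)‖ ≤ 6 * ‖l2Class ((shifted n ^ 2) f)‖ := by
  have hsf := shifted_mem_sobolevInfty (testFunctions_le_sobolevInfty hf)
  have e : (shifted n ^ 2) f = shifted n (shifted n f) := by rw [pow_two]; rfl
  have hcomm : shifted n (sublaplacian n f) = sublaplacian n (shifted n f) := by
    rw [shifted_apply, shifted_apply, map_add]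
  have hTf : horizontalNorm (T n f) ≤ 8 * ‖l2Class ((shifted n ^ 2) f)‖ := by
    have h₁ := horizontalNorm_le (sublaplacian_mem_testFunctions hf)
    have h₂ := norm_l2Class_sublaplacian_le hsf
    rw [hcomm] at h₁
    rw [e]
    linarith [horizontalNorm_T_le hn hf]
  have hf₂ : horizontalNorm f ≤ 2 * ‖l2Class ((shifted n ^ 2) f)‖ := by
    rw [e]
    linarith [horizontalNorm_le hf, norm_l2Class_le_shifted hsf]
  have h := norm_inner_T_le hn hf (T_mem_testFunctions hf)
  rw [inner_self_eq_norm_sq_to_K, norm_pow, RCLike.norm_ofReal, abs_of_nonneg (norm_nonneg _)] at h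
  refine le_of_sq_le_sq ?_ (by positivity)
  calc ‖l2Class (T n f)‖ ^ 2 ≤ 2 * (horizontalNorm (T n f) * horizontalNorm f) := h
    _ ≤ 2 * ((8 * ‖l2Class ((shifted n ^ 2) f)‖) * (2 * ‖l2Class ((shifted n ^ 2) f)‖)) := by
      gcongr
      exact horizontalNorm_nonneg _
    _ ≤ _ := by nlinarith [norm_nonneg (l2Class ((shifted n ^ 2) f))]

end HorizontalNorm

/-- The operators which map test functions to test functions and are bounded there, in the norm of
`L²`, by a power of `I + ℒ`. -/
def shiftedBoundedOps (n : ℕ) : Submodule ℂ (Module.End ℂ (Smooth n)) where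
  carrier := {P | (∀ f ∈ testFunctions n, P f ∈ testFunctions n) ∧ ∃ (m : ℕ) (C : ℝ), 0 ≤ C ∧
    ∀ f ∈ testFunctions n, ‖l2Class (P f)‖ ≤ C * ‖l2Class ((shifted n ^ m) f)‖}
  add_mem' := by
    rintro P Q ⟨hP, m, C, hC, hb⟩ ⟨hQ, m', C', hC', hb'⟩
    refine ⟨fun f hf => add_mem (hP f hf) (hQ f hf), max m m', C + C', by positivity,
      fun f hf => ?_⟩
    have hf' := testFunctions_le_sobolevInfty hf
    rw [LinearMap.add_apply, l2Class_add (testFunctions_le_sobolevInfty (hP f hf))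
      (testFunctions_le_sobolevInfty (hQ f hf)), add_mul]
    refine (norm_add_le _ _).trans (add_le_add ((hb f hf).trans ?_) ((hb' f hf).trans ?_))
    · exact mul_le_mul_of_nonneg_left (norm_l2Class_shifted_pow_mono hf' (le_max_left _ _)) hC
    · exact mul_le_mul_of_nonneg_left (norm_l2Class_shifted_pow_mono hf' (le_max_right _ _)) hC'
  zero_mem' := by
    have h₀ : l2Class (0 : Smooth n) = 0 := (sobolevInftyToL2 n).map_zero
    exact ⟨fun _ _ => zero_mem _, 0, 0, le_rfl, fun f _ => by simp [h₀]⟩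
  smul_mem' := by
    rintro c P ⟨hP, m, C, hC, hb⟩
    refine ⟨fun f hf => Submodule.smul_mem _ c (hP f hf), m, ‖c‖ * C, by positivity,
      fun f hf => ?_⟩
    rw [LinearMap.smul_apply, l2Class_smul _ (testFunctions_le_sobolevInfty (hP f hf)), norm_smul,
      mul_assoc]
    gcongr
    exact hb f hf

section ShiftedBoundedOps

variable {P Q : Module.End ℂ (Smooth n)}

theorem one_mem_shiftedBoundedOps : 1 ∈ shiftedBoundedOps n :=
  ⟨fun _ hf => hf, 0, 1, zero_le_one, fun f _ => by simp⟩

theorem sublaplacian_mem_shiftedBoundedOps : sublaplacian n ∈ shiftedBoundedOps n :=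
  ⟨fun _ hf => sublaplacian_mem_testFunctions hf, 1, 2, zero_le_two, fun f hf => by
    simpa using norm_l2Class_sublaplacian_le (testFunctions_le_sobolevInfty hf)⟩

theorem T_mem_shiftedBoundedOps (hn : 1 ≤ n) : T n ∈ shiftedBoundedOps n :=
  ⟨fun _ hf => T_mem_testFunctions hf, 2, 6, by norm_num, fun _ hf => norm_l2Class_T_le hn hf⟩

theorem mul_mem_shiftedBoundedOps (hP : P ∈ shiftedBoundedOps n) (hQ : Q ∈ shiftedBoundedOps n)
    (hcomm : Commute (sublaplacian n) Q) : P * Q ∈ shiftedBoundedOps n := by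
  obtain ⟨hP, m, C, hC, hb⟩ := hP
  obtain ⟨hQ, m', C', hC', hb'⟩ := hQ
  refine ⟨fun f hf => hP _ (hQ f hf), m' + m, C * C', by positivity, fun f hf => ?_⟩
  have hQm : (shifted n ^ m) (Q f) = Q ((shifted n ^ m) f) :=
    LinearMap.congr_fun (((Commute.one_left Q).add_left hcomm).pow_left m).eq f
  calc ‖l2Class (P (Q f))‖ ≤ C * ‖l2Class ((shifted n ^ m) (Q f))‖ := hb _ (hQ f hf)
    _ ≤ C * (C' * ‖l2Class ((shifted n ^ m') ((shifted n ^ m) f))‖) := by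
        rw [hQm]
        gcongr
        exact hb' _ (shifted_pow_mem_testFunctions m hf)
    _ = _ := by rw [pow_add, mul_assoc]; rfl

theorem V_mul_mem_shiftedBoundedOps (hP : P ∈ shiftedBoundedOps n)
    (hLP : sublaplacian n * P ∈ shiftedBoundedOps n) (i : Fin n ⊕ Fin n) :
    V i * P ∈ shiftedBoundedOps n := by
  obtain ⟨hP, m, C, hC, hb⟩ := hP
  obtain ⟨-, m', C', -, hb'⟩ := hLP
  refine ⟨fun f hf => V_mem_testFunctions (hP f hf) i, max m m', max C C', by positivity,
    fun f hf => ?_⟩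
  have hmono {k k' : ℕ} (h : k ≤ k') :=
    norm_l2Class_shifted_pow_mono (testFunctions_le_sobolevInfty hf) h
  set B := max C C' * ‖l2Class ((shifted n ^ max m m') f)‖
  have h₁ : ‖l2Class (P f)‖ ≤ B := (hb f hf).trans
    (mul_le_mul (le_max_left _ _) (hmono (le_max_left _ _)) (norm_nonneg _) (by positivity))
  have h₂ : ‖l2Class (sublaplacian n (P f))‖ ≤ B := (hb' f hf).trans
    (mul_le_mul (le_max_right _ _) (hmono (le_max_right _ _)) (norm_nonneg _) (by positivity))
  refine le_of_sq_le_sq ?_ (by positivity)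
  calc ‖l2Class (V i (P f))‖ ^ 2 ≤ horizontalNorm (P f) ^ 2 := by
        gcongr
        exact norm_l2Class_V_le_horizontalNorm i _
    _ ≤ ‖l2Class (P f)‖ * ‖l2Class (sublaplacian n (P f))‖ := horizontalNorm_sq_le (hP f hf)
    _ ≤ B ^ 2 := by rw [pow_two]; gcongr

end ShiftedBoundedOps

/-- The commutator of `ℒ` with a word has, up to the central field `T`, no larger order than the
word, since `[V i, V k]` is a multiple of `T`. -/
theorem exists_sublaplacian_mul_wordOp (l : List (Fin n ⊕ Fin n)) :
    ∃ P ∈ horizontalOps n l.length,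
      sublaplacian n * wordOp l = wordOp l * sublaplacian n + P * T n := by
  induction l with
  | nil => exact ⟨0, zero_mem _, by simp⟩
  | cons i l ih =>
    obtain ⟨P, hP, h⟩ := ih
    have hV : sublaplacian n * V i = V i * sublaplacian n +
        ∑ k, (-((4 * symp (frame k) (frame i) : ℝ) : ℂ)) • (V k * T n) := by
      ext1 f
      simp only [Module.End.mul_apply, LinearMap.add_apply, LinearMap.sum_apply,
        LinearMap.smul_apply, sublaplacian_V, sub_eq_add_neg, neg_smul, Finset.sum_neg_distrib]
    have hT : T n * wordOp l = wordOp l * T n := LinearMap.ext (T_wordOp l)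
    have hmem (k : Fin n ⊕ Fin n) {Q} (hQ : Q ∈ horizontalOps n l.length) :
        V k * Q ∈ horizontalOps n (i :: l).length := by
      rw [List.length_cons, add_comm]
      exact mul_mem_horizontalOps (wordOp_mem_horizontalOps (l := [k]) le_rfl) hQ
    refine ⟨V i * P + ∑ k, (-((4 * symp (frame k) (frame i) : ℝ) : ℂ)) • (V k * wordOp l),
      add_mem (hmem i hP) (sum_mem fun k _ => Submodule.smul_mem _ _
        (hmem k (wordOp_mem_horizontalOps le_rfl))), ?_⟩
    rw [wordOp_cons, ← mul_assoc, hV, add_mul, mul_assoc, h, add_mul, Finset.sum_mul,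
      Finset.sum_mul]
    simp only [smul_mul_assoc, mul_assoc, hT, mul_add, add_assoc]

theorem wordOp_mem_shiftedBoundedOps (hn : 1 ≤ n) (l : List (Fin n ⊕ Fin n)) :
    wordOp l ∈ shiftedBoundedOps n := by
  induction h : l.length using Nat.strong_induction_on generalizing l with
  | _ k ih =>
    rcases l with _ | ⟨i, l⟩
    · exact one_mem_shiftedBoundedOps
    have hlt {l' : List (Fin n ⊕ Fin n)} (hl' : l'.length ≤ l.length) :
        wordOp l' ∈ shiftedBoundedOps n := ih _ (by simp_all; omega) l' rfl
    obtain ⟨P, hP, hLP⟩ := exists_sublaplacian_mul_wordOp l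
    have hP' : P ∈ shiftedBoundedOps n :=
      Submodule.span_le.2 (by rintro _ ⟨l', hl', rfl⟩; exact hlt hl') hP
    rw [wordOp_cons]
    refine V_mul_mem_shiftedBoundedOps (hlt le_rfl) ?_ i
    rw [hLP]
    exact add_mem (mul_mem_shiftedBoundedOps (hlt le_rfl) sublaplacian_mem_shiftedBoundedOps
      (Commute.refl _)) (mul_mem_shiftedBoundedOps hP' (T_mem_shiftedBoundedOps hn)
      (LinearMap.ext fun f => (T_sublaplacian f).symm))

theorem exists_norm_wordOp_le (hn : 1 ≤ n) (l : List (Fin n ⊕ Fin n)) :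
    ∃ (m : ℕ) (C : ℝ), 0 ≤ C ∧ ∀ f ∈ testFunctions n,
      ‖l2Class (wordOp l f)‖ ≤ C * ‖l2Class ((shifted n ^ m) f)‖ :=
  (wordOp_mem_shiftedBoundedOps hn l).2

/-! ### The Sobolev inequality at the origin -/

/-- The product of the constant coefficient fields `D w`, for `w` in a list. -/
def iteratedD (ws : List (Heis n)) : Module.End ℂ (Smooth n) := (ws.map D).prod

theorem iteratedD_cons (w : Heis n) (ws : List (Heis n)) :
    iteratedD (w :: ws) = D w * iteratedD ws := by simp [iteratedD]

theorem iteratedD_append_singleton (ws : List (Heis n)) (w : Heis n) :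
    iteratedD (ws ++ [w]) = iteratedD ws * D w := by simp [iteratedD]

theorem iteratedD_mem_testFunctions (ws : List (Heis n)) {f : Smooth n}
    (hf : f ∈ testFunctions n) : iteratedD ws f ∈ testFunctions n := by
  induction ws with
  | nil => exact hf
  | cons w ws ih =>
    rw [iteratedD_cons]
    exact fieldOp_mem_testFunctions ih contDiff_const

theorem mixedDeriv_comp {ι : Type*} [Finite ι] [DecidableEq ι] (e : (ι → ℝ) ≃L[ℝ] Heis n)
    (l : List ι) (f : Smooth n) :
    mixedDeriv l ((f : Heis n → ℂ) ∘ e) = iteratedD (l.map fun i => e (Pi.single i 1)) f ∘ e := by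
  cases nonempty_fintype ι
  induction l with
  | nil => rfl
  | cons i l ih =>
    ext y
    rw [mixedDeriv_cons, ih, List.map_cons, iteratedD_cons]
    beta_reduce
    rw [fderiv_comp y ((contDiff_coe _).differentiable (by simp) _) e.differentiableAt, e.fderiv]
    rfl

theorem exists_norm_apply_zero_le_integral_iteratedD (n : ℕ) :
    ∃ (ws : List (Heis n)) (C : ℝ), 0 ≤ C ∧ ∀ f ∈ testFunctions n,
      ‖f 0‖ ≤ C * ∫ p, ‖iteratedD ws f p‖ := by
  let d := Module.finrank ℝ (Heis n)
  let e : (Fin d → ℝ) ≃L[ℝ] Heis n := (Module.finBasis ℝ (Heis n)).equivFunL.symm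
  let ws : List (Heis n) := (List.finRange d).map fun i => e (Pi.single i 1)
  let μ : Measure (Heis n) := Measure.map e volume
  have hμ : μ = μ.addHaarScalarFactor volume • (volume : Measure (Heis n)) :=
    Measure.isAddLeftInvariant_eq_smul μ volume
  refine ⟨ws, μ.addHaarScalarFactor volume, NNReal.coe_nonneg _, fun f hf => ?_⟩
  have hmixed := enorm_le_lmarginal_mixedDeriv (List.nodup_finRange d)
    ((contDiff_coe f).comp e.contDiff)
    (HasCompactSupport.comp_homeomorph (f := (f : Heis n → ℂ)) hf e.toHomeomorph) 0
  have huniv : (List.finRange d).toFinset = Finset.univ := by ext; simp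
  rw [huniv, lmarginal_univ, mixedDeriv_comp] at hmixed
  have hμf : ‖f 0‖ₑ ≤ ∫⁻ p, ‖iteratedD ws f p‖ₑ ∂μ := by
    rw [lintegral_map (contDiff_coe _).continuous.enorm.measurable e.continuous.measurable]
    simpa [volume_pi] using hmixed
  have hint := integrable_of_mem_testFunctions (iteratedD_mem_testFunctions ws hf)
  rw [hμ, lintegral_smul_measure, ← ofReal_integral_norm_eq_lintegral_enorm hint,
    ← ofReal_norm, ENNReal.smul_def, smul_eq_mul, ← ENNReal.ofReal_coe_nnreal,
    ← ENNReal.ofReal_mul (NNReal.coe_nonneg _)] at hμf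
  exact (ENNReal.ofReal_le_ofReal_iff (by positivity)).1 hμf

theorem leftDeriv_eq_sum (w : Heis n) (f : Smooth n) :
    leftDeriv w f = (∑ j, (((w.1 j).re : ℂ) • V (.inl j) f + ((w.1 j).im : ℂ) • V (.inr j) f)) +
      (w.2 : ℂ) • T n f := by
  ext p
  have hw : leftField w p = (∑ j, ((w.1 j).re • leftField (frame (.inl j), 0) p +
      (w.1 j).im • leftField (frame (.inr j), 0) p)) + w.2 • ((0, 1) : Heis n) := by
    have h : w.1 = ∑ j, ((w.1 j).re • frame (.inl j) + (w.1 j).im • frame (.inr j)) := by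
      ext k
      simp [frame, Finset.sum_apply, Pi.single_apply, Finset.sum_add_distrib]
    ext k
    · conv_lhs => rw [leftField, h]
      simp [leftField, Prod.fst_sum]
    · conv_lhs => rw [leftField, h]
      simp [leftField, Prod.snd_sum, add_comm]
  rw [leftDeriv_apply, hw]
  simp only [map_add, map_sum, map_smul, Complex.real_smul]
  simp only [Submodule.coe_add, Pi.add_apply, AddSubmonoidClass.coe_finsetSum, Finset.sum_apply]
  rfl

theorem mulOp_mulOp (c b : Smooth n) : mulOp c * mulOp b = mulOp (mulOp c b) := by
  ext f p
  simp [mul_assoc]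

theorem integral_norm_mulOp_le {c g : Smooth n} (hc : c ∈ testFunctions n)
    (hg : g ∈ testFunctions n) : ∫ p, ‖mulOp c g p‖ ≤ ‖l2Class c‖ * ‖l2Class g‖ := by
  have h := integral_mul_norm_le_Lp_mul_Lq (μ := (volume : Measure (Heis n)))
    (p := 2) (q := 2) (f := (c : Heis n → ℂ)) (g := (g : Heis n → ℂ))
    (by constructor <;> norm_num) (by simpa using memLp_of_mem_testFunctions hc)
    (by simpa using memLp_of_mem_testFunctions hg)
  have hnorm (f) (hf : f ∈ testFunctions n) :
      (∫ p, ‖f p‖ ^ (2 : ℝ)) ^ (1 / 2 : ℝ) = ‖l2Class f‖ := by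
    simp only [Real.rpow_two]
    rw [← norm_l2Class_sq (memLp_of_mem_testFunctions hf), ← Real.sqrt_eq_rpow,
      Real.sqrt_sq (norm_nonneg _)]
  rw [hnorm c hc, hnorm g hg] at h
  simpa only [mulOp_apply, norm_mul] using h

/-- The operators which map test functions to test functions and are bounded there, from the norm
of `L²` to the norm of `L¹`, by a power of `I + ℒ`. -/
def l1BoundedOps (n : ℕ) : Submodule ℂ (Module.End ℂ (Smooth n)) where
  carrier := {P | (∀ f ∈ testFunctions n, P f ∈ testFunctions n) ∧ ∃ (m : ℕ) (C : ℝ), 0 ≤ C ∧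
    ∀ f ∈ testFunctions n, ∫ p, ‖P f p‖ ≤ C * ‖l2Class ((shifted n ^ m) f)‖}
  add_mem' := by
    rintro P Q ⟨hP, m, C, hC, hb⟩ ⟨hQ, m', C', hC', hb'⟩
    refine ⟨fun f hf => add_mem (hP f hf) (hQ f hf), max m m', C + C', by positivity,
      fun f hf => ?_⟩
    have hf' := testFunctions_le_sobolevInfty hf
    have hPf := (integrable_of_mem_testFunctions (hP f hf)).norm
    have hQf := (integrable_of_mem_testFunctions (hQ f hf)).norm
    calc ∫ p, ‖(P + Q) f p‖ ≤ ∫ p, (‖P f p‖ + ‖Q f p‖) :=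
          integral_mono (integrable_of_mem_testFunctions (add_mem (hP f hf) (hQ f hf))).norm
            (hPf.add hQf) fun p => norm_add_le _ _
      _ = (∫ p, ‖P f p‖) + ∫ p, ‖Q f p‖ := integral_add hPf hQf
      _ ≤ C * ‖l2Class ((shifted n ^ max m m') f)‖ + C' * ‖l2Class ((shifted n ^ max m m') f)‖ :=
          add_le_add
            ((hb f hf).trans (mul_le_mul_of_nonneg_left
              (norm_l2Class_shifted_pow_mono hf' (le_max_left _ _)) hC))
            ((hb' f hf).trans (mul_le_mul_of_nonneg_left
              (norm_l2Class_shifted_pow_mono hf' (le_max_right _ _)) hC'))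
      _ = _ := (add_mul _ _ _).symm
  zero_mem' := ⟨fun _ _ => zero_mem _, 0, 0, le_rfl, fun _ _ => by simp⟩
  smul_mem' := by
    rintro c P ⟨hP, m, C, hC, hb⟩
    refine ⟨fun f hf => Submodule.smul_mem _ c (hP f hf), m, ‖c‖ * C, by positivity,
      fun f hf => ?_⟩
    have hnorm (p : Heis n) : ‖(c • P) f p‖ = ‖c‖ * ‖P f p‖ := norm_smul c (P f p)
    simp only [hnorm]
    rw [integral_const_mul, mul_assoc]
    gcongr
    exact hb f hf

theorem mulOp_mul_wordOp_mem_l1BoundedOps (hn : 1 ≤ n) {c : Smooth n} (hc : c ∈ testFunctions n)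
    (l : List (Fin n ⊕ Fin n)) : mulOp c * wordOp l ∈ l1BoundedOps n := by
  obtain ⟨m, C, hC, hb⟩ := exists_norm_wordOp_le hn l
  refine ⟨fun f _ => mulOp_mem_testFunctions_left hc _, m, ‖l2Class c‖ * C, by positivity,
    fun f hf => (integral_norm_mulOp_le hc (wordOp_mem_testFunctions l hf)).trans ?_⟩
  rw [mul_assoc]
  gcongr
  exact hb f hf

theorem T_mul_wordOp (j : Fin n) (l : List (Fin n ⊕ Fin n)) :
    T n * wordOp l =
      wordOp (.inr j :: .inl j :: l) + (-1 : ℂ) • wordOp (.inl j :: .inr j :: l) := by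
  ext1 f
  simp only [Module.End.mul_apply, LinearMap.add_apply, LinearMap.smul_apply, wordOp_cons, T_eq j]
  module

theorem D_mul_mulOp_mul_wordOp (w : Heis n) (c : Smooth n) (l : List (Fin n ⊕ Fin n)) :
    D w * (mulOp c * wordOp l) = mulOp (D w c) * wordOp l +
      (∑ j, (((w.1 j).re : ℂ) • (mulOp c * wordOp (.inl j :: l)) +
        ((w.1 j).im : ℂ) • (mulOp c * wordOp (.inr j :: l)))) +
      ((w.2 : ℂ) • (mulOp c * (T n * wordOp l)) +
        (-1 : ℂ) • (mulOp (mulOp c (linearFun (symp.flip w.1))) * (T n * wordOp l))) := by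
  ext1 f
  have hD := leftDeriv_eq_D_add w (wordOp l f)
  rw [leftDeriv_eq_sum, ← sub_eq_iff_eq_add] at hD
  have hmul : D w (mulOp c (wordOp l f)) =
      mulOp (D w c) (wordOp l f) + mulOp c (D w (wordOp l f)) :=
    fieldOp_mulOp _ _ _ _
  simp only [Module.End.mul_apply, LinearMap.add_apply, LinearMap.smul_apply, wordOp_cons,
    LinearMap.sum_apply, hmul, ← hD, map_add, map_sum, map_smul, map_sub, ← mulOp_mulOp]
  module

theorem iteratedD_mul_mem_l1BoundedOps (hn : 1 ≤ n) (ws : List (Heis n)) {c : Smooth n}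
    (hc : c ∈ testFunctions n) (l : List (Fin n ⊕ Fin n)) :
    iteratedD ws * (mulOp c * wordOp l) ∈ l1BoundedOps n := by
  induction ws using List.reverseRecOn generalizing c l with
  | nil => exact mulOp_mul_wordOp_mem_l1BoundedOps hn hc l
  | append_singleton ws w ih =>
    have hT {b : Smooth n} (hb : b ∈ testFunctions n) :
        iteratedD ws * (mulOp b * (T n * wordOp l)) ∈ l1BoundedOps n := by
      rw [T_mul_wordOp ⟨0, hn⟩, mul_add, mul_add, mul_smul_comm, mul_smul_comm]
      exact add_mem (ih hb _) (Submodule.smul_mem _ _ (ih hb _))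
    rw [iteratedD_append_singleton, mul_assoc, D_mul_mulOp_mul_wordOp]
    simp only [mul_add, Finset.mul_sum, mul_smul_comm]
    refine add_mem (add_mem (ih (fieldOp_mem_testFunctions hc contDiff_const) l)
      (sum_mem fun j _ => add_mem ?_ ?_)) (add_mem ?_ ?_)
    all_goals apply Submodule.smul_mem
    exacts [ih hc _, ih hc _, hT hc, hT (mulOp_mem_testFunctions_left hc _)]

theorem exists_norm_apply_zero_le (hn : 1 ≤ n) : ∃ (m : ℕ) (C : ℝ), 0 ≤ C ∧
    ∀ f ∈ testFunctions n, ‖f 0‖ ≤ C * ‖l2Class ((shifted n ^ m) f)‖ := by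
  obtain ⟨χ, hχ, hχ₁⟩ := exists_cutoff n
  obtain ⟨ws, C, hC, hb⟩ := exists_norm_apply_zero_le_integral_iteratedD n
  obtain ⟨-, m, C', hC', hb'⟩ := iteratedD_mul_mem_l1BoundedOps hn ws hχ []
  refine ⟨m, C * C', by positivity, fun f hf => ?_⟩
  have hχf : mulOp χ f 0 = f 0 := by rw [mulOp_apply, hχ₁.self_of_nhds, Pi.one_apply, one_mul]
  rw [← hχf, mul_assoc]
  exact (hb _ (mulOp_mem_testFunctions_left hχ f)).trans
    (mul_le_mul_of_nonneg_left (hb' f hf) hC)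

/-- The operator `I + a ℒ` on smooth functions. -/
def shiftedBy (n : ℕ) (a : ℝ) : Module.End ℂ (Smooth n) := 1 + (a : ℂ) • sublaplacian n

theorem shiftedBy_apply (a : ℝ) (f : Smooth n) :
    shiftedBy n a f = f + (a : ℂ) • sublaplacian n f := rfl

theorem shiftedBy_pow_mem_testFunctions (a : ℝ) (m : ℕ) {f : Smooth n}
    (hf : f ∈ testFunctions n) : (shiftedBy n a ^ m) f ∈ testFunctions n := by
  induction m with
  | zero => exact hf
  | succ m ih =>
    rw [pow_succ']
    exact add_mem ih (Submodule.smul_mem _ _ (sublaplacian_mem_testFunctions ih))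

theorem shifted_pow_dilate (r : ℝ) (m : ℕ) (f : Smooth n) :
    (shifted n ^ m) (dilate r f) = dilate r ((shiftedBy n (r ^ 2) ^ m) f) := by
  induction m generalizing f with
  | zero => rfl
  | succ m ih =>
    have hcomm : shifted n (dilate r f) = dilate r (shiftedBy n (r ^ 2) f) := by
      rw [shifted_apply, sublaplacian_dilate, shiftedBy_apply, map_add, map_smul,
        Complex.ofReal_pow]
    rw [shifted_pow_succ_apply, hcomm, ih, pow_succ (shiftedBy n _), Module.End.mul_apply]

theorem exists_norm_apply_zero_le_shiftedBy (hn : 1 ≤ n) : ∃ (m₀ : ℕ) (C : ℝ), 0 ≤ C ∧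
    ∀ m ≥ m₀, ∀ r : ℝ, 0 < r → ∀ f ∈ testFunctions n,
      ‖f 0‖ ≤ C * (r ^ (n + 1))⁻¹ * ‖l2Class ((shiftedBy n (r ^ 2) ^ m) f)‖ := by
  obtain ⟨m₀, C, hC, hb⟩ := exists_norm_apply_zero_le hn
  refine ⟨m₀, C, hC, fun m hm r hr f hf => ?_⟩
  have hdil := dilate_mem_testFunctions hf hr.ne'
  have h := (hb _ hdil).trans (mul_le_mul_of_nonneg_left
    (norm_l2Class_shifted_pow_mono (testFunctions_le_sobolevInfty hdil) hm) hC)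
  rwa [shifted_pow_dilate, norm_l2Class_dilate hr (shiftedBy_pow_mem_testFunctions _ m hf),
    dilate_apply, map_zero, ← mul_assoc] at h

/-! ### Square integrability of derivatives -/

section Regularity

variable {f g u : Smooth n}

theorem norm_l2Class_le_of_norm_apply_le {C : ℝ}
    (hf : MemLp (f : Heis n → ℂ) 2 volume) (hg : MemLp (g : Heis n → ℂ) 2 volume)
    (h : ∀ p, ‖f p‖ ≤ C * ‖g p‖) : ‖l2Class f‖ ≤ C * ‖l2Class g‖ := by
  refine Lp.norm_le_mul_norm_of_ae_le_mul ?_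
  filter_upwards [coeFn_l2Class hf, coeFn_l2Class hg] with p hfp hgp
  rw [hfp, hgp]
  exact h p

theorem norm_l2Class_conjugate (hf : MemLp (f : Heis n → ℂ) 2 volume) :
    ‖l2Class (conjugate f)‖ = ‖l2Class f‖ := by
  have hf' : MemLp (conjugate f : Heis n → ℂ) 2 volume := hf.star
  refine (sq_eq_sq₀ (norm_nonneg _) (norm_nonneg _)).1 ?_
  rw [norm_l2Class_sq hf, norm_l2Class_sq hf']
  simp only [conjugate_apply, RCLike.norm_conj]

theorem norm_integral_mul_le (hf : MemLp (f : Heis n → ℂ) 2 volume)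
    (hg : MemLp (g : Heis n → ℂ) 2 volume) : ‖∫ p, f p * g p‖ ≤ ‖l2Class f‖ * ‖l2Class g‖ := by
  have h := norm_inner_le_norm (𝕜 := ℂ) (l2Class (conjugate f)) (l2Class g)
  rw [inner_l2Class (hf.star : MemLp (conjugate f : Heis n → ℂ) 2 volume) hg,
    norm_l2Class_conjugate hf] at h
  simpa only [conjugate_apply, Complex.conj_conj] using h

theorem memLp_of_norm_l2Class_cutoff_le {χ : Smooth n} (hχ : χ ∈ testFunctions n) (hχ0 : χ 0 = 1)
    {C : ℝ} (h : ∀ ε, 0 < ε → ε ≤ 1 → ‖l2Class (mulOp (dilate ε χ) u)‖ ≤ C) :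
    MemLp (u : Heis n → ℂ) 2 volume := by
  let ε : ℕ → ℝ := fun k => 1 / (k + 1)
  have hε (k : ℕ) : 0 < ε k := Nat.one_div_pos_of_nat
  have hε1 (k : ℕ) : ε k ≤ 1 := (div_le_one (by positivity)).2 (by simp)
  have hmem (k : ℕ) : MemLp (mulOp (dilate (ε k) χ) u : Heis n → ℂ) 2 volume :=
    memLp_of_mem_testFunctions
      (mulOp_mem_testFunctions_left (dilate_mem_testFunctions hχ (hε k).ne') u)
  have hle (k : ℕ) : eLpNorm (mulOp (dilate (ε k) χ) u : Heis n → ℂ) 2 volume ≤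
      ENNReal.ofReal C := by
    rw [← ENNReal.ofReal_toReal (hmem k).eLpNorm_ne_top]
    refine ENNReal.ofReal_le_ofReal (le_of_eq_of_le ?_ (h (ε k) (hε k) (hε1 k)))
    rw [l2Class_eq_toLp (hmem k), Lp.norm_toLp]
  have hlim (p : Heis n) : Tendsto (fun k => mulOp (dilate (ε k) χ) u p) atTop (𝓝 (u p)) := by
    have hd : Continuous fun r : ℝ => dil r p := by simp only [dil_apply]; fun_prop
    have hχc := (contDiff_coe χ).continuous
    have hc : Continuous fun r : ℝ => χ (dil r p) * u p := by fun_prop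
    refine (hc.tendsto' 0 (u p) ?_).comp tendsto_one_div_add_atTop_nhds_zero_nat
    simp [dil_zero_left, hχ0]
  refine ⟨(contDiff_coe u).continuous.aestronglyMeasurable, lt_of_le_of_lt
    (Lp.eLpNorm_lim_le_liminf_eLpNorm (fun k => (hmem k).1) _ (.of_forall hlim)) ?_⟩
  exact lt_of_le_of_lt (liminf_le_of_le (by isBoundedDefault) fun b hb =>
    hb.exists.choose_spec.trans (hle _)) ENNReal.ofReal_lt_top

theorem memLp_of_norm_integral_mul_le {C : ℝ} (hC : 0 ≤ C)
    (h : ∀ ψ ∈ testFunctions n, ‖∫ p, u p * ψ p‖ ≤ C * ‖l2Class ψ‖) :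
    MemLp (u : Heis n → ℂ) 2 volume := by
  obtain ⟨χ, hχ, hχ1⟩ := exists_cutoff n
  obtain ⟨M, hM⟩ := exists_norm_apply_le hχ
  refine memLp_of_norm_l2Class_cutoff_le (C := C * M) hχ hχ1.eq_of_nhds fun ε hε _ => ?_
  have hχε := dilate_mem_testFunctions hχ hε.ne'
  have hw := mulOp_mem_testFunctions_left hχε u
  set w := mulOp (dilate ε χ) u
  have hψ := mulOp_mem_testFunctions_left hχε (conjugate w)
  have hbound : ‖l2Class (mulOp (dilate ε χ) (conjugate w))‖ ≤ M * ‖l2Class w‖ := by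
    refine norm_l2Class_le_of_norm_apply_le
      (memLp_of_mem_testFunctions hψ) (memLp_of_mem_testFunctions hw) fun p => ?_
    rw [mulOp_apply, norm_mul, conjugate_apply, RCLike.norm_conj, dilate_apply]
    exact mul_le_mul_of_nonneg_right (hM _) (norm_nonneg _)
  have hsq : ∫ p, u p * mulOp (dilate ε χ) (conjugate w) p = (‖l2Class w‖ : ℂ) ^ 2 := by
    rw [← Complex.ofReal_pow, norm_l2Class_sq (memLp_of_mem_testFunctions hw),
      ← integral_complex_ofReal]
    refine integral_congr_ae (.of_forall fun p => ?_)
    change _ = ((‖w p‖ ^ 2 : ℝ) : ℂ)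
    rw [Complex.ofReal_pow, ← Complex.mul_conj']
    simp only [mulOp_apply, conjugate_apply, w]
    ring
  have hle := (h _ hψ).trans (mul_le_mul_of_nonneg_left hbound hC)
  rw [hsq, norm_pow, Complex.norm_real, norm_norm] at hle
  nlinarith [norm_nonneg (l2Class w), mul_nonneg hC ((norm_nonneg _).trans (hM 0))]

theorem re_mul_conj_add_mul_conj_ge (x y v z : ℂ) :
    ‖x * z‖ ^ 2 / 2 - 2 * ‖y * v‖ ^ 2 ≤
      ((y * starRingEnd ℂ (x * v) + x * starRingEnd ℂ (y * v + x * z)) * z).re := by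
  have hsplit : (y * starRingEnd ℂ (x * v) + x * starRingEnd ℂ (y * v + x * z)) * z =
      y * starRingEnd ℂ (x * v) * z + x * starRingEnd ℂ (y * v) * z +
        ((‖x * z‖ ^ 2 : ℝ) : ℂ) := by
    rw [Complex.ofReal_pow, ← Complex.mul_conj', map_add]
    ring
  have h1 : ‖y * starRingEnd ℂ (x * v) * z‖ = ‖x * z‖ * ‖y * v‖ := by
    simp only [norm_mul, RCLike.norm_conj]
    ring
  have h2 : ‖x * starRingEnd ℂ (y * v) * z‖ = ‖x * z‖ * ‖y * v‖ := by
    simp only [norm_mul, RCLike.norm_conj]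
    ring
  rw [hsplit, Complex.add_re, Complex.add_re, Complex.ofReal_re]
  nlinarith [(abs_le.1 (Complex.abs_re_le_norm (y * starRingEnd ℂ (x * v) * z))).1,
    (abs_le.1 (Complex.abs_re_le_norm (x * starRingEnd ℂ (y * v) * z))).1,
    sq_nonneg (‖x * z‖ - 2 * ‖y * v‖)]

/-- Caccioppoli's inequality, obtained by testing against `χ² · conj v`. -/
theorem sum_norm_l2Class_mulOp_V_le {χ : Smooth n} (hχ : χ ∈ testFunctions n) (v : Smooth n) :
    ∑ i, ‖l2Class (mulOp χ (V i v))‖ ^ 2 ≤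
      2 * (‖l2Class (mulOp χ v)‖ * ‖l2Class (mulOp χ (sublaplacian n v))‖) +
        4 * ∑ i, ‖l2Class (mulOp (V i χ) v)‖ ^ 2 := by
  have hw := conjugate_mem_testFunctions (mulOp_mem_testFunctions_left hχ v)
  set w := conjugate (mulOp χ v) with hwdef
  have hf := mulOp_mem_testFunctions_left hχ w
  have hVw (i : Fin n ⊕ Fin n) :
      V i w = conjugate (mulOp (V i χ) v + mulOp χ (V i v)) := by rw [hwdef, V_conjugate, V_mulOp]
  have hterm (i : Fin n ⊕ Fin n) :
      ‖l2Class (mulOp χ (V i v))‖ ^ 2 / 2 - 2 * ‖l2Class (mulOp (V i χ) v)‖ ^ 2 ≤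
        (∫ p, V i (mulOp χ w) p * V i v p).re := by
    have ha := memLp_of_mem_testFunctions (mulOp_mem_testFunctions_left hχ (V i v))
    have hb := memLp_of_mem_testFunctions
      (mulOp_mem_testFunctions_left (V_mem_testFunctions hχ i) v)
    have ha' := (ha.integrable_norm_pow two_ne_zero).div_const 2
    have hb' := (hb.integrable_norm_pow two_ne_zero).const_mul 2
    have hint : Integrable fun p => V i (mulOp χ w) p * V i v p :=
      integrable_of_mem_testFunctions (mulOp_mem_testFunctions_left (V_mem_testFunctions hf i) _)
    rw [norm_l2Class_sq ha, norm_l2Class_sq hb, ← integral_div, ← integral_const_mul,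
      ← integral_sub ha' hb']
    refine le_trans (integral_mono (ha'.sub hb') hint.re fun p => ?_)
      (integral_re hint).le
    have h := re_mul_conj_add_mul_conj_ge (χ p) (V i χ p) (v p) (V i v p)
    rw [V_mulOp, hVw]
    exact h
  have hIBP : ∫ p, w p * mulOp χ (sublaplacian n v) p = ∑ i, ∫ p, V i (mulOp χ w) p * V i v p := by
    rw [← integral_mul_sublaplacian hf]
    refine integral_congr_ae (.of_forall fun p => ?_)
    simp only [mulOp_apply]
    ring
  have hle := norm_integral_mul_le (memLp_of_mem_testFunctions hw) (memLp_of_mem_testFunctions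
    (mulOp_mem_testFunctions_left hχ (sublaplacian n v)))
  rw [hwdef, norm_l2Class_conjugate (memLp_of_mem_testFunctions
    (mulOp_mem_testFunctions_left hχ v)), ← hwdef, hIBP] at hle
  have hre := (Complex.re_le_norm _).trans hle
  rw [Complex.re_sum] at hre
  have hsum := (Finset.sum_le_sum fun i (_ : i ∈ Finset.univ) => hterm i).trans hre
  rw [Finset.sum_sub_distrib, ← Finset.sum_div, ← Finset.mul_sum] at hsum
  linarith

theorem memLp_V {v : Smooth n} (hv : MemLp (v : Heis n → ℂ) 2 volume)
    (hLv : MemLp (sublaplacian n v : Heis n → ℂ) 2 volume) (i : Fin n ⊕ Fin n) :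
    MemLp (V i v : Heis n → ℂ) 2 volume := by
  obtain ⟨χ, hχ, hχ1⟩ := exists_cutoff n
  obtain ⟨M, hM⟩ := exists_norm_apply_le hχ
  choose K hK using fun j => exists_norm_apply_le (V_mem_testFunctions hχ j)
  set B := 2 * ((M * ‖l2Class v‖) * (M * ‖l2Class (sublaplacian n v)‖)) +
    4 * ∑ j, (K j * ‖l2Class v‖) ^ 2
  refine memLp_of_norm_l2Class_cutoff_le (C := √B) hχ hχ1.eq_of_nhds fun ε hε hε1 =>
    Real.le_sqrt_of_sq_le ?_
  have hχε := dilate_mem_testFunctions hχ hε.ne'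
  have hmul {u : Smooth n} (hu : MemLp (u : Heis n → ℂ) 2 volume) :
      ‖l2Class (mulOp (dilate ε χ) u)‖ ≤ M * ‖l2Class u‖ :=
    norm_l2Class_le_of_norm_apply_le
      (memLp_of_mem_testFunctions (mulOp_mem_testFunctions_left hχε u)) hu fun p =>
        (norm_mul _ _).trans_le (mul_le_mul_of_nonneg_right (hM _) (norm_nonneg _))
  have hV (j : Fin n ⊕ Fin n) : ‖l2Class (mulOp (V j (dilate ε χ)) v)‖ ≤ K j * ‖l2Class v‖ := by
    refine norm_l2Class_le_of_norm_apply_le (memLp_of_mem_testFunctions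
      (mulOp_mem_testFunctions_left (V_mem_testFunctions hχε j) v)) hv fun p => ?_
    rw [mulOp_apply, norm_mul, V_dilate]
    refine mul_le_mul_of_nonneg_right ?_ (norm_nonneg _)
    change ‖(ε : ℂ) * V j χ (dil ε p)‖ ≤ K j
    rw [norm_mul, Complex.norm_of_nonneg hε.le]
    exact (mul_le_of_le_one_left (norm_nonneg _) hε1).trans (hK j _)
  refine (Finset.single_le_sum (f := fun j => ‖l2Class (mulOp (dilate ε χ) (V j v))‖ ^ 2)
    (fun _ _ => sq_nonneg _) (Finset.mem_univ i)).trans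
    ((sum_norm_l2Class_mulOp_V_le hχε v).trans ?_)
  have hM0 : 0 ≤ M := (norm_nonneg _).trans (hM 0)
  exact add_le_add
    (mul_le_mul_of_nonneg_left (mul_le_mul (hmul hv) (hmul hLv) (norm_nonneg _) (by positivity))
      zero_le_two)
    (mul_le_mul_of_nonneg_left (Finset.sum_le_sum fun j _ =>
      pow_le_pow_left₀ (norm_nonneg _) (hV j) 2) (by norm_num))

theorem mem_sobolevInfty_of_forall_memLp {W : Set (Smooth n)}
    (hW : ∀ f ∈ W, MemLp (f : Heis n → ℂ) 2 volume) (hL : ∀ f ∈ W, shifted n f ∈ W)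
    (hT : ∀ f ∈ W, T n f ∈ W) {f : Smooth n} (hf : f ∈ W) : f ∈ sobolevInfty n := by
  intro l
  induction h : l.length using Nat.strong_induction_on generalizing l f with
  | _ k ih =>
    rcases l with _ | ⟨i, l⟩
    · exact hW f hf
    have hlt {g : Smooth n} (hg : g ∈ W) {l' : List (Fin n ⊕ Fin n)} (hl' : l'.length ≤ l.length) :
        MemLp (wordOp l' g : Heis n → ℂ) 2 volume := ih _ (by simp_all; omega) hg l' rfl
    have hPT {P : Module.End ℂ (Smooth n)} (hP : P ∈ horizontalOps n l.length) :
        MemLp (P (T n f) : Heis n → ℂ) 2 volume := by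
      induction hP using Submodule.span_induction with
      | mem _ hP => obtain ⟨l', hl', rfl⟩ := hP; exact hlt (hT f hf) hl'
      | zero => exact MemLp.zero
      | add _ _ _ _ h h' => exact h.add h'
      | smul c _ _ h => exact h.const_smul c
    obtain ⟨P, hP, hLP⟩ := exists_sublaplacian_mul_wordOp l
    rw [wordOp_cons]
    refine memLp_V (hlt hf le_rfl) ?_ i
    have heq : sublaplacian n (wordOp l f) =
        wordOp l (shifted n f) - wordOp l f + P (T n f) := by
      rw [shifted_apply, map_add, add_sub_cancel_left]
      exact congrArg (fun Q : Module.End ℂ (Smooth n) => Q f) hLP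
    rw [heq]
    exact ((hlt (hL f hf) le_rfl).sub (hlt hf le_rfl)).add (hPT hP)

end Regularity

/-! ### Group convolution -/

theorem heisMul_heisMul_neg (p q : Heis n) : heisMul (heisMul p q) (-q) = p := by
  ext <;> simp [heisMul, symp_self]; ring

theorem neg_heisMul_heisMul (p q : Heis n) : heisMul (-p) (heisMul p q) = q := by
  ext <;> simp [heisMul, symp_self]; ring

theorem measurePreserving_shear (a : Fin n → ℂ) {c : (Fin n → ℂ) → ℝ} (hc : Continuous c) :
    MeasurePreserving (fun p : Heis n => (a + p.1, c p.1 + p.2)) volume volume :=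
  have : (volume : Measure (Fin n → ℂ)).IsAddHaarMeasure := Measure.pi.isAddHaarMeasure _
  (measurePreserving_add_left volume a).skew_product (g := fun z t => c z + t) (by fun_prop)
    (.of_forall fun z => (measurePreserving_add_left volume (c z)).map_eq)

theorem measurePreserving_heisMul (p : Heis n) : MeasurePreserving (heisMul p) volume volume := by
  convert measurePreserving_shear p.1 (c := fun z => p.2 + symp p.1 z) (by fun_prop) using 2 with q
  ext <;> simp [heisMul]; ring

theorem measurePreserving_heisMul_right (q : Heis n) :
    MeasurePreserving (fun r => heisMul r q) volume volume := by
  convert measurePreserving_shear q.1 (c := fun z => q.2 - symp q.1 z) (by fun_prop) using 2 with p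
  ext <;> simp [heisMul, symp_swap p.1 q.1] <;> ring

theorem contDiff_heisMul_right (q : Heis n) : ContDiff ℝ ∞ fun r : Heis n => heisMul r q :=
  contDiff_heisMul_uncurry.comp (contDiff_id.prodMk contDiff_const)

theorem integral_comp_heisMul_right (f : Heis n → ℂ) (q : Heis n) :
    ∫ r, f (heisMul r q) = ∫ p, f p :=
  (measurePreserving_heisMul_right q).integral_comp
    ((contDiff_heisMul_right q).continuous.measurableEmbedding
      (Function.LeftInverse.injective (g := fun p => heisMul p (-q))
        fun p => heisMul_heisMul_neg p q)) f

/-- Composition with the right translation by `q`, as an operator on smooth functions. -/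
def translateRight (q : Heis n) : Module.End ℂ (Smooth n) :=
  pullback (fun r => heisMul r q) (contDiff_heisMul_right q)

theorem T_translateRight (q : Heis n) (f : Smooth n) :
    T n (translateRight q f) = translateRight q (T n f) := by
  ext p
  have h : HasFDerivAt (fun r => heisMul r q) ((ContinuousLinearMap.fst ℝ (Fin n → ℂ) ℝ).prod
      (.snd ℝ (Fin n → ℂ) ℝ + symp.flip q.1 ∘L .fst ℝ _ ℝ)) p :=
    ((ContinuousLinearMap.fst ℝ (Fin n → ℂ) ℝ).hasFDerivAt.add_const _).prodMk
      (((ContinuousLinearMap.snd ℝ (Fin n → ℂ) ℝ).hasFDerivAt.add_const _).add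
        (symp.flip q.1 ∘L .fst ℝ _ ℝ).hasFDerivAt)
  rw [T, translateRight, fieldOp_pullback_apply, h.fderiv]
  change fderiv ℝ f (heisMul p q) (0, 1 + symp 0 q.1) = fderiv ℝ f (heisMul p q) (0, 1)
  rw [map_zero, zero_apply, add_zero]

theorem integral_T_mul_translateRight {φ : Smooth n} (hφ : φ ∈ testFunctions n) (ψ : Smooth n)
    (q : Heis n) : ∫ r, T n φ r * ψ (heisMul r q) = -∫ r, φ r * T n ψ (heisMul r q) := by
  have h := integral_D_eq_zero (0, 1) (mulOp_mem_testFunctions_left hφ (translateRight q ψ))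
  refine eq_neg_of_add_eq_zero_left (Eq.trans ?_ h)
  change _ = ∫ p, T n (mulOp φ (translateRight q ψ)) p
  have hmul : T n (mulOp φ (translateRight q ψ)) =
      mulOp (T n φ) (translateRight q ψ) + mulOp φ (translateRight q (T n ψ)) := by
    rw [← T_translateRight]
    exact fieldOp_mulOp _ _ _ _
  rw [hmul]
  refine (integral_add (f := mulOp (T n φ) (translateRight q ψ))
    (g := mulOp φ (translateRight q (T n ψ))) ?_ ?_).symm
  · exact integrable_of_mem_testFunctions
      (mulOp_mem_testFunctions_left (T_mem_testFunctions hφ) _)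
  · exact integrable_of_mem_testFunctions (mulOp_mem_testFunctions_left hφ _)

theorem exists_isCompact_heisMul {φ : Smooth n} (hφ : φ ∈ testFunctions n) (p₀ : Heis n) :
    ∃ k : Set (Heis n), IsCompact k ∧
      ∀ p q, p ∈ Metric.ball p₀ 1 → q ∉ k → φ (heisMul p q) = 0 := by
  have hc : Continuous fun z : Heis n × Heis n => heisMul (-z.1) z.2 :=
    contDiff_heisMul_uncurry.continuous.comp (continuous_fst.neg.prodMk continuous_snd)
  refine ⟨_, ((isCompact_closedBall p₀ 1).prod hφ).image hc, fun p q hp hq => ?_⟩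
  by_contra h
  exact hq ⟨(p, heisMul p q), ⟨Metric.ball_subset_closedBall hp, subset_tsupport _ h⟩,
    neg_heisMul_heisMul p q⟩

theorem translate_mem_testFunctions (a : Heis n) {f : Smooth n} (hf : f ∈ testFunctions n) :
    translate a f ∈ testFunctions n := by
  obtain ⟨k, hk, hfk⟩ := exists_isCompact_heisMul hf a
  exact HasCompactSupport.intro hk fun q => hfk a q (Metric.mem_ball_self one_pos)

theorem norm_l2Class_translate (a : Heis n) {f : Smooth n} (hf : f ∈ testFunctions n) :
    ‖l2Class (translate a f)‖ = ‖l2Class f‖ := by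
  refine (sq_eq_sq₀ (norm_nonneg _) (norm_nonneg _)).1 ?_
  rw [norm_l2Class_sq (memLp_of_mem_testFunctions hf),
    norm_l2Class_sq (memLp_of_mem_testFunctions (translate_mem_testFunctions a hf))]
  exact (measurePreserving_heisMul a).integral_comp
    ((contDiff_heisMul a).continuous.measurableEmbedding
      (Function.LeftInverse.injective (neg_heisMul_heisMul a))) fun p => ‖f p‖ ^ 2

theorem locallyIntegrable_conj (g : L2 n) :
    LocallyIntegrable (fun q => starRingEnd ℂ (g q)) volume :=
  (Lp.memLp g).star.locallyIntegrable one_le_two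

theorem inner_l2Class_right (g : L2 n) {f : Smooth n} (hf : MemLp (f : Heis n → ℂ) 2 volume) :
    ⟪g, l2Class f⟫_ℂ = ∫ q, starRingEnd ℂ (g q) * f q := by
  rw [L2.inner_def]
  refine integral_congr_ae ?_
  filter_upwards [coeFn_l2Class hf] with q hq
  rw [hq, RCLike.inner_apply, mul_comm]

theorem contDiff_integral_mul_heisMul {φ : Smooth n} (hφ : φ ∈ testFunctions n)
    {G : Heis n → ℂ} (hG : LocallyIntegrable G volume) :
    ContDiff ℝ ∞ fun p => ∫ q, G q * φ (heisMul p (-q)) := by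
  refine contDiff_iff_contDiffAt.2 fun p₀ => ?_
  obtain ⟨k, hk, hφk⟩ := exists_isCompact_heisMul hφ p₀
  have h := contDiffOn_convolution_right_with_param (𝕜 := ℝ) (n := (⊤ : ℕ∞)) (μ := volume)
    (ContinuousLinearMap.mul ℝ ℂ) (f := G) (g := fun p q => φ (heisMul p q))
    Metric.isOpen_ball hk hφk hG ((contDiff_coe φ).comp contDiff_heisMul_uncurry).contDiffOn
  have hat := (h.contDiffAt (x := (p₀, 0)) ((Metric.isOpen_ball.prod isOpen_univ).mem_nhds
    ⟨Metric.mem_ball_self one_pos, trivial⟩)).comp p₀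
    (contDiffAt_id.prodMk contDiffAt_const :
      ContDiffAt ℝ ∞ (fun p : Heis n => (p, (0 : Heis n))) p₀)
  exact hat.congr_of_eventuallyEq (.of_forall fun p => by simp [convolution])

/-- The group convolution `φ * ḡ`, i.e. `p ↦ ∫ φ(p q⁻¹) ḡ(q) dq`. Convolving from the left commutes
with left-invariant operators; the complex conjugate makes the pairings with test functions inner
products with `g`. -/
def groupConv {φ : Smooth n} (hφ : φ ∈ testFunctions n) (g : L2 n) : Smooth n :=
  ⟨fun p => ∫ q, starRingEnd ℂ (g q) * φ (heisMul p (-q)),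
    contDiff_integral_mul_heisMul hφ (locallyIntegrable_conj g)⟩

theorem groupConv_apply {φ : Smooth n} (hφ : φ ∈ testFunctions n) (g : L2 n) (p : Heis n) :
    groupConv hφ g p = ∫ q, starRingEnd ℂ (g q) * φ (heisMul p (-q)) := rfl

section GroupConv

variable {φ ψ : Smooth n} (hφ : φ ∈ testFunctions n) (hψ : ψ ∈ testFunctions n) (g : L2 n)
include hψ

theorem hasCompactSupport_mul_heisMul (hφ : φ ∈ testFunctions n) :
    HasCompactSupport fun z : Heis n × Heis n => φ z.1 * ψ (heisMul z.1 z.2) := by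
  have hc : Continuous fun z : Heis n × Heis n => (z.1, heisMul (-z.1) z.2) :=
    continuous_fst.prodMk (contDiff_heisMul_uncurry.continuous.comp
      (continuous_fst.neg.prodMk continuous_snd))
  refine HasCompactSupport.intro ((IsCompact.prod hφ hψ).image hc) fun z hz => ?_
  by_contra h
  refine hz ⟨(z.1, heisMul z.1 z.2), ⟨subset_tsupport _ (left_ne_zero_of_mul h),
    subset_tsupport _ (right_ne_zero_of_mul h)⟩, ?_⟩
  exact Prod.ext rfl (neg_heisMul_heisMul _ _)

theorem integral_groupConv_mul : ∫ p, groupConv hφ g p * ψ p =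
    ∫ q, starRingEnd ℂ (g q) * ∫ r, φ r * ψ (heisMul r q) := by
  have hcont : Continuous fun z : Heis n × Heis n => ψ z.1 * φ (heisMul z.1 (-z.2)) :=
    ((contDiff_coe ψ).continuous.comp continuous_fst).mul ((contDiff_coe φ).continuous.comp
      (contDiff_heisMul_uncurry.continuous.comp (continuous_fst.prodMk continuous_snd.neg)))
  have hint := integrable_mul_comp_snd_of_hasCompactSupport (μ := volume) hcont
    ((hasCompactSupport_mul_heisMul hφ hψ).comp_homeomorph
      ((Homeomorph.refl (Heis n)).prodCongr (Homeomorph.neg (Heis n)))) (locallyIntegrable_conj g)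
  have hswap := integral_integral_swap
    (f := fun p q => ψ p * φ (heisMul p (-q)) * starRingEnd ℂ (g q)) hint
  have hleft (p : Heis n) : groupConv hφ g p * ψ p =
      ∫ q, ψ p * φ (heisMul p (-q)) * starRingEnd ℂ (g q) := by
    rw [groupConv_apply, ← integral_mul_const]
    exact integral_congr_ae (.of_forall fun q => by ring)
  have hright (q : Heis n) : ∫ p, ψ p * φ (heisMul p (-q)) * starRingEnd ℂ (g q) =
      starRingEnd ℂ (g q) * ∫ r, φ r * ψ (heisMul r q) := by
    rw [← integral_comp_heisMul_right _ q, ← integral_const_mul]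
    refine integral_congr_ae (.of_forall fun r => ?_)
    simp only [heisMul_heisMul_neg]
    ring
  simp only [hleft]
  exact hswap.trans (by simp only [hright])

theorem integral_groupConv_mul_eq_integral_inner : ∫ p, groupConv hφ g p * ψ p =
    ∫ r, φ r * ⟪g, l2Class (translate r ψ)⟫_ℂ := by
  have hcont : Continuous fun z : Heis n × Heis n => φ z.1 * ψ (heisMul z.1 z.2) :=
    ((contDiff_coe φ).continuous.comp continuous_fst).mul
      ((contDiff_coe ψ).continuous.comp contDiff_heisMul_uncurry.continuous)
  have hswap := integral_integral_swap
    (f := fun r q => φ r * ψ (heisMul r q) * starRingEnd ℂ (g q))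
    (integrable_mul_comp_snd_of_hasCompactSupport (μ := volume)
    hcont (hasCompactSupport_mul_heisMul hψ hφ) (locallyIntegrable_conj g))
  rw [integral_groupConv_mul hφ hψ]
  have hleft (q : Heis n) : starRingEnd ℂ (g q) * ∫ r, φ r * ψ (heisMul r q) =
      ∫ r, φ r * ψ (heisMul r q) * starRingEnd ℂ (g q) := by
    rw [integral_mul_const, mul_comm]
  have hright (r : Heis n) : φ r * ⟪g, l2Class (translate r ψ)⟫_ℂ =
      ∫ q, φ r * ψ (heisMul r q) * starRingEnd ℂ (g q) := by
    rw [inner_l2Class_right g (memLp_of_mem_testFunctions (translate_mem_testFunctions r hψ)),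
      ← integral_const_mul]
    exact integral_congr_ae (.of_forall fun q => by simp only [translate_apply]; ring)
  simp only [hleft, hright]
  exact hswap.symm

end GroupConv

theorem memLp_groupConv {φ : Smooth n} (hφ : φ ∈ testFunctions n) (g : L2 n) :
    MemLp (groupConv hφ g : Heis n → ℂ) 2 volume := by
  have hφ1 := (integrable_of_mem_testFunctions hφ).norm
  refine memLp_of_norm_integral_mul_le (C := (∫ r, ‖φ r‖) * ‖g‖)
    (by positivity) fun ψ hψ => ?_
  rw [integral_groupConv_mul_eq_integral_inner hφ hψ, mul_assoc, ← integral_mul_const]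
  refine norm_integral_le_of_norm_le (hφ1.mul_const _) (.of_forall fun r => ?_)
  rw [norm_mul, ← norm_l2Class_translate r hψ]
  exact mul_le_mul_of_nonneg_left (norm_inner_le_norm _ _) (norm_nonneg _)

theorem eq_zero_of_integral_mul_eq_zero {u : Smooth n}
    (h : ∀ ψ ∈ testFunctions n, ∫ p, u p * ψ p = 0) : u = 0 := by
  have hc := (contDiff_coe u).continuous
  have hae : ∀ᵐ p, u p = 0 := by
    refine ae_eq_zero_of_integral_contDiff_smul_eq_zero hc.locallyIntegrable fun ρ hρ hρs => ?_
    refine (integral_congr_ae (.of_forall fun p => ?_)).trans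
      (h ⟨fun p => (ρ p : ℂ), Complex.ofRealCLM.contDiff.comp hρ⟩
        (hρs.comp_left (g := fun x : ℝ => (x : ℂ)) Complex.ofReal_zero))
    simp [mul_comm]
  ext p
  exact congrFun ((Continuous.ae_eq_iff_eq volume hc continuous_zero).1 hae) p

theorem eq_of_integral_mul_eq {u v : Smooth n}
    (h : ∀ ψ ∈ testFunctions n, ∫ p, u p * ψ p = ∫ p, v p * ψ p) : u = v := by
  refine sub_eq_zero.1 (eq_zero_of_integral_mul_eq_zero fun ψ hψ => ?_)
  have hint (w : Smooth n) : Integrable fun p => w p * ψ p :=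
    integrable_of_mem_testFunctions (mulOp_mem_testFunctions_right hψ w)
  rw [← sub_eq_zero.2 (h ψ hψ), ← integral_sub (hint u) (hint v)]
  exact integral_congr_ae (.of_forall fun p => sub_mul _ _ _)

theorem T_groupConv {φ : Smooth n} (hφ : φ ∈ testFunctions n) (g : L2 n) :
    T n (groupConv hφ g) = groupConv (T_mem_testFunctions hφ) g := by
  refine eq_of_integral_mul_eq fun ψ hψ => ?_
  have hT := integral_T_mul_translateRight hψ (groupConv hφ g) 0
  have h0 (r : Heis n) : heisMul r 0 = r := by ext <;> simp [heisMul]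
  simp only [h0] at hT
  have hcomm (u v : Heis n → ℂ) : ∫ p, u p * v p = ∫ p, v p * u p := by simp only [mul_comm]
  rw [hcomm, ← neg_eq_iff_eq_neg.2 hT, hcomm, integral_groupConv_mul hφ (T_mem_testFunctions hψ),
    integral_groupConv_mul _ hψ]
  simp only [integral_T_mul_translateRight hφ, mul_neg, integral_neg]

theorem shifted_translate (a : Heis n) (f : Smooth n) :
    shifted n (translate a f) = translate a (shifted n f) := by
  simp only [shifted_apply, sublaplacian_translate, map_add]

theorem integral_shifted_mul {f : Smooth n} (hf : f ∈ testFunctions n) (g : Smooth n) :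
    ∫ p, shifted n f p * g p = ∫ p, f p * shifted n g p := by
  have hint {u : Smooth n} (hu : u ∈ testFunctions n) (v : Smooth n) :
      Integrable fun p => u p * v p :=
    integrable_of_mem_testFunctions (mulOp_mem_testFunctions_left hu v)
  have hleft (p : Heis n) : shifted n f p * g p = f p * g p + sublaplacian n f p * g p :=
    add_mul _ _ _
  have hright (p : Heis n) : f p * shifted n g p = f p * g p + f p * sublaplacian n g p :=
    mul_add _ _ _
  simp only [hleft, hright]
  rw [integral_add (hint hf g) (hint (sublaplacian_mem_testFunctions hf) g),
    integral_add (hint hf g) (hint hf (sublaplacian n g)), integral_sublaplacian_mul hf]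

theorem inner_resolvent_pow_shifted (m : ℕ) {f h : Smooth n} (hf : f ∈ sobolevInfty n)
    (hh : h ∈ sobolevInfty n) : ⟪(resolvent n ^ m) (l2Class h), l2Class (shifted n f)⟫_ℂ =
      ⟪(resolvent n ^ m) (l2Class (shifted n h)), l2Class f⟫_ℂ := by
  have hcomm : (resolvent n ^ m) (l2Class h) =
      resolvent n ((resolvent n ^ m) (l2Class (shifted n h))) := by
    conv_lhs => rw [← resolvent_shifted hh]
    exact congrArg (fun R : L2 n →L[ℂ] L2 n => R (l2Class (shifted n h)))
      ((pow_succ (resolvent n) m).symm.trans (pow_succ' (resolvent n) m))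
  rw [hcomm, (resolvent_isPositive n).inner_left_eq_inner_right, resolvent_shifted hf]

section

variable {φ h : Smooth n} (hφ : φ ∈ testFunctions n) (hh : h ∈ testFunctions n)
include hh

theorem shifted_groupConv_resolvent_pow (m : ℕ) :
    shifted n (groupConv hφ ((resolvent n ^ m) (l2Class h))) =
      groupConv hφ ((resolvent n ^ m) (l2Class (shifted n h))) := by
  refine eq_of_integral_mul_eq fun ψ hψ => ?_
  have hcomm (u v : Heis n → ℂ) : ∫ p, u p * v p = ∫ p, v p * u p := by simp only [mul_comm]
  rw [hcomm, ← integral_shifted_mul hψ, hcomm,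
    integral_groupConv_mul_eq_integral_inner hφ (shifted_mem_testFunctions hψ),
    integral_groupConv_mul_eq_integral_inner hφ hψ]
  simp only [← shifted_translate, inner_resolvent_pow_shifted m
    (testFunctions_le_sobolevInfty (translate_mem_testFunctions _ hψ))
    (testFunctions_le_sobolevInfty hh)]

theorem groupConv_resolvent_pow_mem_sobolevInfty (m : ℕ) :
    groupConv hφ ((resolvent n ^ m) (l2Class h)) ∈ sobolevInfty n := by
  refine mem_sobolevInfty_of_forall_memLp (W := {u | ∃ (φ : Smooth n) (hφ : φ ∈ testFunctions n),
    ∃ h ∈ testFunctions n, u = groupConv hφ ((resolvent n ^ m) (l2Class h))}) ?_ ?_ ?_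
    ⟨φ, hφ, h, hh, rfl⟩
  · rintro _ ⟨φ, hφ, h, -, rfl⟩
    exact memLp_groupConv hφ _
  · rintro _ ⟨φ, hφ, h, hh, rfl⟩
    exact ⟨φ, hφ, _, shifted_mem_testFunctions hh, shifted_groupConv_resolvent_pow hφ hh m⟩
  · rintro _ ⟨φ, hφ, h, hh, rfl⟩
    exact ⟨_, T_mem_testFunctions hφ, h, hh, T_groupConv hφ _⟩

theorem shifted_pow_groupConv_resolvent_pow (m k : ℕ) :
    (shifted n ^ k) (groupConv hφ ((resolvent n ^ m) (l2Class h))) =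
      groupConv hφ ((resolvent n ^ m) (l2Class ((shifted n ^ k) h))) := by
  induction k generalizing h with
  | zero => rfl
  | succ k ih =>
    rw [shifted_pow_succ_apply, shifted_groupConv_resolvent_pow hφ hh,
      ih (shifted_mem_testFunctions hh), ← shifted_pow_succ_apply]

theorem exists_shifted_pow_eq_groupConv (m : ℕ) :
    ∃ u ∈ sobolevInfty n, (shifted n ^ m) u = groupConv hφ (l2Class h) := by
  refine ⟨_, groupConv_resolvent_pow_mem_sobolevInfty hφ hh m, ?_⟩
  rw [shifted_pow_groupConv_resolvent_pow hφ hh,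
    resolvent_pow_shifted_pow m (testFunctions_le_sobolevInfty hh)]

end

theorem inner_shifted_pow_eq_zero {m : ℕ} {g : L2 n}
    (h : ∀ f ∈ testFunctions n, ⟪g, l2Class ((shifted n ^ m) f)⟫_ℂ = 0) {u : Smooth n}
    (hu : u ∈ sobolevInfty n) : ⟪g, l2Class ((shifted n ^ m) u)⟫_ℂ = 0 := by
  obtain ⟨χ, hχ, hχ1⟩ := exists_cutoff n
  have hlim := tendsto_l2Class_apply_cutoff (shifted_pow_mem_horizontalOps n m) hχ hu
  rw [hχ1.self_of_nhds, Pi.one_apply, one_smul] at hlim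
  refine tendsto_nhds_unique ((continuous_const.inner continuous_id).continuousAt.tendsto.comp hlim)
    (tendsto_const_nhds.congr' ?_)
  filter_upwards [self_mem_nhdsWithin] with ε hε
  exact (h _ (mulOp_mem_testFunctions_left (dilate_mem_testFunctions hχ (ne_of_gt hε)) u)).symm

/-- Composition with the inversion of the group, as an operator on smooth functions. -/
def reflect (n : ℕ) : Module.End ℂ (Smooth n) := pullback (fun p => -p) contDiff_neg

theorem reflect_mem_testFunctions {f : Smooth n} (hf : f ∈ testFunctions n) :
    reflect n f ∈ testFunctions n :=
  HasCompactSupport.comp_homeomorph hf (Homeomorph.neg (Heis n))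

theorem integral_groupConv_reflect_mul {φ ψ : Smooth n} (hφ : φ ∈ testFunctions n)
    (hψ : ψ ∈ testFunctions n) (g : L2 n) :
    ∫ p, groupConv (reflect_mem_testFunctions hφ) g p * ψ p =
      ∫ q, starRingEnd ℂ (g q) * groupConv hφ (l2Class (conjugate ψ)) q := by
  rw [integral_groupConv_mul _ hψ]
  refine integral_congr_ae (.of_forall fun q => congrArg (starRingEnd ℂ (g q) * ·) ?_)
  have hneg (r : Heis n) : -heisMul r (-q) = heisMul q (-r) := by
    ext <;> simp [heisMul, symp_swap q.1 r.1]; ring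
  rw [groupConv_apply, ← integral_comp_heisMul_right _ (-q)]
  refine integral_congr_ae ?_
  filter_upwards [coeFn_l2Class (memLp_of_mem_testFunctions (conjugate_mem_testFunctions hψ))]
    with r hr
  have hinv : heisMul (heisMul r (-q)) q = r := by simpa using heisMul_heisMul_neg r (-q)
  rw [hr, conjugate_apply, Complex.conj_conj, hinv, mul_comm]
  exact congrArg (fun p => ψ r * φ p) (hneg r)

theorem eq_zero_of_forall_groupConv_eq_zero {g : L2 n}
    (h : ∀ (φ : Smooth n) (hφ : φ ∈ testFunctions n), groupConv hφ g = 0) : g = 0 := by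
  have hae : ∀ᵐ q, starRingEnd ℂ (g q) = 0 := by
    refine ae_eq_zero_of_integral_contDiff_smul_eq_zero (locallyIntegrable_conj g)
      fun ρ hρ hρs => ?_
    let φ : Smooth n := ⟨fun p => (ρ p : ℂ), Complex.ofRealCLM.contDiff.comp hρ⟩
    have hφ : φ ∈ testFunctions n :=
      hρs.comp_left (g := fun x : ℝ => (x : ℂ)) Complex.ofReal_zero
    have h0 : groupConv (reflect_mem_testFunctions hφ) g 0 = 0 :=
      congrArg (fun u : Smooth n => u 0) (h _ _)
    refine Eq.trans (integral_congr_ae (.of_forall fun q => ?_)) h0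
    have hq : heisMul 0 (-q) = -q := by ext <;> simp [heisMul]
    change ρ q • _ = _ * ((ρ (-heisMul 0 (-q)) : ℝ) : ℂ)
    rw [hq, neg_neg, Complex.real_smul, mul_comm]
  rw [Lp.eq_zero_iff_ae_eq_zero]
  filter_upwards [hae] with q hq
  simpa using hq

theorem eq_zero_of_inner_shifted_pow_eq_zero (m : ℕ) (g : L2 n)
    (h : ∀ f ∈ testFunctions n, ⟪g, l2Class ((shifted n ^ m) f)⟫_ℂ = 0) : g = 0 := by
  have horth {φ ψ : Smooth n} (hφ : φ ∈ testFunctions n) (hψ : ψ ∈ testFunctions n) :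
      ⟪g, l2Class (groupConv hφ (l2Class (conjugate ψ)))⟫_ℂ = 0 := by
    obtain ⟨u, hu, hum⟩ := exists_shifted_pow_eq_groupConv hφ (conjugate_mem_testFunctions hψ) m
    exact hum ▸ inner_shifted_pow_eq_zero h hu
  have hzero {φ : Smooth n} (hφ : φ ∈ testFunctions n) :
      groupConv (reflect_mem_testFunctions hφ) g = 0 :=
    eq_zero_of_integral_mul_eq_zero fun ψ hψ => by
      rw [integral_groupConv_reflect_mul hφ hψ, ← inner_l2Class_right g (memLp_groupConv hφ _),
        horth hφ hψ]
  refine eq_zero_of_forall_groupConv_eq_zero fun φ hφ => ?_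
  have hrefl : reflect n (reflect n φ) = φ := by
    ext p
    exact congrArg φ (neg_neg p)
  simpa only [hrefl] using hzero (reflect_mem_testFunctions hφ)

/-! ### Functionals bounded by powers of a positive contraction -/

section PositiveContraction

variable {H : Type*} [NormedAddCommGroup H] [InnerProductSpace ℂ H] [CompleteSpace H]
  {a : H →L[ℂ] H}

theorem opPow_eq_cfc (ha : 0 ≤ a) (y : ℝ) : opPow a y = cfc (fun x : ℝ => x ^ y) a :=
  CFC.rpow_eq_cfc_real ha

theorem opPow_add (ha : 0 ≤ a) {x y : ℝ} (hx : 0 ≤ x) (hy : 0 ≤ y) :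
    opPow a (x + y) = opPow a x * opPow a y := by
  have hc {r : ℝ} (hr : 0 ≤ r) : ContinuousOn (fun x : ℝ => x ^ r) (spectrum ℝ a) :=
    (Real.continuous_rpow_const hr).continuousOn
  rw [opPow_eq_cfc ha, opPow_eq_cfc ha, opPow_eq_cfc ha, ← cfc_mul _ _ a (hc hx) (hc hy)]
  exact cfc_congr fun z hz => Real.rpow_add_of_nonneg (spectrum_nonneg_of_nonneg ha hz) hx hy

theorem opPow_natCast (ha : 0 ≤ a) (m : ℕ) : opPow a m = a ^ m := CFC.rpow_natCast a m

theorem opPow_zero (ha : 0 ≤ a) : opPow a 0 = 1 := CFC.rpow_zero a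

theorem opPow_one (ha : 0 ≤ a) : opPow a 1 = a := CFC.rpow_one a

theorem isSelfAdjoint_opPow (ha : 0 ≤ a) (y : ℝ) : IsSelfAdjoint (opPow a y) := by
  rw [opPow_eq_cfc ha]
  exact cfc_predicate _ _

theorem inner_opPow_left (ha : 0 ≤ a) (y : ℝ) (u v : H) :
    ⟪opPow a y u, v⟫_ℂ = ⟪u, opPow a y v⟫_ℂ :=
  (isSelfAdjoint_opPow ha y).isSymmetric u v

theorem norm_sq_cfc_apply {f : ℝ → ℝ} (hf : ContinuousOn f (spectrum ℝ a)) (u : H) :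
    ‖cfc f a u‖ ^ 2 = (⟪cfc (fun x => f x * f x) a u, u⟫_ℂ).re := by
  have hsa : IsSelfAdjoint (cfc f a) := cfc_predicate _ _
  rw [cfc_mul f f a hf hf, mul_apply_eq_comp, ← ContinuousLinearMap.adjoint_inner_right,
    hsa.adjoint_eq]
  exact norm_sq_eq_re_inner (𝕜 := ℂ) _

theorem norm_cfc_apply_le {f g : ℝ → ℝ} (hf : ContinuousOn f (spectrum ℝ a))
    (hg : ContinuousOn g (spectrum ℝ a)) (h : ∀ x ∈ spectrum ℝ a, |f x| ≤ |g x|) (u : H) :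
    ‖cfc f a u‖ ≤ ‖cfc g a u‖ := by
  have hle : cfc (fun x => f x * f x) a ≤ cfc (fun x => g x * g x) a :=
    cfc_mono (fun x hx => abs_le_iff_mul_self_le.1 (h x hx))
  have hpos := ((ContinuousLinearMap.le_def _ _).1 hle).re_inner_nonneg_left u
  rw [sub_apply, inner_sub_left, map_sub] at hpos
  refine le_of_sq_le_sq ?_ (norm_nonneg _)
  rw [norm_sq_cfc_apply hf, norm_sq_cfc_apply hg]
  exact sub_nonneg.1 hpos

theorem spectrum_le_one (ha1 : ‖a‖ ≤ 1) {x : ℝ} (hx : x ∈ spectrum ℝ a) : x ≤ 1 :=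
  calc x ≤ ‖x‖ := le_abs_self x
    _ ≤ ‖a‖ * ‖(1 : H →L[ℂ] H)‖ := spectrum.norm_le_norm_mul_of_mem hx
    _ ≤ 1 := mul_le_one₀ ha1 (norm_nonneg _) ContinuousLinearMap.norm_id_le

theorem norm_opPow_apply_le (ha : 0 ≤ a) (ha1 : ‖a‖ ≤ 1) {y : ℝ} (hy : 0 ≤ y) (u : H) :
    ‖opPow a y u‖ ≤ ‖u‖ := by
  have h := norm_cfc_apply_le (a := a) (f := fun x => x ^ y) (g := fun _ => 1)
    (Real.continuous_rpow_const hy).continuousOn continuousOn_const (fun x hx => by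
      have h0 := spectrum_nonneg_of_nonneg ha hx
      rw [abs_of_nonneg (Real.rpow_nonneg h0 _), abs_one]
      exact Real.rpow_le_one h0 (spectrum_le_one ha1 hx) hy) u
  rwa [← opPow_eq_cfc ha, cfc_const_one ℝ a (IsSelfAdjoint.of_nonneg ha), one_apply_eq_self] at h

/-- A continuous function which is `1` on `(-∞, ε]` and `0` on `[2 ε, ∞)`, used to split a vector
dyadically along the spectrum. -/
def lowPass (ε x : ℝ) : ℝ := max 0 (min 1 (2 - x / ε))

theorem continuous_lowPass (ε : ℝ) : Continuous (lowPass ε) := by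
  unfold lowPass; fun_prop

theorem lowPass_nonneg (ε x : ℝ) : 0 ≤ lowPass ε x := le_max_left _ _

theorem lowPass_le_one (ε x : ℝ) : lowPass ε x ≤ 1 := max_le zero_le_one (min_le_left _ _)

theorem lowPass_eq_one {ε x : ℝ} (hε : 0 < ε) (hx : x ≤ ε) : lowPass ε x = 1 := by
  have : x / ε ≤ 1 := (div_le_one hε).2 hx
  rw [lowPass, min_eq_left (by linarith), max_eq_right zero_le_one]

theorem lowPass_eq_zero {ε x : ℝ} (hε : 0 < ε) (hx : 2 * ε ≤ x) : lowPass ε x = 0 := by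
  have : 2 ≤ x / ε := (le_div_iff₀ hε).2 hx
  exact max_eq_left ((min_le_right _ _).trans (by linarith))

theorem abs_lowPass_sub_lowPass_le {ε x b : ℝ} (hε : 0 < ε) (hx : 0 ≤ x) (hb : 0 ≤ b) :
    |lowPass ε x - lowPass (ε / 4) x| ≤ (4 / ε) ^ b * x ^ b := by
  rcases le_or_gt x (ε / 4) with h | h
  · rw [lowPass_eq_one hε (by linarith), lowPass_eq_one (by linarith) h, sub_self, abs_zero]
    positivity
  · calc |lowPass ε x - lowPass (ε / 4) x| ≤ 1 :=
          abs_sub_le_of_nonneg_of_le (lowPass_nonneg _ _) (lowPass_le_one _ _)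
            (lowPass_nonneg _ _) (lowPass_le_one _ _)
      _ ≤ (4 / ε * x) ^ b :=
          Real.one_le_rpow (by rw [div_mul_eq_mul_div, one_le_div hε]; linarith) hb
      _ = (4 / ε) ^ b * x ^ b := Real.mul_rpow (by positivity) hx

theorem cfc_add_smul_pow (ha : IsSelfAdjoint a) (ε : ℝ) (m : ℕ) :
    cfc (fun x : ℝ => (x + ε * (1 - x)) ^ m) a = (a + (ε : ℂ) • (1 - a)) ^ m := by
  rw [cfc_pow _ _ _ (by fun_prop) ha, cfc_add a (fun x => x) (fun x => ε * (1 - x)),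
    cfc_const_mul ε (fun x => 1 - x), cfc_sub (fun _ => 1) (fun x => x), cfc_id' ℝ _ ha,
    cfc_const_one ℝ _ ha, Complex.coe_smul]

theorem norm_add_smul_pow_cfc_apply_le (ha : 0 ≤ a) (ha1 : ‖a‖ ≤ 1) {ε : ℝ} (hε : 0 < ε) (m : ℕ)
    {b K : ℝ} (hb : 0 ≤ b) (hK : 0 ≤ K) {k : ℝ → ℝ} (hk : Continuous k)
    (hle : ∀ x, 0 ≤ x → |k x| ≤ K * x ^ b) (hzero : ∀ x, 2 * ε ≤ x → k x = 0) (u : H) :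
    ‖((a + (ε : ℂ) • (1 - a)) ^ m) (cfc k a u)‖ ≤ (3 * ε) ^ m * K * ‖opPow a b u‖ := by
  have hF : Continuous fun x : ℝ => (x + ε * (1 - x)) ^ m := by fun_prop
  have hg : ContinuousOn (fun x : ℝ => x ^ b) (spectrum ℝ a) :=
    (Real.continuous_rpow_const hb).continuousOn
  have hpt (x : ℝ) (hx : x ∈ spectrum ℝ a) :
      |(x + ε * (1 - x)) ^ m * k x| ≤ |(3 * ε) ^ m * K * x ^ b| := by
    have hx0 := spectrum_nonneg_of_nonneg ha hx
    have hx1 := mul_nonneg hε.le (sub_nonneg.2 (spectrum_le_one ha1 hx))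
    have hxb := Real.rpow_nonneg hx0 b
    rcases le_or_gt (2 * ε) x with hx2 | hx2
    · rw [hzero x hx2, mul_zero, abs_zero]
      exact abs_nonneg _
    · have hx3 : x + ε * (1 - x) ≤ 3 * ε := by nlinarith
      rw [abs_of_nonneg (mul_nonneg (by positivity) hxb : 0 ≤ (3 * ε) ^ m * K * x ^ b), abs_mul,
        abs_of_nonneg (pow_nonneg (add_nonneg hx0 hx1) m), mul_assoc]
      exact mul_le_mul (pow_le_pow_left₀ (add_nonneg hx0 hx1) hx3 m) (hle x hx0) (abs_nonneg _)
        (by positivity)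
  have h := norm_cfc_apply_le
    (f := fun x => (x + ε * (1 - x)) ^ m * k x) (hF.mul hk).continuousOn
    (hg.const_mul ((3 * ε) ^ m * K)) hpt u
  rwa [cfc_mul _ _ a hF.continuousOn hk.continuousOn, cfc_add_smul_pow (IsSelfAdjoint.of_nonneg ha),
    mul_apply_eq_comp, cfc_const_mul _ _ a hg, ← opPow_eq_cfc ha, smul_apply, norm_smul,
    Real.norm_of_nonneg (by positivity)] at h

section

variable (ha : 0 ≤ a) (ha1 : ‖a‖ ≤ 1) {ℓ : H →ₗ[ℂ] ℂ} {m d : ℕ} {C : ℝ} (hC : 0 ≤ C)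
  (hscale : ∀ r : ℝ, 0 < r → ∀ u,
    ‖ℓ u‖ ≤ C * (r ^ d)⁻¹ * ‖((a + ((r ^ 2 : ℝ) : ℂ) • (1 - a)) ^ m) u‖)
include ha ha1 hC hscale

theorem norm_cfc_band_le {b r : ℝ} (hb : 0 ≤ b) (hr : 0 < r) (u : H) :
    ‖ℓ (cfc (lowPass (r ^ 2)) a u - cfc (lowPass (r ^ 2 / 4)) a u)‖ ≤
      C * 3 ^ m * 4 ^ b * ‖opPow a b u‖ * r ^ (2 * (m - b) - d) := by
  have hr2 : 0 < r ^ 2 := by positivity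
  have h := norm_add_smul_pow_cfc_apply_le ha ha1 hr2 m hb (K := (4 / r ^ 2) ^ b) (by positivity)
    ((continuous_lowPass (r ^ 2)).sub (continuous_lowPass (r ^ 2 / 4)))
    (fun x hx => abs_lowPass_sub_lowPass_le hr2 hx hb) (fun x hx => by
      rw [Pi.sub_apply, lowPass_eq_zero hr2 hx, lowPass_eq_zero (by linarith) (by linarith),
        sub_zero]) u
  have hexp : (r ^ d)⁻¹ * ((r ^ 2) ^ m * ((r ^ 2) ^ b)⁻¹) = r ^ (2 * (m - b) - d) := by
    rw [← Real.rpow_natCast r d, ← Real.rpow_natCast (r ^ 2) m, ← Real.rpow_natCast r 2,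
      ← Real.rpow_mul hr.le, ← Real.rpow_mul hr.le, ← Real.rpow_neg hr.le, ← Real.rpow_neg hr.le,
      ← Real.rpow_add hr, ← Real.rpow_add hr]
    congr 1
    push_cast
    ring
  rw [← sub_apply, ← cfc_sub _ _ a (continuous_lowPass _).continuousOn
    (continuous_lowPass _).continuousOn]
  calc _ ≤ C * (r ^ d)⁻¹ * ((3 * r ^ 2) ^ m * (4 / r ^ 2) ^ b * ‖opPow a b u‖) :=
        (hscale r hr _).trans (by gcongr; exact h)
    _ = C * 3 ^ m * 4 ^ b * ‖opPow a b u‖ * ((r ^ d)⁻¹ * ((r ^ 2) ^ m * ((r ^ 2) ^ b)⁻¹)) := by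
        rw [Real.div_rpow (by norm_num) hr2.le, mul_pow]
        ring
    _ = _ := by rw [hexp]

theorem tendsto_cfc_lowPass (hd : d < 2 * m) (u : H) :
    Tendsto (fun r : ℝ => ℓ (cfc (lowPass (r ^ 2)) a u)) (𝓝[>] 0) (𝓝 0) := by
  have hlim : Tendsto (fun r : ℝ => C * 3 ^ m * ‖u‖ * r ^ (2 * m - d)) (𝓝[>] 0) (𝓝 0) := by
    have h : Continuous fun r : ℝ => C * 3 ^ m * ‖u‖ * r ^ (2 * m - d) := by fun_prop
    exact (h.tendsto' 0 0 (by simp [(Nat.sub_pos_of_lt hd).ne'])).mono_left nhdsWithin_le_nhds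
  refine squeeze_zero_norm' ?_ hlim
  filter_upwards [self_mem_nhdsWithin] with r (hr : 0 < r)
  have hr2 : 0 < r ^ 2 := by positivity
  have h := norm_add_smul_pow_cfc_apply_le ha ha1 hr2 m le_rfl zero_le_one
    (continuous_lowPass (r ^ 2)) (fun x _ => by
      rw [abs_of_nonneg (lowPass_nonneg _ _), Real.rpow_zero, one_mul]
      exact lowPass_le_one _ _) (fun x => lowPass_eq_zero hr2) u
  rw [opPow_zero ha, one_apply_eq_self, mul_one] at h
  calc _ ≤ C * (r ^ d)⁻¹ * ((3 * r ^ 2) ^ m * ‖u‖) :=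
        (hscale r hr _).trans (by gcongr)
    _ = _ := by
        rw [pow_sub₀ _ hr.ne' hd.le, mul_pow, ← pow_mul]
        ring

/-- An abstract Sobolev embedding: since `ℓ` is controlled on every scale `r`, the pieces of `u` in
the spectral bands `x ≈ 4⁻ⁱ` of `a` contribute a geometric series. -/
theorem exists_norm_le_opPow {b : ℝ} (hb : 0 ≤ b) (hd : d < 2 * (m - b)) :
    ∃ C' : ℝ, ∀ u, ‖ℓ u‖ ≤ C' * ‖opPow a b u‖ := by
  set ρ : ℝ := (1 / 2) ^ (2 * (m - b) - d)
  have hρ1 : ρ < 1 := Real.rpow_lt_one (by norm_num) (by norm_num) (by linarith)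
  set r : ℕ → ℝ := fun i => (1 / 2) ^ i with hr
  have hr0 (i : ℕ) : 0 < r i := by positivity
  have hrlim : Tendsto r atTop (𝓝[>] 0) :=
    tendsto_nhdsWithin_iff.2 ⟨tendsto_pow_atTop_nhds_zero_of_lt_one (by norm_num) (by norm_num),
      .of_forall hr0⟩
  have hrρ (i : ℕ) : r i ^ (2 * (m - b) - d) = ρ ^ i :=
    Real.rpow_pow_comm (by norm_num) _ i |>.symm
  refine ⟨C * 3 ^ m * 4 ^ b / (1 - ρ), fun u => ?_⟩
  set M := C * 3 ^ m * 4 ^ b * ‖opPow a b u‖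
  set E : ℕ → H := fun i => cfc (lowPass (r i ^ 2)) a u with hE
  have hE0 : E 0 = u := by
    have h : cfc (lowPass 1) a = cfc (fun _ : ℝ => 1) a :=
      cfc_congr fun x hx => lowPass_eq_one one_pos (spectrum_le_one ha1 hx)
    rw [hE]
    simp only [hr, pow_zero, one_pow]
    rw [h, cfc_const_one ℝ a (IsSelfAdjoint.of_nonneg ha), one_apply_eq_self]
  have hstep (i : ℕ) : ‖ℓ (E i) - ℓ (E (i + 1))‖ ≤ M * ρ ^ i := by
    have h := norm_cfc_band_le ha ha1 hC hscale hb (hr0 i) u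
    have hquarter : r i ^ 2 / 4 = r (i + 1) ^ 2 := by simp only [hr, pow_succ]; ring
    rwa [hrρ, hquarter, map_sub] at h
  have hlim : Tendsto (fun i => ℓ (E i)) atTop (𝓝 0) := by
    have hd' : d < 2 * m := by exact_mod_cast (by linarith : (d : ℝ) < 2 * m)
    exact (tendsto_cfc_lowPass ha ha1 hC hscale hd' u).comp hrlim
  have h := dist_le_of_le_geometric_of_tendsto₀ ρ M hρ1
    (fun i => (dist_eq_norm _ _).trans_le (hstep i)) hlim
  rw [hE0, dist_zero_right] at h
  exact h.trans_eq (by ring)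

end

end PositiveContraction

/-! ### Evaluation at the origin in Sobolev spaces -/

theorem resolvent_nonneg (n : ℕ) : 0 ≤ resolvent n :=
  (ContinuousLinearMap.nonneg_iff_isPositive _).2 (resolvent_isPositive n)

theorem norm_resolvent_le (n : ℕ) : ‖resolvent n‖ ≤ 1 :=
  ContinuousLinearMap.opNorm_le_bound _ zero_le_one fun f => by
    rw [one_mul]; exact norm_resolvent_apply_le f

theorem commute_shifted_pow_shiftedBy (m : ℕ) (ε : ℝ) : Commute (shifted n ^ m) (shiftedBy n ε) :=
  Commute.pow_left ((Commute.one_right _).add_right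
    (Commute.smul_right ((Commute.one_left _).add_left (Commute.refl _)) _)) m

theorem resolvent_add_smul_shifted (ε : ℝ) {f : Smooth n} (hf : f ∈ testFunctions n) :
    (resolvent n + (ε : ℂ) • (1 - resolvent n)) (l2Class (shifted n f)) =
      l2Class (shiftedBy n ε f) := by
  have hf' := testFunctions_le_sobolevInfty hf
  have hL := sublaplacian_mem_sobolevInfty hf'
  rw [add_apply, smul_apply, sub_apply, one_apply_eq_self, resolvent_shifted hf', shifted_apply,
    shiftedBy_apply, l2Class_add hf' hL, l2Class_add hf' (Submodule.smul_mem _ _ hL),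
    l2Class_smul _ hL, add_sub_cancel_left]

theorem resolvent_add_smul_pow_shifted_pow (ε : ℝ) (m : ℕ) {f : Smooth n}
    (hf : f ∈ testFunctions n) :
    ((resolvent n + (ε : ℂ) • (1 - resolvent n)) ^ m) (l2Class ((shifted n ^ m) f)) =
      l2Class ((shiftedBy n ε ^ m) f) := by
  induction m generalizing f with
  | zero => rfl
  | succ m ih =>
    have hcomm : shiftedBy n ε ((shifted n ^ m) f) = (shifted n ^ m) (shiftedBy n ε f) :=
      congrArg (fun P : Module.End ℂ (Smooth n) => P f) (commute_shifted_pow_shiftedBy m ε).eq.symm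
    have hf' : shiftedBy n ε f ∈ testFunctions n := by
      simpa using shiftedBy_pow_mem_testFunctions ε 1 hf
    rw [pow_succ, mul_apply_eq_comp, pow_succ', Module.End.mul_apply,
      resolvent_add_smul_shifted ε (shifted_pow_mem_testFunctions m hf), hcomm, ih hf', pow_succ,
      Module.End.mul_apply]

/-- The map `f ↦ (I + ℒ)^m f` from test functions to `L²`, whose range is dense. -/
def testShift (n m : ℕ) : testFunctions n →ₗ[ℂ] L2 n :=
  sobolevInftyToL2 n ∘ₗ (Submodule.inclusion testFunctions_le_sobolevInfty) ∘ₗ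
    ((shifted n ^ m).restrict fun _ => shifted_pow_mem_testFunctions m)

theorem denseRange_testShift (n m : ℕ) : DenseRange (testShift n m) := by
  have h : (LinearMap.range (testShift n m))ᗮ = ⊥ := (Submodule.eq_bot_iff _).2 fun g hg =>
    eq_zero_of_inner_shifted_pow_eq_zero m g fun f hf =>
      (Submodule.mem_orthogonal' _ _).1 hg _ ⟨⟨f, hf⟩, rfl⟩
  exact Submodule.dense_iff_topologicalClosure_eq_top.2
    (Submodule.topologicalClosure_eq_top_iff.2 h)

/-- Evaluation at the origin, as a functional on test functions. -/
def evalZero (n : ℕ) : testFunctions n →ₗ[ℂ] ℂ :=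
  LinearMap.proj 0 ∘ₗ (Smooth n).subtype ∘ₗ (testFunctions n).subtype

theorem exists_clm_shifted_pow_eq_apply_zero (hn : 1 ≤ n) :
    ∃ (m₀ : ℕ) (C : ℝ), 0 ≤ C ∧ ∀ m ≥ m₀, ∃ ℓ : L2 n →L[ℂ] ℂ,
      (∀ f ∈ testFunctions n, ℓ (l2Class ((shifted n ^ m) f)) = f 0) ∧
      ∀ r : ℝ, 0 < r → ∀ u, ‖ℓ u‖ ≤ C * (r ^ (n + 1))⁻¹ *
        ‖((resolvent n + ((r ^ 2 : ℝ) : ℂ) • (1 - resolvent n)) ^ m) u‖ := by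
  obtain ⟨m₀, C, hC, hb⟩ := exists_norm_apply_zero_le_shiftedBy hn
  refine ⟨m₀, C, hC, fun m hm => ?_⟩
  have hshift (r : ℝ) (f : testFunctions n) :
      ((resolvent n + ((r ^ 2 : ℝ) : ℂ) • (1 - resolvent n)) ^ m) (testShift n m f) =
        l2Class ((shiftedBy n (r ^ 2) ^ m) f) :=
    resolvent_add_smul_pow_shifted_pow (r ^ 2) m f.2
  have hbound (f : testFunctions n) : ‖evalZero n f‖ ≤ C * ‖testShift n m f‖ := by
    have h := hb m hm 1 one_pos f f.2
    rwa [← hshift, one_pow, inv_one, mul_one, one_pow, Complex.ofReal_one, one_smul, add_sub_cancel,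
      one_pow, one_apply_eq_self] at h
  have hext := @exists_extension_of_denseRange ℂ (testFunctions n) (L2 n) _ _ _ _ _ (testShift n m)
  obtain ⟨ℓ, hℓ, hle⟩ := hext (denseRange_testShift n m) hbound
  refine ⟨ℓ, fun f hf => hℓ ⟨f, hf⟩, fun r hr => hle _ (by fun_prop) fun f => ?_⟩
  rw [hshift]
  exact hb m hm r hr f f.2

theorem exists_norm_apply_zero_le_opPow (hn : 1 ≤ n) {s : ℝ} (hs : (n : ℝ) - 1 < s) :
    ∃ (m : ℕ) (C : ℝ), 1 + s / 2 ≤ m ∧ ∀ f ∈ sobolevInfty n,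
      ‖f 0‖ ≤ C * ‖opPow (resolvent n) (m - 1 - s / 2) (l2Class ((shifted n ^ m) f))‖ := by
  obtain ⟨m₀, C, hC, hb⟩ := exists_clm_shifted_pow_eq_apply_zero hn
  obtain ⟨m₁, hm₁⟩ := exists_nat_ge (1 + s / 2)
  have hms : 1 + s / 2 ≤ (max m₀ m₁ : ℕ) := hm₁.trans (by exact_mod_cast le_max_right _ _)
  obtain ⟨ℓ, hℓ, hscale⟩ := hb (max m₀ m₁) (le_max_left _ _)
  obtain ⟨C', hle⟩ := exists_norm_le_opPow (resolvent_nonneg n) (norm_resolvent_le n)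
    (ℓ := ℓ.toLinearMap) hC hscale (b := (max m₀ m₁ : ℕ) - 1 - s / 2) (by linarith)
    (by push_cast; linarith)
  refine ⟨max m₀ m₁, C', hms, fun f hf => ?_⟩
  obtain ⟨χ, hχ, hχ1⟩ := exists_cutoff n
  have hlim := tendsto_l2Class_apply_cutoff (shifted_pow_mem_horizontalOps n (max m₀ m₁)) hχ hf
  rw [hχ1.self_of_nhds, Pi.one_apply, one_smul] at hlim
  have hcutoff : ∀ᶠ ε : ℝ in 𝓝[>] 0,
      ℓ (l2Class ((shifted n ^ max m₀ m₁) (mulOp (dilate ε χ) f))) = f 0 := by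
    filter_upwards [self_mem_nhdsWithin] with ε (hε : 0 < ε)
    rw [hℓ _ (mulOp_mem_testFunctions_left (dilate_mem_testFunctions hχ hε.ne') f), mulOp_apply,
      dilate_apply, map_zero, hχ1.self_of_nhds, Pi.one_apply, one_mul]
  have heq : ℓ (l2Class ((shifted n ^ max m₀ m₁) f)) = f 0 :=
    tendsto_nhds_unique ((ℓ.continuous.tendsto _).comp hlim)
      (tendsto_const_nhds.congr' (hcutoff.mono fun _ h => h.symm))
  exact heq ▸ hle _

namespace Sobolev

variable {s : ℝ≥0}

theorem toL2_eq (u : Sobolev n s) : u.toL2 = besselPotential n s ((ofL2 n s).symm u) :=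
  (congrArg toL2 ((ofL2 n s).apply_symm_apply u)).symm

theorem toL2_injective : Function.Injective (toL2 : Sobolev n s → L2 n) :=
  Submodule.subtype_injective _

theorem inner_eq (u v : Sobolev n s) : ⟪u, v⟫_ℂ = ⟪(ofL2 n s).symm u, (ofL2 n s).symm v⟫_ℂ := rfl

theorem norm_eq (u : Sobolev n s) : ‖u‖ = ‖(ofL2 n s).symm u‖ := rfl

theorem besselPotential_opPow {k : ℕ} (hk : (s : ℝ) / 2 ≤ k) {f : Smooth n}
    (hf : f ∈ sobolevInfty n) :
    besselPotential n s (opPow (resolvent n) (k - s / 2) (l2Class ((shifted n ^ k) f))) =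
      l2Class f := by
  rw [besselPotential, ← mul_apply_eq_comp, ← opPow_add (resolvent_nonneg n) (by positivity)
    (by linarith), add_sub_cancel, opPow_natCast (resolvent_nonneg n),
    resolvent_pow_shifted_pow k hf]

theorem exists_toL2_eq_l2Class (s : ℝ≥0) {f : Smooth n} (hf : f ∈ sobolevInfty n) :
    ∃ u : Sobolev n s, u.toL2 = l2Class f := by
  obtain ⟨k, hk⟩ := exists_nat_ge ((s : ℝ) / 2)
  exact ⟨ofL2 n s _, besselPotential_opPow hk hf⟩

theorem ofL2_symm_eq {u : Sobolev n s} {f : Smooth n} (hf : f ∈ sobolevInfty n)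
    (hu : u.toL2 = l2Class f) {k : ℕ} (hk : (s : ℝ) / 2 ≤ k) :
    (ofL2 n s).symm u = opPow (resolvent n) (k - s / 2) (l2Class ((shifted n ^ k) f)) := by
  apply besselPotential_injective n s
  rw [besselPotential_opPow hk hf, ← toL2_eq, hu]

end Sobolev

/-! ### Flat functions -/

theorem commute_X (i j : Fin n) : Commute (X i) (X j) := by
  rw [Commute, SemiconjBy, X_eq_V, X_eq_V, V_mul_V]
  simp [frame, symp_single_one, Pi.single_apply, apply_ite Complex.im]

theorem commute_Y (i j : Fin n) : Commute (Y i) (Y j) := by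
  rw [Commute, SemiconjBy, Y_eq_V, Y_eq_V, V_mul_V]
  simp [frame, symp_single_I, Pi.single_apply, apply_ite Complex.re]

theorem exists_wordOp_inl_eq_Xpow (l : List (Fin n)) :
    ∃ α : Fin n → ℕ, wordOp (l.map .inl) = Xpow α := by
  obtain ⟨α, hα⟩ := exists_list_prod_map_eq_prod_ofFn_pow commute_X l
  exact ⟨α, by simp only [wordOp, List.map_map, Function.comp_def, ← X_eq_V, hα, Xpow]⟩

theorem exists_wordOp_inr_eq_Ypow (l : List (Fin n)) :
    ∃ β : Fin n → ℕ, wordOp (l.map .inr) = Ypow β := by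
  obtain ⟨β, hβ⟩ := exists_list_prod_map_eq_prod_ofFn_pow commute_Y l
  exact ⟨β, by simp only [wordOp, List.map_map, Function.comp_def, ← Y_eq_V, hβ, Ypow]⟩

/-- The span of the derivatives `X_{j₁} ⋯ X_{jₖ} f`. -/
def xSpan (f : Smooth n) : Submodule ℂ (Smooth n) :=
  Submodule.span ℂ (Set.range fun l : List (Fin n) => wordOp (l.map .inl) f)

theorem X_mem_xSpan (i : Fin n) {f g : Smooth n} (hg : g ∈ xSpan f) : X i g ∈ xSpan f := by
  have hle : xSpan f ≤ (xSpan f).comap (X i) := Submodule.span_le.2 <| by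
    rintro _ ⟨l, rfl⟩
    exact Submodule.subset_span ⟨i :: l, by simp [X_eq_V, wordOp_cons]⟩
  exact hle hg

theorem Y_wordOp_sub_mem_xSpan (j : Fin n) (l : List (Fin n)) (f : Smooth n) :
    Y j (wordOp (l.map .inl) f) - wordOp (l.map .inl) (Y j f) ∈ xSpan (T n f) := by
  induction l with
  | nil => simp [wordOp]
  | cons i l ih =>
    have hT : T n (wordOp (l.map .inl) f) ∈ xSpan (T n f) := by
      rw [T_wordOp]
      exact Submodule.subset_span ⟨l, rfl⟩
    have hYX := V_V (.inr j) (.inl i) (wordOp (l.map .inl) f)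
    rw [← X_eq_V, ← Y_eq_V] at hYX
    rw [List.map_cons, wordOp_cons, ← X_eq_V, Module.End.mul_apply, Module.End.mul_apply, hYX,
      add_sub_right_comm, ← map_sub]
    exact add_mem (X_mem_xSpan i ih) (Submodule.smul_mem _ _ hT)

/-- The span of the derivatives `X_{j₁} ⋯ X_{jₚ} Y_{k₁} ⋯ Y_{k_q} T^k f`. -/
def orderedSpan (f : Smooth n) : Submodule ℂ (Smooth n) :=
  Submodule.span ℂ (Set.range fun a : List (Fin n) × List (Fin n) × ℕ =>
    wordOp (a.1.map .inl) (wordOp (a.2.1.map .inr) ((T n ^ a.2.2) f)))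

theorem xSpan_le_orderedSpan (l : List (Fin n)) (k : ℕ) (f : Smooth n) :
    xSpan (wordOp (l.map .inr) ((T n ^ k) f)) ≤ orderedSpan f :=
  Submodule.span_mono <| by rintro _ ⟨l', rfl⟩; exact ⟨(l', l, k), rfl⟩

theorem V_mem_orderedSpan (i : Fin n ⊕ Fin n) {f g : Smooth n} (hg : g ∈ orderedSpan f) :
    V i g ∈ orderedSpan f := by
  have hle : orderedSpan f ≤ (orderedSpan f).comap (V i) := Submodule.span_le.2 <| by
    rintro _ ⟨⟨l, l', k⟩, rfl⟩
    cases i with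
    | inl i => exact Submodule.subset_span ⟨(i :: l, l', k), by simp [wordOp_cons]⟩
    | inr j =>
      have hsub := Y_wordOp_sub_mem_xSpan j l (wordOp (l'.map .inr) ((T n ^ k) f))
      rw [T_wordOp, ← Module.End.mul_apply (T n), ← pow_succ'] at hsub
      have hY : wordOp (l.map .inl) (Y j (wordOp (l'.map .inr) ((T n ^ k) f))) ∈ orderedSpan f :=
        Submodule.subset_span ⟨(l, j :: l', k), by simp [Y_eq_V, wordOp_cons]⟩
      have := add_mem (xSpan_le_orderedSpan _ _ _ hsub) hY
      rwa [sub_add_cancel, Y_eq_V] at this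
  exact hle hg

theorem memLp_of_mem_orderedSpan {f g : Smooth n} (hf : f ∈ flatFunctions n)
    (hg : g ∈ orderedSpan f) : MemLp (g : Heis n → ℂ) 2 volume := by
  induction hg using Submodule.span_induction with
  | mem g hg =>
    obtain ⟨⟨l, l', k⟩, rfl⟩ := hg
    obtain ⟨α, hα⟩ := exists_wordOp_inl_eq_Xpow l
    obtain ⟨β, hβ⟩ := exists_wordOp_inr_eq_Ypow l'
    simpa only [hα, hβ] using (hf α β k).1
  | zero => exact MemLp.zero
  | add g h _ _ hg hh => exact hg.add hh
  | smul c g _ hg => exact hg.const_smul c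

theorem flatFunctions_le_sobolevInfty : flatFunctions n ≤ sobolevInfty n := by
  intro f hf l
  refine memLp_of_mem_orderedSpan hf ?_
  induction l with
  | nil => exact Submodule.subset_span ⟨([], [], 0), rfl⟩
  | cons i l ih => rw [wordOp_cons]; exact V_mem_orderedSpan i ih

theorem apply_zero_of_mem_flatFunctions {f : Smooth n} (hf : f ∈ flatFunctions n) : f 0 = 0 := by
  simpa [Xpow, Ypow] using (hf 0 0 0).2

/-- The operators that preserve the test functions and their vanishing near the origin. -/
def localOps (n : ℕ) : Submonoid (Module.End ℂ (Smooth n)) where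
  carrier := {P | ∀ f ∈ testFunctions n, f =ᶠ[𝓝 0] 0 → P f ∈ testFunctions n ∧ P f =ᶠ[𝓝 0] 0}
  mul_mem' hP hQ f hf h0 := hP _ (hQ f hf h0).1 (hQ f hf h0).2
  one_mem' _ hf h0 := ⟨hf, h0⟩

theorem fieldOp_mem_localOps (v : Heis n → Heis n) (hv : ContDiff ℝ ∞ v) :
    fieldOp v hv ∈ localOps n := fun f hf h0 => by
  refine ⟨fieldOp_mem_testFunctions hf hv, ?_⟩
  filter_upwards [h0.fderiv (𝕜 := ℝ)] with p hp
  rw [fieldOp_apply, hp]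
  simp

theorem mem_flatFunctions_of_eventuallyEq {f : Smooth n} (hf : f ∈ testFunctions n)
    (h0 : f =ᶠ[𝓝 0] 0) : f ∈ flatFunctions n := by
  intro α β k
  have hX : Xpow α ∈ localOps n := Submonoid.list_prod_mem _ fun P hP => by
    obtain ⟨j, rfl⟩ := (List.mem_ofFn' _ _).1 hP
    exact pow_mem (fieldOp_mem_localOps _ _) _
  have hY : Ypow β ∈ localOps n := Submonoid.list_prod_mem _ fun P hP => by
    obtain ⟨j, rfl⟩ := (List.mem_ofFn' _ _).1 hP
    exact pow_mem (fieldOp_mem_localOps _ _) _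
  have hT : T n ^ k ∈ localOps n := pow_mem (fieldOp_mem_localOps _ _) k
  have h := mul_mem hX (mul_mem hY hT) f hf h0
  exact ⟨memLp_of_mem_testFunctions h.1, h.2.self_of_nhds⟩

/-! ### Functions concentrated at the origin -/

section Concentration

variable {P : Module.End ℂ (Smooth n)} {k : ℕ} {χ f : Smooth n}

theorem exists_norm_l2Class_mulOp_dilate_le (hχ : χ ∈ testFunctions n)
    (hf : f ∈ testFunctions n) :
    ∃ C, 0 ≤ C ∧ ∀ r : ℝ, 0 < r → ‖l2Class (mulOp (dilate r χ) f)‖ ≤ C / r ^ (n + 1) := by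
  obtain ⟨M, hM⟩ := exists_norm_apply_le hf
  have hM0 : 0 ≤ M := (norm_nonneg _).trans (hM 0)
  refine ⟨M * ‖l2Class χ‖, by positivity, fun r hr => ?_⟩
  have hd := dilate_mem_testFunctions hχ hr.ne'
  have h : ‖l2Class (mulOp (dilate r χ) f)‖ ≤ M * ‖l2Class (dilate r χ)‖ := by
    refine Lp.norm_le_mul_norm_of_ae_le_mul ?_
    filter_upwards [coeFn_l2Class (memLp_of_mem_testFunctions (mulOp_mem_testFunctions_left hd f)),
      coeFn_l2Class (memLp_of_mem_testFunctions hd)] with p h₁ h₂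
    rw [h₁, h₂, mulOp_apply, norm_mul, mul_comm]
    gcongr
    exact hM p
  rw [norm_l2Class_dilate hr hχ] at h
  exact h.trans_eq (by ring)

theorem exists_norm_l2Class_wordOp_mulOp_dilate_le (l : List (Fin n ⊕ Fin n))
    (hχ : χ ∈ testFunctions n) (hf : f ∈ testFunctions n) :
    ∃ C, 0 ≤ C ∧ ∀ r : ℝ, 1 ≤ r →
      ‖l2Class (wordOp l (mulOp (dilate r χ) f))‖ ≤ C * r ^ l.length / r ^ (n + 1) := by
  induction l using List.reverseRecOn generalizing χ f with
  | nil =>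
    obtain ⟨C, hC, h⟩ := exists_norm_l2Class_mulOp_dilate_le hχ hf
    exact ⟨C, hC, fun r hr => by simpa using h r (by linarith)⟩
  | append_singleton l i ih =>
    obtain ⟨C, hC, h⟩ := ih (V_mem_testFunctions hχ i) hf
    obtain ⟨C', hC', h'⟩ := ih hχ (V_mem_testFunctions hf i)
    refine ⟨C + C', by positivity, fun r hr => ?_⟩
    have hr0 : 0 < r := by linarith
    have h₁ := testFunctions_le_sobolevInfty
      (wordOp_mem_testFunctions l (mulOp_mem_testFunctions_right hf (dilate r (V i χ))))
    have h₂ := testFunctions_le_sobolevInfty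
      (wordOp_mem_testFunctions l (mulOp_mem_testFunctions_right
        (V_mem_testFunctions hf i) (dilate r χ)))
    have hword : wordOp (l ++ [i]) = wordOp l * V i := wordOp_append l [i]
    rw [hword, Module.End.mul_apply, V_mulOp_dilate, map_add, map_smul,
      l2Class_add (Submodule.smul_mem _ _ h₁) h₂, l2Class_smul _ h₁, List.length_append,
      List.length_singleton]
    calc _ ≤ r * ‖l2Class (wordOp l (mulOp (dilate r (V i χ)) f))‖ +
          ‖l2Class (wordOp l (mulOp (dilate r χ) (V i f)))‖ :=
          (norm_add_le _ _).trans_eq <| by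
            rw [norm_smul, Complex.norm_real, Real.norm_of_nonneg hr0.le]
      _ ≤ r * (C * r ^ l.length / r ^ (n + 1)) + C' * r ^ (l.length + 1) / r ^ (n + 1) := by
          gcongr
          · exact h r hr
          · refine (h' r hr).trans ?_
            gcongr
            omega
      _ = (C + C') * r ^ (l.length + 1) / r ^ (n + 1) := by ring

theorem exists_norm_l2Class_apply_mulOp_dilate_le (hP : P ∈ horizontalOps n k)
    (hχ : χ ∈ testFunctions n) (hf : f ∈ testFunctions n) :
    ∃ C, 0 ≤ C ∧ ∀ r : ℝ, 1 ≤ r →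
      ‖l2Class (P (mulOp (dilate r χ) f))‖ ≤ C * r ^ k / r ^ (n + 1) := by
  have hmem {Q : Module.End ℂ (Smooth n)} (hQ : Q ∈ horizontalOps n k) (r : ℝ) :
      Q (mulOp (dilate r χ) f) ∈ sobolevInfty n :=
    testFunctions_le_sobolevInfty
      (apply_mem_testFunctions hQ (mulOp_mem_testFunctions_right hf (dilate r χ)))
  induction hP using Submodule.span_induction with
  | mem _ hP =>
    obtain ⟨l, hl, rfl⟩ := hP
    obtain ⟨C, hC, h⟩ := exists_norm_l2Class_wordOp_mulOp_dilate_le l hχ hf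
    refine ⟨C, hC, fun r hr => (h r hr).trans ?_⟩
    gcongr
    exact hl
  | zero =>
    have h₀ : l2Class (0 : Smooth n) = 0 := (sobolevInftyToL2 n).map_zero
    exact ⟨0, le_rfl, fun r _ => by simp [h₀]⟩
  | add Q Q' hQ hQ' h h' =>
    obtain ⟨C, hC, h⟩ := h
    obtain ⟨C', hC', h'⟩ := h'
    refine ⟨C + C', by positivity, fun r hr => ?_⟩
    rw [LinearMap.add_apply, l2Class_add (hmem hQ r) (hmem hQ' r), add_mul, add_div]
    exact (norm_add_le _ _).trans (add_le_add (h r hr) (h' r hr))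
  | smul c Q hQ h =>
    obtain ⟨C, hC, h⟩ := h
    refine ⟨‖c‖ * C, by positivity, fun r hr => ?_⟩
    rw [LinearMap.smul_apply, l2Class_smul _ (hmem hQ r), norm_smul, mul_assoc, mul_div_assoc]
    gcongr
    exact h r hr

end Concentration

/-! ### Weak convergence and ranges of self-adjoint operators -/

section Hilbert

variable {H : Type*} [NormedAddCommGroup H] [InnerProductSpace ℂ H]

theorem closure_induction_graph {A : H →ₗ.[ℂ] H} {p : H × H → Prop} (hp : IsClosed {z | p z})
    (h : ∀ x : A.domain, p (x, A x)) (x : A.closure.domain) : p (x, A.closure x) := by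
  have hgraph : (A.closure.graph : Set (H × H)) ⊆ closure (A.graph : Set (H × H)) := by
    by_cases hA : A.IsClosable
    · exact hA.graph_closure_eq_closure_graph.ge
    · rw [LinearPMap.closure_def' hA]
      exact subset_closure
  refine closure_minimal ?_ hp (hgraph (LinearPMap.mem_graph _ x))
  rintro ⟨_, _⟩ hz
  obtain ⟨x, rfl, rfl⟩ := (LinearPMap.mem_graph_iff A).1 hz
  exact h x

variable [CompleteSpace H] {a : H →L[ℂ] H}

theorem denseRange_opPow (ha : 0 ≤ a) (hinj : Function.Injective a) {y : ℝ} (hy : 0 ≤ y) :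
    DenseRange (opPow a y) := by
  have hpow := opPow_injective ((ContinuousLinearMap.nonneg_iff_isPositive a).1 ha) hinj hy
  have h : (LinearMap.range (opPow a y).toLinearMap)ᗮ = ⊥ :=
    (Submodule.eq_bot_iff _).2 fun g hg => hpow <| ext_inner_right ℂ fun u => by
      rw [inner_opPow_left ha, map_zero, inner_zero_left]
      exact (Submodule.mem_orthogonal' _ _).1 hg _ ⟨u, rfl⟩
  exact Submodule.dense_iff_topologicalClosure_eq_top.2
    (Submodule.topologicalClosure_eq_top_iff.2 h)

theorem tendsto_inner_of_tendsto_opPow {ι : Type*} {l : Filter ι} (ha : 0 ≤ a)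
    (hinj : Function.Injective a) {y : ℝ} (hy : 0 ≤ y) {u : ι → H} {B : ℝ}
    (hB : ∀ᶠ i in l, ‖u i‖ ≤ B) (hu : Tendsto (fun i => opPow a y (u i)) l (𝓝 0)) (g : H) :
    Tendsto (fun i => ⟪g, u i⟫_ℂ) l (𝓝 0) := by
  rw [Metric.tendsto_nhds]
  intro ε hε
  obtain ⟨_, hw, w, rfl⟩ := Metric.dense_iff.1 (denseRange_opPow ha hinj hy) g
    (ε / (2 * (|B| + 1))) (by positivity)
  rw [Metric.mem_ball, dist_comm, dist_eq_norm] at hw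
  have hlim : Tendsto (fun i => ⟪opPow a y w, u i⟫_ℂ) l (𝓝 0) := by
    simp only [inner_opPow_left ha]
    simpa using (tendsto_const_nhds (x := w)).inner hu
  filter_upwards [hB, Metric.tendsto_nhds.1 hlim (ε / 2) (by positivity)] with i hi hsmall
  rw [dist_zero_right] at hsmall ⊢
  have hdiff : ‖⟪g - opPow a y w, u i⟫_ℂ‖ ≤ ε / 2 :=
    calc _ ≤ ε / (2 * (|B| + 1)) * (|B| + 1) :=
          (norm_inner_le_norm _ _).trans <|
            mul_le_mul hw.le (hi.trans (by linarith [le_abs_self B])) (norm_nonneg _)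
              (by positivity)
      _ = ε / 2 := by field_simp
  calc ‖⟪g, u i⟫_ℂ‖ = ‖⟪g - opPow a y w, u i⟫_ℂ + ⟪opPow a y w, u i⟫_ℂ‖ := by
        rw [← inner_add_left, sub_add_cancel]
    _ ≤ ‖⟪g - opPow a y w, u i⟫_ℂ‖ + ‖⟪opPow a y w, u i⟫_ℂ‖ := norm_add_le _ _
    _ < ε := by linarith

theorem norm_opPow_half_sq_le (ha : 0 ≤ a) (k : ℕ) (u : H) :
    ‖opPow a ((k : ℝ) / 2) u‖ ^ 2 ≤ ‖(a ^ k) u‖ * ‖u‖ := by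
  have hk : (0 : ℝ) ≤ (k : ℝ) / 2 := by positivity
  have hsq : ‖opPow a ((k : ℝ) / 2) u‖ ^ 2 = (⟪(a ^ k) u, u⟫_ℂ).re := by
    have h := norm_sq_eq_re_inner (𝕜 := ℂ) (opPow a ((k : ℝ) / 2) u)
    rwa [← inner_opPow_left ha, ← mul_apply_eq_comp, ← opPow_add ha hk hk, add_halves,
      opPow_natCast ha] at h
  exact hsq.trans_le ((Complex.re_le_norm _).trans (norm_inner_le_norm _ _))

theorem norm_opPow_sq_le (ha : 0 ≤ a) (ha1 : ‖a‖ ≤ 1) {k : ℕ} {y : ℝ} (hy : (k : ℝ) / 2 ≤ y)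
    (u : H) : ‖opPow a y u‖ ^ 2 ≤ ‖(a ^ k) u‖ * ‖u‖ := by
  refine le_trans ?_ (norm_opPow_half_sq_le ha k u)
  rw [← sub_add_cancel y (k / 2), opPow_add ha (by linarith) (by positivity), mul_apply_eq_comp]
  gcongr
  exact norm_opPow_apply_le ha ha1 (by linarith) _

theorem dense_range_of_isSelfAdjoint_closure {A : H →ₗ.[ℂ] H}
    (hA : ∀ x : A.domain, ‖(x : H)‖ ≤ ‖(x : H) + A x‖) (hsa : IsSelfAdjoint A.closure) :
    Dense (Set.range fun x : A.domain => (x : H) + A x) := by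
  have hrange : (LinearMap.range (A.domain.subtype + A.toFun) : Set H) =
      Set.range fun x : A.domain => (x : H) + A x := rfl
  rw [← hrange, Submodule.dense_iff_topologicalClosure_eq_top,
    Submodule.topologicalClosure_eq_top_iff, Submodule.eq_bot_iff]
  intro v hv
  have horth (x : A.closure.domain) : ⟪v, x + A.closure x⟫_ℂ = 0 :=
    closure_induction_graph (p := fun z => ⟪v, z.1 + z.2⟫_ℂ = 0)
      (isClosed_eq (by fun_prop) continuous_const)
      (fun x => (Submodule.mem_orthogonal' _ _).1 hv _ ⟨x, rfl⟩) x
  have hadj (x : A.closure.domain) : ⟪-v, (x : H)⟫_ℂ = ⟪v, A.closure x⟫_ℂ := by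
    have h := horth x
    rw [inner_add_right] at h
    rw [inner_neg_left, neg_eq_of_add_eq_zero_right h]
  have hmem : v ∈ A.closure.adjoint.domain := LinearPMap.mem_adjoint_domain_of_exists v ⟨-v, hadj⟩
  have hgraph : (v, -v) ∈ A.closure.graph := by
    have h := LinearPMap.mem_graph A.closure.adjoint ⟨v, hmem⟩
    rw [LinearPMap.adjoint_apply_eq hsa.dense_domain _ hadj] at h
    exact LinearPMap.isSelfAdjoint_def.1 hsa ▸ h
  obtain ⟨x, hx, hAx⟩ := (LinearPMap.mem_graph_iff _).1 hgraph
  have hle := closure_induction_graph (p := fun z => ‖z.1‖ ≤ ‖z.1 + z.2‖)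
    (isClosed_le (by fun_prop) (by fun_prop)) hA x
  simpa [hx, hAx] using hle

end Hilbert

/-! ### The operator `A` -/

section OpA

variable {s : ℝ≥0}

theorem ae_eq_iff_eq_l2Class {u : L2 n} {f : Smooth n} (hf : f ∈ sobolevInfty n) :
    u =ᵐ[volume] (f : Heis n → ℂ) ↔ u = l2Class f := by
  have h := coeFn_l2Class (memLp_of_mem_sobolevInfty hf)
  exact ⟨fun hu => Lp.ext (hu.trans h.symm), fun hu => hu ▸ h⟩

theorem mem_graphA {u : Sobolev n s × Sobolev n s} : u ∈ graphA n s ↔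
    ∃ f ∈ flatFunctions n, u.1.toL2 = l2Class f ∧ u.2.toL2 = l2Class (sublaplacian n f) := by
  refine exists_congr fun f => and_congr_right fun hf => ?_
  have hf' := flatFunctions_le_sobolevInfty hf
  rw [ae_eq_iff_eq_l2Class hf', ae_eq_iff_eq_l2Class (sublaplacian_mem_sobolevInfty hf')]

theorem eq_zero_of_l2Class_eq_zero {f : Smooth n} (hf : f ∈ sobolevInfty n)
    (h : l2Class f = 0) : f = 0 := by
  have hae : (0 : Heis n → ℂ) =ᵐ[volume] f :=
    (Lp.coeFn_zero _ _ _).symm.trans ((ae_eq_iff_eq_l2Class hf).2 h.symm)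
  exact Subtype.ext
    ((Continuous.ae_eq_iff_eq volume continuous_zero (contDiff_coe f).continuous).1 hae).symm

theorem graph_opA (n : ℕ) (s : ℝ≥0) : (opA n s).graph = graphA n s := by
  refine Submodule.toLinearPMap_graph_eq _ fun u hu h0 => ?_
  obtain ⟨f, hf, h₁, h₂⟩ := mem_graphA.1 hu
  rw [h0, map_zero] at h₁
  obtain rfl := eq_zero_of_l2Class_eq_zero (flatFunctions_le_sobolevInfty hf) h₁.symm
  apply Sobolev.toL2_injective
  rw [h₂, map_zero, map_zero]
  exact (sobolevInftyToL2 n).map_zero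

theorem exists_flat_of_mem_domain (x : (opA n s).domain) : ∃ f ∈ flatFunctions n,
    (x : Sobolev n s).toL2 = l2Class f ∧ (opA n s x).toL2 = l2Class (sublaplacian n f) := by
  have h := LinearPMap.mem_graph (opA n s) x
  rw [graph_opA] at h
  exact mem_graphA.1 h

theorem exists_mem_domain_of_flat {f : Smooth n} (hf : f ∈ flatFunctions n) :
    ∃ x : (opA n s).domain,
      (x : Sobolev n s).toL2 = l2Class f ∧ (opA n s x).toL2 = l2Class (sublaplacian n f) := by
  have hf' := flatFunctions_le_sobolevInfty hf
  obtain ⟨u, hu⟩ := Sobolev.exists_toL2_eq_l2Class s hf'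
  obtain ⟨v, hv⟩ := Sobolev.exists_toL2_eq_l2Class s (sublaplacian_mem_sobolevInfty hf')
  have h : (u, v) ∈ (opA n s).graph := by
    rw [graph_opA]
    exact mem_graphA.2 ⟨f, hf, hu, hv⟩
  obtain ⟨x, rfl, rfl⟩ := (LinearPMap.mem_graph_iff _).1 h
  exact ⟨x, hu, hv⟩

theorem commute_besselPotential_resolvent (n : ℕ) (s : ℝ≥0) :
    Commute (besselPotential n s) (resolvent n) := by
  have hs : (0 : ℝ) ≤ (s : ℝ) / 2 := by positivity
  have h := opPow_add (resolvent_nonneg n) hs zero_le_one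
  rw [add_comm, opPow_add (resolvent_nonneg n) zero_le_one hs, opPow_one (resolvent_nonneg n)] at h
  exact h.symm

/-- On its range, `(I + A)⁻¹` is the resolvent of `ℒ`, acting on `f₀ = (I + ℒ)^{s/2} f`. -/
theorem ofL2_symm_domain (x : (opA n s).domain) :
    (Sobolev.ofL2 n s).symm (x : Sobolev n s) =
      resolvent n ((Sobolev.ofL2 n s).symm ((x : Sobolev n s) + opA n s x)) := by
  obtain ⟨f, hf, h₁, h₂⟩ := exists_flat_of_mem_domain x
  have hf' := flatFunctions_le_sobolevInfty hf
  apply besselPotential_injective n s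
  rw [← mul_apply_eq_comp, (commute_besselPotential_resolvent n s).eq, mul_apply_eq_comp,
    ← Sobolev.toL2_eq, ← Sobolev.toL2_eq, map_add, h₁, h₂,
    ← l2Class_add hf' (sublaplacian_mem_sobolevInfty hf'), ← shifted_apply, resolvent_shifted hf']

theorem norm_le_norm_add_opA (x : (opA n s).domain) :
    ‖(x : Sobolev n s)‖ ≤ ‖(x : Sobolev n s) + opA n s x‖ := by
  rw [Sobolev.norm_eq, Sobolev.norm_eq, ofL2_symm_domain]
  exact norm_resolvent_apply_le _

theorem isFormalAdjoint_opA (n : ℕ) (s : ℝ≥0) : (opA n s).IsFormalAdjoint (opA n s) := by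
  intro x y
  have hsymm : ⟪(x : Sobolev n s), y + opA n s y⟫_ℂ = ⟪x + opA n s x, (y : Sobolev n s)⟫_ℂ := by
    rw [Sobolev.inner_eq, Sobolev.inner_eq, ofL2_symm_domain x, ofL2_symm_domain y]
    exact (resolvent_isPositive n).isSymmetric _ _
  rw [inner_add_left, inner_add_right] at hsymm
  exact (add_left_cancel hsymm).symm

theorem tendsto_inner_concentrated (hs : (s : ℝ) ≤ (n : ℝ) + 1) {χ φ : Smooth n}
    (hχ : χ ∈ testFunctions n) (hφ : φ ∈ testFunctions n) (g : L2 n) :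
    Tendsto (fun r : ℝ => ⟪g, opPow (resolvent n) ((n + 1 : ℕ) - s / 2)
      (l2Class ((shifted n ^ (n + 1)) (mulOp (dilate r χ) φ)))⟫_ℂ) atTop (𝓝 0) := by
  have hmem (r : ℝ) : mulOp (dilate r χ) φ ∈ sobolevInfty n :=
    testFunctions_le_sobolevInfty (mulOp_mem_testFunctions_right hφ (dilate r χ))
  obtain ⟨C, hC, h⟩ := exists_norm_l2Class_mulOp_dilate_le hχ hφ
  obtain ⟨C', hC', h'⟩ := exists_norm_l2Class_apply_mulOp_dilate_le
    (shifted_pow_mem_horizontalOps n (n + 1)) hχ hφ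
  refine tendsto_inner_of_tendsto_opPow (resolvent_nonneg n) (resolvent_injective n)
    (y := (s : ℝ) / 2) (by positivity) (B := √(C * C')) ?_ ?_ g
  · filter_upwards [eventually_ge_atTop 1] with r hr
    have hr0 : 0 < r := by linarith
    refine Real.le_sqrt_of_sq_le ?_
    calc _ ≤ ‖l2Class (mulOp (dilate r χ) φ)‖ *
          ‖l2Class ((shifted n ^ (n + 1)) (mulOp (dilate r χ) φ))‖ := by
          rw [← resolvent_pow_shifted_pow (n + 1) (hmem r)]
          exact norm_opPow_sq_le (resolvent_nonneg n) (norm_resolvent_le n)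
            (by push_cast; linarith) _
      _ ≤ (C / r ^ (n + 1)) * (C' * r ^ (2 * (n + 1)) / r ^ (n + 1)) := by
          gcongr
          · exact h r hr0
          · exact h' r hr
      _ = C * C' := by
          rw [two_mul, pow_add r (n + 1) (n + 1)]
          field_simp
  · have hbessel (r : ℝ) : opPow (resolvent n) ((s : ℝ) / 2) (opPow (resolvent n)
        ((n + 1 : ℕ) - s / 2) (l2Class ((shifted n ^ (n + 1)) (mulOp (dilate r χ) φ)))) =
          l2Class (mulOp (dilate r χ) φ) :=
      Sobolev.besselPotential_opPow (by push_cast; linarith) (hmem r)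
    simp only [hbessel]
    exact squeeze_zero_norm' ((eventually_gt_atTop 0).mono h)
      (tendsto_const_nhds.div_atTop (tendsto_pow_atTop n.succ_ne_zero))

theorem sub_mulOp_dilate_mem_flatFunctions {χ φ : Smooth n}
    (hχ1 : (χ : Heis n → ℂ) =ᶠ[𝓝 0] 1) (hφ : φ ∈ testFunctions n) (r : ℝ) :
    φ - mulOp (dilate r χ) φ ∈ flatFunctions n := by
  refine mem_flatFunctions_of_eventuallyEq
    (sub_mem hφ (mulOp_mem_testFunctions_right hφ _)) ?_
  filter_upwards [((dil r).continuous.tendsto' 0 0 (map_zero _)).eventually hχ1] with p hp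
  change φ p - mulOp (dilate r χ) φ p = 0
  rw [mulOp_apply, dilate_apply, hp, Pi.one_apply, one_mul, sub_self]

theorem dense_domain_opA (hs : (s : ℝ) ≤ (n : ℝ) + 1) :
    Dense ((opA n s).domain : Set (Sobolev n s)) := by
  rw [Submodule.dense_iff_topologicalClosure_eq_top, Submodule.topologicalClosure_eq_top_iff,
    Submodule.eq_bot_iff]
  intro g hg
  have hk : (s : ℝ) / 2 ≤ (n + 1 : ℕ) := by push_cast; linarith
  obtain ⟨χ, hχ, hχ1⟩ := exists_cutoff n
  set g₀ := (Sobolev.ofL2 n s).symm g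
  have horth (φ) (hφ : φ ∈ testFunctions n) : ⟪g₀, opPow (resolvent n) ((n + 1 : ℕ) - s / 2)
      (l2Class ((shifted n ^ (n + 1)) φ))⟫_ℂ = 0 := by
    refine tendsto_nhds_unique (tendsto_const_nhds.congr fun r => ?_)
      (tendsto_inner_concentrated hs hχ hφ g₀)
    have hm := mulOp_mem_testFunctions_right hφ (dilate r χ)
    have hflat := sub_mulOp_dilate_mem_flatFunctions hχ1 hφ r
    obtain ⟨x, hx, -⟩ := exists_mem_domain_of_flat (s := s) hflat
    have hgx : ⟪g, (x : Sobolev n s)⟫_ℂ = 0 := (Submodule.mem_orthogonal' _ _).1 hg _ x.2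
    rw [Sobolev.inner_eq, Sobolev.ofL2_symm_eq (flatFunctions_le_sobolevInfty hflat) hx hk,
      map_sub, l2Class_sub (shifted_pow_mem_sobolevInfty _ (testFunctions_le_sobolevInfty hφ))
        (shifted_pow_mem_sobolevInfty _ (testFunctions_le_sobolevInfty hm)),
      map_sub, inner_sub_right] at hgx
    exact sub_eq_zero.1 hgx
  have hpow : opPow (resolvent n) ((n + 1 : ℕ) - s / 2) g₀ = 0 :=
    eq_zero_of_inner_shifted_pow_eq_zero (n + 1) _ fun f hf =>
      (inner_opPow_left (resolvent_nonneg n) _ _ _).trans (horth f hf)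
  have hg₀ : g₀ = 0 := opPow_injective (resolvent_isPositive n) (resolvent_injective n)
    (by linarith) (hpow.trans (map_zero _).symm)
  exact (LinearEquiv.map_eq_zero_iff _).1 hg₀

/-- Evaluation at the origin is a bounded functional of `(I + ℒ) f ∈ W^{s,2}`, because
`s + 2 > n + 1`. -/
theorem exists_norm_apply_zero_le_norm_shifted (hn : 1 ≤ n) (hs : (n : ℝ) - 1 < s) :
    ∃ C, 0 ≤ C ∧ ∀ f ∈ sobolevInfty n, ∀ u : Sobolev n s, u.toL2 = l2Class (shifted n f) →
      ‖f 0‖ ≤ C * ‖u‖ := by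
  obtain ⟨m, C, hm, hC⟩ := exists_norm_apply_zero_le_opPow hn hs
  obtain ⟨k, rfl⟩ : ∃ k, m = k + 1 := Nat.exists_eq_succ_of_ne_zero <| by
    rintro rfl
    push_cast at hm
    linarith
  push_cast at hm
  refine ⟨max C 0, le_max_right _ _, fun f hf u hu => ?_⟩
  have h := hC f hf
  rw [shifted_pow_succ_apply, Nat.cast_add, Nat.cast_one, add_sub_cancel_right,
    ← Sobolev.ofL2_symm_eq (shifted_mem_sobolevInfty hf) hu (by linarith), ← Sobolev.norm_eq] at h
  exact h.trans (by gcongr; exact le_max_left _ _)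

theorem not_dense_range_add_opA (hn : 1 ≤ n) (hs : (n : ℝ) - 1 < s) :
    ¬ Dense (Set.range fun x : (opA n s).domain => (x : Sobolev n s) + opA n s x) := by
  intro hdense
  obtain ⟨C, hC, hle⟩ := exists_norm_apply_zero_le_norm_shifted hn hs
  obtain ⟨φ, hφ, hφ1⟩ := exists_cutoff n
  have hφ' := testFunctions_le_sobolevInfty hφ
  obtain ⟨w, hw⟩ := Sobolev.exists_toL2_eq_l2Class s (shifted_mem_sobolevInfty hφ')
  obtain ⟨_, hnear, x, rfl⟩ := Metric.dense_iff.1 hdense w (1 / (C + 1)) (by positivity)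
  obtain ⟨f, hf, hx, hAx⟩ := exists_flat_of_mem_domain x
  have hf' := flatFunctions_le_sobolevInfty hf
  have hdiff : (w - ((x : Sobolev n s) + opA n s x)).toL2 = l2Class (shifted n (φ - f)) := by
    rw [map_sub, map_add, hw, hx, hAx, ← l2Class_add hf' (sublaplacian_mem_sobolevInfty hf'),
      ← shifted_apply,
      ← l2Class_sub (shifted_mem_sobolevInfty hφ') (shifted_mem_sobolevInfty hf'), map_sub]
  have h0 : (φ - f) 0 = 1 := by
    change φ 0 - f 0 = 1
    rw [hφ1.self_of_nhds, apply_zero_of_mem_flatFunctions hf, Pi.one_apply, sub_zero]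
  have hone := hle _ (sub_mem hφ' hf') _ hdiff
  rw [h0, norm_one] at hone
  rw [Metric.mem_ball, dist_comm, dist_eq_norm, lt_div_iff₀ (by positivity)] at hnear
  nlinarith [norm_nonneg (w - ((x : Sobolev n s) + opA n s x))]

end OpA

end Heisenberg

end

theorem proposition3p3 (n : ℕ) (hn : 1 ≤ n) (s : ℝ≥0) (hs : (n : ℝ) - 1 < s)
    (hs' : (s : ℝ) ≤ (n : ℝ) + 1) :
    (∀ f ∈ Heisenberg.flatFunctions n, ∃ u : (Heisenberg.opA n s).domain,
      (u : Heisenberg.Sobolev n s).toL2 =ᵐ[volume] (f : Heisenberg.Heis n → ℂ) ∧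
      (Heisenberg.opA n s u).toL2 =ᵐ[volume]
        (Heisenberg.sublaplacian n f : Heisenberg.Heis n → ℂ)) ∧
    Dense ((Heisenberg.opA n s).domain : Set (Heisenberg.Sobolev n s)) ∧
    (Heisenberg.opA n s).IsFormalAdjoint (Heisenberg.opA n s) ∧
    ¬ Dense (Set.range fun u : (Heisenberg.opA n s).domain =>
      (u : Heisenberg.Sobolev n s) + Heisenberg.opA n s u) ∧
    ¬ IsEssentiallySelfAdjoint (Heisenberg.opA n s) := by
  have hrange := Heisenberg.not_dense_range_add_opA hn hs
  refine ⟨fun f hf => ?_, Heisenberg.dense_domain_opA hs', Heisenberg.isFormalAdjoint_opA n s,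
    hrange, fun h => hrange ?_⟩
  · have hf' := Heisenberg.flatFunctions_le_sobolevInfty hf
    obtain ⟨u, hu, hAu⟩ := Heisenberg.exists_mem_domain_of_flat (s := s) hf
    exact ⟨u, (Heisenberg.ae_eq_iff_eq_l2Class hf').2 hu, (Heisenberg.ae_eq_iff_eq_l2Class
      (Heisenberg.sublaplacian_mem_sobolevInfty hf')).2 hAu⟩
  · exact Heisenberg.dense_range_of_isSelfAdjoint_closure Heisenberg.norm_le_norm_add_opA h.2.2
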